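/- **Setting.** Let $h:\mathbb Z^d\to\mathbb C$ satisfy $h(\zeta)=\overline{h(-\zeta)}$, $\sum_y e^{m|y|}|h(y)|<\infty$ for some $m>0$, and: for every $0\neq k\in\mathbb R^d$ there is $y$ with $k\cdot y\ne 0$ and $h(y)\neq 0$. Let $\Omega$ be a topological space with a Borel probability measure $\mu$ and $\mu$-preserving maps $\sigma_x:\Omega\to\Omega$, $x\in\mathbb Z^d$, with $\sigma_0=\mathrm{id}$, $\sigma_x\circ\sigma_y=\sigma_{x+y}$. Let $(\mathbb P_a)_{a\in\Omega}$ be a (measurable) family of probability measures on the path space $\Omega^{[0,\infty)}$ with the product $\sigma$-algebra such that: $\mathbb P_a$ is carried by the right continuous paths with $\omega_0=a$ (this set has outer measure one); $\mathbb P_{\sigma_x a}$ is the image of $\mathbb P_a$ under $(\omega_t)_t\mapsto(\sigma_x\omega_t)_t$; $\mathbb P_a((\omega_{t+s})_{t\ge0}\in\mathcal A)=\mathbb E_a(\mathbb P_{\omega_s}(\mathcal A))$ for $s>0$ and measurable $\mathcal A$; and $\int \mathbb P_a(\omega_t\in A)\,d\mu(a)=\mu(A)$ for $t>0$ and Borel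 $A$. Let $S_t^\dagger$ be the operators on $L^2(\Omega)=L^2(\Omega,\mu;\mathbb C)$ with $\langle g,S_t^\dagger f\rangle=\int\mathbb E_a(\overline{g(\omega_t)}f(\omega_0))\,d\mu(a)$, and let $Bf=\lim_{t\downarrow0}t^{-1}(f-S_t^\dagger f)$, with domain $\mathcal D(B)$ all $f\in L^2(\Omega)$ for which the limit exists in norm. Assume there are $T>0$ and $b,q\in\mathbb R$ such that for all $f\in\mathcal D(B)$ with $\int f\,d\mu=0$ $$\operatorname{Re}\langle f,Bf\rangle\ge\tfrac1T\|f\|^2,\qquad |\operatorname{Im}\langle f,Bf\rangle|\le q\,\bigl|\operatorname{Re}\langle f,Bf\rangle+b\|f\|^2\bigr| .$$ Let $v_0\in L^\infty(\mu)$ be real, $v_x=v_0\circ\sigma_x$, and assume there is $\chi>0$ with $\|B^{-1}(v_x-v_0)\|_{L^2(\Omega)}\ge\chi$ for all $x\ne0$, where $B^{-1}$ is the inverse of $B$ on the mean-zero functions. On $\mathcal H=L^2(\mathbb Z^d\times\Omega)=\ell^2(\mathbb Z^d;L^2(\Omega))$ let $\widehat L_z=\mathrm i\widehat K_z+\mathrm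 i\widehat V+B$, $z\in\mathbb C^d$, where $\widehat K_z\phi(x,\omega)=\sum_\zeta h(\zeta)[\phi(x-\zeta,\omega)-e^{-\mathrm iz\cdot\zeta}\phi(x-\zeta,\sigma_\zeta\omega)]$, $\widehat V\phi(x,\omega)=(v_x(\omega)-v_0(\omega))\phi(x,\omega)$, and $B$ acts on the variable $\omega$, with domain the $\phi$ such that $\phi(x,\cdot)\in\mathcal D(B)$ for all $x$ and $\sum_x\|B\phi(x,\cdot)\|^2<\infty$. For real $\gamma,p,c$ put $$\Sigma(\gamma,p,c)=\{w\in\mathbb C:\operatorname{Re}w\ge\gamma/T,\ |\operatorname{Im}w|\le p(\operatorname{Re}w+c)\}.$$ **Claim.** There are $0<\gamma<1$ and $p,c>0$ such that, with $\Sigma_+^{(0)}=\Sigma(\gamma,p,c)$: (0) $\delta_0\otimes1$ is in the kernels of $\widehat L_0$ and $\widehat L_0^\dagger$, the spectrum of $\widehat L_0$ restricted to $\{\delta_0\otimes1\}^\perp$ is contained in $\Sigma_+^{(0)}$, and for some $C_0<\infty$ every $w\notin\{0\}\cup\Sigma_+^{(0)}$ is in the resolvent set of $\widehat L_0$ with $\|(\widehat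 L_0-w)^{-1}\|\le C_0/\operatorname{dist}(w,\{0\}\cup\Sigma_+^{(0)})$; and there are $\epsilon>0$, $A,C<\infty$, a function $E$ analytic on $\{z\in\mathbb C^d:|z|<\epsilon\}$, and for each $|z|<\epsilon$ numbers $\gamma'=\gamma'(z)$, $c'=c'(z)$ with $$\gamma-A|z|\le\gamma'\le\gamma,\qquad \gamma'>\gamma/4,\qquad c\le c'\le c+A|z|,$$ such that for all $|z|<\epsilon$, with $\Sigma_+^{(z)}=\Sigma(\gamma',p,c')$: (1) $\sigma(\widehat L_z)=\{E(z)\}\cup\sigma_+^{(z)}$ with $\sigma_+^{(z)}\subset\Sigma_+^{(z)}$; (2) $E(z)$ is a non-degenerate (algebraically simple) eigenvalue of $\widehat L_z$ and $|E(z)|<\gamma/(4T)$; (3) every $w\notin\{E(z)\}\cup\Sigma_+^{(z)}$ is in the resolvent set and $$\|(\widehat L_z-wI)^{-1}\|\le\frac{C}{\operatorname{dist}\bigl(w,\{E(z)\}\cup\Sigma_+^{(z)}\bigr)} .$$ -/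

import Mathlib

open MeasureTheory ProbabilityTheory Filter Topology
open scoped ENNReal NNReal

noncomputable section

namespace MarkovAnderson

/-! ### Unbounded operators -/

section Operators

variable {E : Type*} [NormedAddCommGroup E] [NormedSpace ℂ E]

/-- `R` is the bounded two-sided inverse `(A - w)⁻¹` of `A - w : D(A) → E`. -/
structure IsResolventAt (A : E →ₗ.[ℂ] E) (w : ℂ) (R : E →L[ℂ] E) : Prop where
  left_inv : ∀ φ : A.domain, R (A φ - w • (φ : E)) = φ
  right_inv : ∀ ψ : E, ∃ φ : A.domain, (φ : E) = R ψ ∧ A φ - w • (φ : E) = ψ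

/-- The spectrum of an unbounded operator: all `w` for which `A - w` has no bounded inverse. -/
def spec (A : E →ₗ.[ℂ] E) : Set ℂ := {w | ¬ ∃ R : E →L[ℂ] E, IsResolventAt A w R}

/-- `e` is an algebraically simple eigenvalue of `A`: the eigenspace is spanned by one non-zero
vector `φ`, and there are no further generalized eigenvectors (`φ` is not in the range
of `A - e`). -/
def IsNondegenerateEigenvalue (A : E →ₗ.[ℂ] E) (e : ℂ) : Prop :=
  ∃ φ : A.domain, (φ : E) ≠ 0 ∧ A φ = e • (φ : E) ∧
    (∀ η : A.domain, A η = e • (η : E) → ∃ a : ℂ, (η : E) = a • (φ : E)) ∧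
    (∀ η : A.domain, A η - e • (η : E) ≠ φ)

/-- The part of `A` in the subspace `M`: its graph consists of the pairs in the graph of `A` both
of whose entries lie in `M`. -/
def partIn (A : E →ₗ.[ℂ] E) (M : Submodule ℂ E) : M →ₗ.[ℂ] M :=
  (A.graph.comap (M.subtype.prodMap M.subtype)).toLinearPMap

/-- The graph of the generator of a family `S` (formally `S t = exp (-t B)`): the pairs `(f, g)`
with `g = lim_{t ↓ 0} t⁻¹ (f - S t f)` in norm. -/
def generatorGraph (S : ℝ≥0 → E →L[ℂ] E) : Submodule ℂ (E × E) where
  carrier := {fg | Tendsto (fun t : ℝ≥0 => ((t : ℂ)⁻¹) • (fg.1 - S t fg.1)) (𝓝[>] 0) (𝓝 fg.2)}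
  zero_mem' := by simp
  add_mem' := by
    intro a b ha hb
    refine (Tendsto.add ha hb).congr fun t => ?_
    simp only [Prod.fst_add, map_add, ← smul_add]
    congr 1
    abel
  smul_mem' := by
    intro c a ha
    refine (Tendsto.const_smul ha c).congr fun t => ?_
    simp only [Prod.smul_fst, map_smul, ← smul_sub]
    exact smul_comm _ _ _

/-- The generator `B` of `S`, with the sign convention `S t = exp (-t B)`, defined on all `f` for
which `lim_{t ↓ 0} t⁻¹ (f - S t f)` exists in norm. -/
def generator (S : ℝ≥0 → E →L[ℂ] E) : E →ₗ.[ℂ] E := (generatorGraph S).toLinearPMap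

/-- The relation between `S`, the generator and its graph. -/
theorem generator_graph (S : ℝ≥0 → E →L[ℂ] E) : (generator S).graph = generatorGraph S := by
  refine Submodule.toLinearPMap_graph_eq _ ?_
  rintro ⟨f, g⟩ hx hf
  have hx' : Tendsto (fun t : ℝ≥0 => ((t : ℂ)⁻¹) • (f - S t f)) (𝓝[>] 0) (𝓝 g) := hx
  obtain rfl : f = 0 := hf
  simp only [map_zero, sub_zero, smul_zero] at hx'
  exact tendsto_nhds_unique hx' tendsto_const_nhds

/-- The graph of `1 ⊗ A` on `ℓ²(ι) ⊗ E = ℓ²(ι; E)`. -/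
def ampliationGraph (ι : Type*) (A : E →ₗ.[ℂ] E) :
    Submodule ℂ (lp (fun _ : ι => E) 2 × lp (fun _ : ι => E) 2) where
  carrier := {φψ | ∀ x, ((φψ.1 : ι → E) x, (φψ.2 : ι → E) x) ∈ A.graph}
  zero_mem' := fun _ => A.graph.zero_mem
  add_mem' := fun ha hb x => A.graph.add_mem (ha x) (hb x)
  smul_mem' := fun c _ ha x => A.graph.smul_mem c (ha x)

/-- The operator `1 ⊗ A` on `ℓ²(ι; E)`: it acts by `A` on every component, with domain all `φ`
such that `φ x ∈ D(A)` for all `x` and `x ↦ A (φ x)` is square summable. -/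
def ampliation (ι : Type*) (A : E →ₗ.[ℂ] E) :
    lp (fun _ : ι => E) 2 →ₗ.[ℂ] lp (fun _ : ι => E) 2 :=
  (ampliationGraph ι A).toLinearPMap

theorem ampliation_graph (ι : Type*) (A : E →ₗ.[ℂ] E) :
    (ampliation ι A).graph = ampliationGraph ι A := by
  refine Submodule.toLinearPMap_graph_eq _ ?_
  rintro ⟨φ, ψ⟩ hx hφ
  obtain rfl : φ = 0 := hφ
  ext1
  funext x
  exact A.graph_fst_eq_zero_snd (hx x) rfl

/-- Relabelling of the components along a bijection, `φ ↦ φ ∘ e`, as an isometry of `ℓ²`. -/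
def reindex {ι : Type*} (e : ι ≃ ι) :
    lp (fun _ : ι => E) 2 →ₗᵢ[ℂ] lp (fun _ : ι => E) 2 where
  toFun φ := ⟨fun x => φ (e x), by
    have h := lp.memℓp φ
    change Memℓp (fun x => φ (e x)) 2
    rw [memℓp_gen_iff (by norm_num)] at h ⊢
    exact (e.summable_iff (f := fun x => ‖φ x‖ ^ (2 : ℝ≥0∞).toReal)).2 h⟩
  map_add' _ _ := rfl
  map_smul' _ _ := rfl
  norm_map' φ := by
    change ‖(⟨fun x => φ (e x), _⟩ : lp (fun _ : ι => E) 2)‖ = ‖φ‖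
    rw [lp.norm_eq_tsum_rpow (by norm_num), lp.norm_eq_tsum_rpow (by norm_num)]
    congr 1
    exact e.tsum_eq (fun x => ‖φ x‖ ^ (2 : ℝ≥0∞).toReal)

end Operators

/-! ### The model -/

/-- Multiplication by a real function in `L^∞` on `L²`. -/
def mulL2 {Ω : Type*} [MeasurableSpace Ω] {μ : Measure Ω} (u : Lp ℝ ∞ μ) : Lp ℂ 2 μ →L[ℂ] Lp ℂ 2 μ :=
  LinearMap.mkContinuous
    { toFun := fun f => u • f
      map_add' := fun f g => Lp.add_smul u f g
      map_smul' := fun c f => by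
        ext1
        filter_upwards [Lp.coeFn_lpSMul (r := 2) u (c • f), Lp.coeFn_smul c f,
          Lp.coeFn_smul c (u • f : Lp ℂ 2 μ), Lp.coeFn_lpSMul (r := 2) u f] with ω h1 h2 h3 h4
        simp only [RingHom.id_apply]
        rw [h1, h3, Pi.smul_apply', h2, Pi.smul_apply, Pi.smul_apply, h4, Pi.smul_apply']
        exact smul_comm _ _ _ } ‖u‖ (Lp.norm_smul_le u)

theorem norm_mulL2_le {Ω : Type*} [MeasurableSpace Ω] {μ : Measure Ω} (u : Lp ℝ ∞ μ) : ‖mulL2 u‖ ≤ ‖u‖ :=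
  LinearMap.mkContinuous_norm_le _ (norm_nonneg _) _

/-- The Euclidean length of a lattice point. -/
def latticeNorm {d : ℕ} (y : Fin d → ℤ) : ℝ := ‖WithLp.toLp 2 (fun i => (y i : ℝ))‖

/-- A translation invariant hopping kernel on `ℤ^d`: self-adjoint, exponentially bounded and
non-degenerate. -/
structure HoppingKernel (d : ℕ) where
  h : (Fin d → ℤ) → ℂ
  self_adjoint : ∀ ζ, h ζ = starRingEnd ℂ (h (-ζ))
  exp_bounded : ∃ m : ℝ, 0 < m ∧ Summable fun y => Real.exp (m * latticeNorm y) * ‖h y‖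
  nondegenerate : ∀ k : Fin d → ℝ, k ≠ 0 → ∃ y : Fin d → ℤ, ∑ i, k i * (y i : ℝ) ≠ 0 ∧ h y ≠ 0

/-- A right continuous Markov process on `Ω` with invariant measure `μ`, invariant in
distribution under an action of `ℤ^d` by measure preserving maps. The measures `ℙ_a` live on the
product σ-algebra of the path space. The set of right continuous paths need not be measurable;
that `ℙ_a` gives it probability one means that its outer measure is one (which is what `P a`
computes on non-measurable sets). -/
structure ShiftMarkovProcess (d : ℕ) (Ω : Type*) [TopologicalSpace Ω] [MeasurableSpace Ω]
    [BorelSpace Ω] (μ : Measure Ω) where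
  σ : (Fin d → ℤ) → Ω → Ω
  σ_measurePreserving : ∀ x, MeasurePreserving (σ x) μ μ
  σ_zero : σ 0 = id
  σ_add : ∀ x y, σ x ∘ σ y = σ (x + y)
  P : Kernel Ω (ℝ≥0 → Ω)
  isProbabilityMeasure : ∀ a, IsProbabilityMeasure (P a)
  right_continuous : ∀ a,
    P a {ω | (∀ t, ContinuousWithinAt ω (Set.Ici t) t) ∧ ω 0 = a} = 1
  shift_invariant : ∀ a x, P (σ x a) = (P a).map fun ω t => σ x (ω t)
  markov : ∀ s : ℝ≥0, 0 < s → ∀ a, ∀ A : Set (ℝ≥0 → Ω), MeasurableSet A →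
    P a ((fun ω t => ω (t + s)) ⁻¹' A) = ∫⁻ ω, P (ω s) A ∂(P a)
  invariant : ∀ t : ℝ≥0, 0 < t → ∀ A : Set Ω, MeasurableSet A →
    ∫⁻ a, P a {ω | ω t ∈ A} ∂μ = μ A

section Model

variable {d : ℕ} {Ω : Type*} [TopologicalSpace Ω] [MeasurableSpace Ω] [BorelSpace Ω]
  {μ : Measure Ω}

/-- The augmented Hilbert space `L²(ℤ^d × Ω) = ℓ²(ℤ^d; L²(Ω, μ))`. -/
abbrev AugSpace (d : ℕ) (μ : Measure Ω) : Type _ :=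
  lp (fun _ : Fin d → ℤ => Lp ℂ 2 μ) 2

namespace ShiftMarkovProcess

variable (X : ShiftMarkovProcess d Ω μ)

/-- The law of the path when the initial point has distribution `μ`, that is
`A ↦ ∫ ℙ_a(A) dμ(a)`. -/
def law : Measure (ℝ≥0 → Ω) := μ.bind X.P

theorem lintegral_marginal (t : ℝ≥0) (A : Set Ω) (hA : MeasurableSet A) :
    ∫⁻ a, X.P a {ω | ω t ∈ A} ∂μ = μ A := by
  rcases eq_or_ne t 0 with rfl | ht
  · have key : ∀ a, X.P a {ω | ω 0 ∈ A} = A.indicator 1 a := by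
      intro a
      have := X.isProbabilityMeasure a
      have hA' : MeasurableSet {ω : ℝ≥0 → Ω | ω 0 ∈ A} := measurable_pi_apply 0 hA
      by_cases ha : a ∈ A
      · rw [Set.indicator_of_mem ha, Pi.one_apply]
        refine le_antisymm prob_le_one ((X.right_continuous a).symm.le.trans (measure_mono ?_))
        rintro ω ⟨-, h0⟩
        simpa [h0] using ha
      · rw [Set.indicator_of_notMem ha, ← prob_compl_eq_one_iff hA']
        refine le_antisymm prob_le_one ((X.right_continuous a).symm.le.trans (measure_mono ?_))
        rintro ω ⟨-, h0⟩
        simpa [h0] using ha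
    simp only [key]
    exact lintegral_indicator_one hA
  · exact X.invariant t (pos_iff_ne_zero.2 ht) A hA

theorem measurePreserving_eval (t : ℝ≥0) :
    MeasurePreserving (fun ω : ℝ≥0 → Ω => ω t) X.law μ := by
  refine ⟨measurable_pi_apply t, ?_⟩
  ext A hA
  rw [Measure.map_apply (measurable_pi_apply t) hA, law,
    Measure.bind_apply (measurable_pi_apply t hA) X.P.measurable.aemeasurable]
  exact X.lintegral_marginal t A hA

/-- The isometry `f ↦ f(ω_t)` of `L²(Ω, μ)` into the `L²` space of the path. -/
def evalL2 (t : ℝ≥0) : Lp ℂ 2 μ →L[ℂ] Lp ℂ 2 X.law :=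
  (Lp.compMeasurePreservingₗᵢ ℂ _ (X.measurePreserving_eval t)).toContinuousLinearMap

/-- The operator `S_t†` on `L²(Ω, μ)`, determined by
`⟨g, S_t† f⟩ = 𝔼 (conj g(ω_t) f(ω_0))` for all `f`, `g`. -/
def semigroupAdj (t : ℝ≥0) : Lp ℂ 2 μ →L[ℂ] Lp ℂ 2 μ :=
  (X.evalL2 t).adjoint ∘L X.evalL2 0

theorem inner_semigroupAdj (t : ℝ≥0) (f g : Lp ℂ 2 μ) :
    inner ℂ g (X.semigroupAdj t f) = inner ℂ (X.evalL2 t g) (X.evalL2 0 f) := by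
  rw [semigroupAdj, ContinuousLinearMap.comp_apply, ContinuousLinearMap.adjoint_inner_right]

/-- The Markov generator `B` on `L²(Ω, μ)`, with `S_t† = exp (-t B)`. -/
def B : Lp ℂ 2 μ →ₗ.[ℂ] Lp ℂ 2 μ := generator X.semigroupAdj

/-- The operator `f ↦ f ∘ σ_x` on `L²(Ω, μ)`. -/
def shiftL2 (x : Fin d → ℤ) : Lp ℂ 2 μ →ₗᵢ[ℂ] Lp ℂ 2 μ :=
  Lp.compMeasurePreservingₗᵢ ℂ (X.σ x) (X.σ_measurePreserving x)

/-- The potential `v_x = v_0 ∘ σ_x`. -/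
def v (v₀ : Lp ℝ ∞ μ) (x : Fin d → ℤ) : Lp ℝ ∞ μ :=
  Lp.compMeasurePreserving (X.σ x) (X.σ_measurePreserving x) v₀

theorem norm_v_sub_le (v₀ : Lp ℝ ∞ μ) (x : Fin d → ℤ) : ‖X.v v₀ x - v₀‖ ≤ 2 * ‖v₀‖ := by
  refine (norm_sub_le _ _).trans ?_
  rw [v, Lp.norm_compMeasurePreserving, two_mul]

/-- The potential term, `(V̂ φ)(x, ω) = (v_x(ω) - v_0(ω)) φ(x, ω)`. -/
def Vhat (v₀ : Lp ℝ ∞ μ) : AugSpace d μ →L[ℂ] AugSpace d μ :=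
  lp.mapCLM 2 (fun x => mulL2 (X.v v₀ x - v₀)) (K := 2 * ‖v₀‖) (by positivity)
    (fun x => (norm_mulL2_le _).trans (X.norm_v_sub_le v₀ x))

/-- The translation `φ ↦ φ(· - ζ, ·)`. -/
def translate (μ : Measure Ω) (ζ : Fin d → ℤ) : AugSpace d μ →L[ℂ] AugSpace d μ :=
  (reindex (Equiv.subRight ζ)).toContinuousLinearMap

/-- The shift `φ ↦ φ(·, σ_ζ ·)`. -/
def shift (ζ : Fin d → ℤ) : AugSpace d μ →L[ℂ] AugSpace d μ :=
  lp.mapCLM 2 (fun _ => (X.shiftL2 ζ).toContinuousLinearMap) (K := 1) zero_le_one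
    (fun _ => LinearIsometry.norm_toContinuousLinearMap_le _)

/-- The hopping term,
`(K̂_z φ)(x, ω) = ∑_ζ h(ζ) (φ(x - ζ, ω) - exp(-i z·ζ) φ(x - ζ, σ_ζ ω))`.
The series converges absolutely in operator norm if `|Im z|` is at most the rate of exponential
decay of `h`. -/
def Khat (𝓚 : HoppingKernel d) (z : EuclideanSpace ℂ (Fin d)) :
    AugSpace d μ →L[ℂ] AugSpace d μ :=
  ∑' ζ : Fin d → ℤ, 𝓚.h ζ •
    (translate μ ζ -
      Complex.exp (-Complex.I * ∑ i, z i * (ζ i : ℂ)) • (translate μ ζ ∘L X.shift ζ))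

/-- `L̂_z = i K̂_z + i V̂ + B` with the domain of (the ampliation of) `B`. -/
def Lhat (𝓚 : HoppingKernel d) (v₀ : Lp ℝ ∞ μ) (z : EuclideanSpace ℂ (Fin d)) :
    AugSpace d μ →ₗ.[ℂ] AugSpace d μ :=
  (Complex.I • X.Khat 𝓚 z + Complex.I • X.Vhat v₀ : AugSpace d μ →L[ℂ] AugSpace d μ).toLinearMap
    +ᵥ ampliation (Fin d → ℤ) X.B

end ShiftMarkovProcess

/-- The constant function `1` in `L²(Ω, μ)`. -/
def constOne (μ : Measure Ω) [IsProbabilityMeasure μ] : Lp ℂ 2 μ := Lp.const 2 μ 1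

/-- The vector `δ_0 ⊗ 1`. -/
def deltaOne (d : ℕ) (μ : Measure Ω) [IsProbabilityMeasure μ] : AugSpace d μ :=
  lp.single 2 (0 : Fin d → ℤ) (constOne μ)

/-- The truncated sector `{w : Re w ≥ γ / T, |Im w| ≤ p (Re w + c)}`. -/
def truncSector (T γ p c : ℝ) : Set ℂ := {w | γ / T ≤ w.re ∧ |w.im| ≤ p * (w.re + c)}

/-- The description of the spectrum of an operator `L` (to be `L̂_0`) in terms of a truncated
sector: `δ_0 ⊗ 1` is in the kernel of `L` and of its adjoint, the spectrum of the part of `L` in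
the orthogonal complement of `δ_0 ⊗ 1` lies in the sector, and the resolvent of `L` is controlled
by the distance to `0` and the sector. -/
structure UnperturbedSpectrum [IsProbabilityMeasure μ] (L : AugSpace d μ →ₗ.[ℂ] AugSpace d μ)
    (T γ p c : ℝ) : Prop where
  kernel : (deltaOne d μ, 0) ∈ L.graph
  kernel_adjoint : ∀ φ : L.domain, inner ℂ (deltaOne d μ) (L φ) = 0
  spec_part : spec (partIn L (ℂ ∙ deltaOne d μ)ᗮ) ⊆ truncSector T γ p c
  resolvent_bound : ∃ C : ℝ, ∀ w ∉ {0} ∪ truncSector T γ p c,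
    ∃ R, IsResolventAt L w R ∧ ‖R‖ ≤ C / Metric.infDist w ({0} ∪ truncSector T γ p c)

end Model

end MarkovAnderson

end

open MeasureTheory ProbabilityTheory Filter Topology
open scoped ENNReal NNReal

noncomputable section

namespace MarkovAnderson

/-! ### Bounded perturbations of a fixed unbounded operator, and the continuity method -/

section Operators

variable {E : Type*} [NormedAddCommGroup E] [NormedSpace ℂ E]

/-! Write `e` for `δ₀ ⊗ 1`. At `z = 0` the terms `iK̂` and `iV̂` are skew-adjoint, so the real part
of the quadratic form comes from `B` alone. The gap makes it at least `1/T` times the squared norm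
of the fluctuating part `φ₁ = φ - meanPart φ`, and gives nothing on the non-random functions `a(x)`.
Of these, `e` is a true null vector of the operator and of its adjoint. It is lifted to the
eigenvalue `1/T` by adding `T⁻¹|e⟩⟨e|`.

The components `a(x)` with `x ≠ 0` are controlled by the equation rather than by the form. In `(L -
w)φ = f`, with `L` the lifted operator, project site `x` onto mean-zero functions. The hopping term
annihilates `a`, the term `w a` projects to zero, and the potential produces `i a(x)(v_x - v₀)`.
Inverting `B` shows that `φ₁(x) + i a(x) B⁻¹(v_x - v₀)` is bounded by `f` and `φ₁`, so the lower
bound `χ` controls `|a(x)|` (`mean_component_le`, `meanPart_sub_le`). Combined with the form bound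
this handles every bounded `w` with `Re w ≤ γ/T`, for small `γ`. For `w` outside a cone the
numerical range suffices. Together these bound the lifted operator minus `w` below by a multiple of
the distance to the sector (`exists_lowerBound`).

Surjectivity comes from the path measure. The operators `S_t†` form a strongly continuous
contraction semigroup, so `B + l` is invertible for `l > 0`. Invertibility is carried from a large
negative spectral parameter to any `w` off the sector along a segment avoiding the sector
(`exists_resolvent_of_lowerBound`).

The lift is removed by the rank-one formula, whose denominator is `F(z, w) = 1 - l⟨e, R(z, w) e⟩`
with `l = 1/T` and `R` the lifted resolvent. At `z = 0` this is `-w/(l - w)`, with a simple zero at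
`0`. Since `K̂_z` is analytic in `z`, the implicit function theorem produces the analytic eigenvalue
`E(z)` and a resolvent bound on a disc about `0` (`exists_eigenvalue`). Off that disc, a Neumann
series about `L̂₀ - w` works once the sector has been enlarged by a multiple of `|z|`
(`exists_spectral_perturbation`). -/

/-- `R` is the bounded inverse of `A + T`, where `G` is the graph of `A` and `T` is bounded. -/
structure IsBddInverse (G : Submodule ℂ (E × E)) (T R : E →L[ℂ] E) : Prop where
  left_inv : ∀ φ ψ, (φ, ψ) ∈ G → R (ψ + T φ) = φ
  right_mem : ∀ ψ, (R ψ, ψ - T (R ψ)) ∈ G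

theorem mem_graph_vadd_iff (A : E →ₗ.[ℂ] E) (T : E →L[ℂ] E) (φ ψ : E) :
    (φ, ψ) ∈ (T.toLinearMap +ᵥ A).graph ↔ (φ, ψ - T φ) ∈ A.graph := by
  simp only [LinearPMap.mem_graph_iff]
  constructor
  · rintro ⟨y, rfl, hy⟩
    refine ⟨⟨y, y.2⟩, rfl, ?_⟩
    rw [← hy]
    simp [LinearPMap.vadd_apply]
  · rintro ⟨y, rfl, hy⟩
    refine ⟨⟨y, y.2⟩, rfl, ?_⟩
    have h : (T.toLinearMap +ᵥ A) ⟨y, y.2⟩ = T y + A y := rfl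
    rw [h, hy]
    simp

theorem isResolventAt_iff (A : E →ₗ.[ℂ] E) (w : ℂ) (R : E →L[ℂ] E) :
    IsResolventAt A w R ↔ IsBddInverse A.graph (-(w • (1 : E →L[ℂ] E))) R := by
  constructor
  · rintro ⟨h1, h2⟩
    refine ⟨fun φ ψ h => ?_, fun ψ => ?_⟩
    · obtain ⟨y, rfl, rfl⟩ := (LinearPMap.mem_graph_iff A).1 h
      simpa [sub_eq_add_neg] using h1 y
    · obtain ⟨φ, h, h'⟩ := h2 ψ
      rw [LinearPMap.mem_graph_iff]
      refine ⟨φ, h, ?_⟩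
      have : A φ = ψ + w • R ψ := by rw [← h, ← sub_eq_iff_eq_add]; exact h'
      simp [this]
  · rintro ⟨h1, h2⟩
    refine ⟨fun φ => ?_, fun ψ => ?_⟩
    · simpa [sub_eq_add_neg] using h1 φ (A φ) (A.mem_graph φ)
    · obtain ⟨y, hy, hy'⟩ := (LinearPMap.mem_graph_iff A).1 (h2 ψ)
      refine ⟨y, hy, ?_⟩
      simp only at hy hy'
      simp [hy, hy']

/-- The spectral parameter and all bounded terms are moved into the perturbation. Every later
argument then varies a bounded operator over one fixed graph, with no domain to track. -/
theorem isResolventAt_vadd_iff (A : E →ₗ.[ℂ] E) (T : E →L[ℂ] E) (w : ℂ) (R : E →L[ℂ] E) :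
    IsResolventAt (T.toLinearMap +ᵥ A) w R ↔
      IsBddInverse A.graph (T - w • (1 : E →L[ℂ] E)) R := by
  rw [isResolventAt_iff]
  constructor
  · rintro ⟨h1, h2⟩
    refine ⟨fun φ ψ h => ?_, fun ψ => ?_⟩
    · have := h1 φ (ψ + T φ) (by rw [mem_graph_vadd_iff]; simpa using h)
      simpa [sub_eq_add_neg, add_assoc] using this
    · have := h2 ψ
      rw [mem_graph_vadd_iff] at this
      convert this using 2
      simp
      abel
  · rintro ⟨h1, h2⟩
    refine ⟨fun φ ψ h => ?_, fun ψ => ?_⟩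
    · rw [mem_graph_vadd_iff] at h
      simpa [sub_eq_add_neg, add_assoc] using h1 φ _ h
    · rw [mem_graph_vadd_iff]
      convert h2 ψ using 2
      simp
      abel

/-- An operator that is onto and bounded below has a bounded inverse. -/
theorem exists_isBddInverse {G : Submodule ℂ (E × E)} {T : E →L[ℂ] E} {κ : ℝ} (hκ : 0 < κ)
    (hb : ∀ φ ψ, (φ, ψ) ∈ G → κ * ‖φ‖ ≤ ‖ψ + T φ‖)
    (hs : ∀ ψ, ∃ φ, (φ, ψ - T φ) ∈ G) : ∃ R, IsBddInverse G T R := by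
  choose r hr using hs
  have uniq : ∀ φ ψ, (φ, ψ) ∈ G → ψ + T φ = 0 → φ = 0 := by
    intro φ ψ h h0
    have := hb φ ψ h
    rw [h0, norm_zero] at this
    exact norm_le_zero_iff.1 (nonpos_of_mul_nonpos_right this hκ)
  have uniq2 : ∀ φ ψ, (φ, ψ - T φ) ∈ G → φ = r ψ := by
    intro φ ψ h
    have := uniq _ _ (G.sub_mem h (hr ψ)) (by simp)
    exact sub_eq_zero.1 this
  let R₀ : E →ₗ[ℂ] E :=
    { toFun := r
      map_add' := fun a b => (uniq2 _ _ (by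
        have := G.add_mem (hr a) (hr b)
        rwa [Prod.mk_add_mk, ← add_sub_add_comm, ← map_add] at this)).symm
      map_smul' := fun c a => (uniq2 _ _ (by
        have := G.smul_mem c (hr a)
        rwa [Prod.smul_mk, smul_sub, ← map_smul] at this)).symm }
  refine ⟨R₀.mkContinuous κ⁻¹ fun ψ => ?_, fun φ ψ h => ?_, fun ψ => hr ψ⟩
  · have := hb _ _ (hr ψ)
    rw [sub_add_cancel] at this
    change ‖r ψ‖ ≤ _
    rwa [inv_mul_eq_div, le_div_iff₀ hκ, mul_comm]
  · exact (uniq2 _ _ (by simpa using h)).symm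

namespace IsBddInverse

variable {G : Submodule ℂ (E × E)} {T S R : E →L[ℂ] E}

/-- On the graph, `A + T + S = (1 + S R)(A + T)`. -/
theorem add_of_isUnit (h : IsBddInverse G T R) (hu : IsUnit (1 + S * R)) :
    IsBddInverse G (T + S) (R * Ring.inverse (1 + S * R)) := by
  have h1 := Ring.inverse_mul_cancel _ hu
  have h2 := Ring.mul_inverse_cancel _ hu
  refine ⟨fun φ ψ hφ => ?_, fun ψ => ?_⟩
  · have e1 := h.left_inv φ ψ hφ
    have e2 : ψ + (T + S) φ = (1 + S * R) (ψ + T φ) := by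
      simp [mul_apply_eq_comp, e1, add_assoc]
    rw [e2, mul_apply_eq_comp, ← mul_apply_eq_comp (Ring.inverse _), h1]
    simpa using e1
  · set χ := Ring.inverse (1 + S * R) ψ with hχ
    have e2 : χ + S (R χ) = ψ := by
      have := congrArg (fun Z : E →L[ℂ] E => Z ψ) h2
      simpa [mul_apply_eq_comp] using this
    have := h.right_mem χ
    rw [mul_apply_eq_comp, ← hχ]
    convert this using 2
    rw [← e2]
    simp

theorem exists_add [CompleteSpace E] (h : IsBddInverse G T R) (hS : ‖S‖ * ‖R‖ ≤ 1 / 2) :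
    ∃ R', IsBddInverse G (T + S) R' ∧ ‖R'‖ ≤ 2 * ‖R‖ := by
  have hlt : ‖-(S * R)‖ < 1 := by
    rw [norm_neg]
    exact ((norm_mul_le S R).trans hS).trans_lt (by norm_num)
  have hu : IsUnit (1 + S * R) := by
    simpa using isUnit_one_sub_of_norm_lt_one hlt
  have key := h.add_of_isUnit hu
  refine ⟨_, key, ContinuousLinearMap.opNorm_le_bound _ (by positivity) fun ψ => ?_⟩
  set R' := R * Ring.inverse (1 + S * R)
  -- The second resolvent equation, together with `‖S‖‖R‖ ≤ 1/2`, gives the factor 2 without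
  -- estimating `Ring.inverse`.
  have e : R' ψ = R (ψ - S (R' ψ)) := by
    have := h.left_inv _ _ (key.right_mem ψ)
    have e2 : ψ - S (R' ψ) = ψ - (T + S) (R' ψ) + T (R' ψ) := by
      rw [add_apply]; abel
    rw [e2, this]
  have : ‖R' ψ‖ ≤ ‖R‖ * ‖ψ‖ + 1 / 2 * ‖R' ψ‖ := by
    calc ‖R' ψ‖ = ‖R (ψ - S (R' ψ))‖ := by rw [← e]
      _ ≤ ‖R‖ * (‖ψ‖ + ‖S‖ * ‖R' ψ‖) :=
        (R.le_opNorm _).trans (by gcongr; exact (norm_sub_le _ _).trans (by gcongr; exact S.le_opNorm _))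
      _ = ‖R‖ * ‖ψ‖ + (‖S‖ * ‖R‖) * ‖R' ψ‖ := by ring
      _ ≤ _ := by gcongr
  linarith

theorem norm_le (h : IsBddInverse G T R) {κ : ℝ} (hκ : 0 < κ)
    (hb : ∀ φ ψ, (φ, ψ) ∈ G → κ * ‖φ‖ ≤ ‖ψ + T φ‖) : ‖R‖ ≤ κ⁻¹ := by
  refine ContinuousLinearMap.opNorm_le_bound _ (by positivity) fun ψ => ?_
  have := hb _ _ (h.right_mem ψ)
  rw [sub_add_cancel] at this
  rwa [inv_mul_eq_div, le_div_iff₀ hκ, mul_comm]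

/-- The continuity method: invertibility propagates along a segment of bounded perturbations on
which `A + T + s S` is uniformly bounded below. -/
theorem exists_of_segment [CompleteSpace E] (h : IsBddInverse G T R) {κ : ℝ} (hκ : 0 < κ)
    (hb : ∀ s ∈ Set.Icc (0 : ℝ) 1, ∀ φ ψ, (φ, ψ) ∈ G → κ * ‖φ‖ ≤ ‖ψ + (T + (s : ℂ) • S) φ‖) :
    ∃ R', IsBddInverse G (T + S) R' := by
  -- The uniform lower bound keeps every inverse along the way below `κ⁻¹` in norm, so a step of
  -- length `1/N` always stays within the range of the Neumann series.
  obtain ⟨N, hN⟩ := exists_nat_gt (2 * ‖S‖ * κ⁻¹)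
  have hN0 : (0 : ℝ) < N := lt_of_le_of_lt (by positivity) hN
  have step : ∀ k : ℕ, k ≤ N → ∃ R', IsBddInverse G (T + (((k : ℝ) / N : ℝ) : ℂ) • S) R' := by
    intro k
    induction k with
    | zero => intro _; exact ⟨R, by simpa using h⟩
    | succ k ih =>
      intro hk
      obtain ⟨R₁, h₁⟩ := ih (by omega)
      have hk' : (k : ℝ) ≤ N := by exact_mod_cast (by omega : k ≤ N)
      have n1 := h₁.norm_le hκ (hb _ ⟨by positivity, (div_le_one hN0).2 hk'⟩)
      obtain ⟨R₂, h₂, -⟩ := h₁.exists_add (S := ((1 / N : ℝ) : ℂ) • S) (by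
        rw [norm_smul, Complex.norm_real, Real.norm_of_nonneg (by positivity)]
        calc 1 / (N : ℝ) * ‖S‖ * ‖R₁‖ ≤ 1 / N * ‖S‖ * κ⁻¹ := by gcongr
          _ = (‖S‖ * κ⁻¹) / N := by ring
          _ ≤ 1 / 2 := by rw [div_le_iff₀ hN0]; linarith)
      refine ⟨R₂, ?_⟩
      convert h₂ using 1
      rw [add_assoc, ← add_smul]
      congr 2
      push_cast
      ring
  obtain ⟨R', h'⟩ := step N le_rfl
  exact ⟨R', by simpa [div_self hN0.ne'] using h'⟩

end IsBddInverse

end Operators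

/-! ### Rank-one perturbations of an inverse -/

section RankOne

variable {E : Type*} [NormedAddCommGroup E] [InnerProductSpace ℂ E]
  {G : Submodule ℂ (E × E)} {T R : E →L[ℂ] E}

/-- Removing a rank one perturbation. -/
theorem IsBddInverse.sub_rankOne (h : IsBddInverse G T R) (e : E) (l : ℂ)
    (hF : 1 - l * inner ℂ e (R e) ≠ 0) :
    IsBddInverse G (T - l • InnerProductSpace.rankOne ℂ e e)
      (R + (l / (1 - l * inner ℂ e (R e))) •
        (InnerProductSpace.rankOne ℂ (R e) e ∘L R)) := by
  set F := 1 - l * inner ℂ e (R e) with hFdef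
  refine ⟨fun φ ψ hφ => ?_, fun ψ => ?_⟩
  · have e1 := h.left_inv φ ψ hφ
    have e2 : R (ψ + (T - l • InnerProductSpace.rankOne ℂ e e) φ)
        = φ - (l * inner ℂ e φ) • R e := by
      have e0 : ψ + (T - l • InnerProductSpace.rankOne ℂ e e) φ
          = (ψ + T φ) - (l * inner ℂ e φ) • e := by
        simp [smul_smul]; abel
      rw [e0, map_sub, e1, map_smul]
    have e3 : (l / F) * (inner ℂ e φ * F) = l * inner ℂ e φ := by field_simp
    simp only [add_apply, smul_apply,
      ContinuousLinearMap.comp_apply, InnerProductSpace.rankOne_apply, e2]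
    have e4 : inner ℂ e (φ - (l * inner ℂ e φ) • R e) = inner ℂ e φ * F := by
      rw [inner_sub_right, inner_smul_right, hFdef]; ring
    rw [e4, smul_smul, e3]
    abel
  -- The candidate inverse applied to `ψ` is `R` applied to this shifted vector, so its membership
  -- in the graph is that of `R`.
  · have m := h.right_mem (ψ + ((l / F) * inner ℂ e (R ψ)) • e)
    convert m using 2
    · simp [InnerProductSpace.rankOne_apply, smul_smul]
    · have e3 : l * (inner ℂ e (R ψ) + l / F * inner ℂ e (R ψ) * inner ℂ e (R e))
          = l / F * inner ℂ e (R ψ) := by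
        have : l * inner ℂ e (R e) = 1 - F := by rw [hFdef]; ring
        field_simp
        linear_combination (inner ℂ e (R ψ) * l) * this
      have e4 : (R + (l / F) • (InnerProductSpace.rankOne ℂ (R e) e ∘L R)) ψ
          = R (ψ + ((l / F) * inner ℂ e (R ψ)) • e) := by
        simp [smul_smul]
      have e5 : inner ℂ e (R (ψ + ((l / F) * inner ℂ e (R ψ)) • e))
          = inner ℂ e (R ψ) + l / F * inner ℂ e (R ψ) * inner ℂ e (R e) := by
        rw [map_add, map_smul, inner_add_right, inner_smul_right]
      rw [e4, sub_apply, smul_apply, InnerProductSpace.rankOne_apply, e5, smul_smul, e3]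
      abel

end RankOne

/-! ### Generators of contraction semigroups -/

section Semigroup

variable {E : Type*} [NormedAddCommGroup E] [NormedSpace ℂ E]

/-- `S` is a strongly continuous semigroup of contractions. -/
structure IsContractionSemigroup (S : ℝ≥0 → E →L[ℂ] E) : Prop where
  zero : S 0 = 1
  add : ∀ s t, S (s + t) = S s ∘L S t
  norm_le : ∀ t, ‖S t‖ ≤ 1
  tendsto : ∀ f, Tendsto (fun t => S t f) (𝓝[>] 0) (𝓝 f)

theorem mem_generatorGraph_iff (S : ℝ≥0 → E →L[ℂ] E) (f g : E) :
    (f, g) ∈ generatorGraph S ↔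
      Tendsto (fun t : ℝ≥0 => ((t : ℂ)⁻¹) • (f - S t f)) (𝓝[>] 0) (𝓝 g) := Iff.rfl

theorem tendsto_coe_nhdsGT_zero :
    Tendsto (fun t : ℝ≥0 => (t : ℝ)) (𝓝[>] 0) (𝓝[>] 0) := by
  refine tendsto_nhdsWithin_iff.2 ⟨?_, ?_⟩
  · exact (NNReal.continuous_coe.tendsto' 0 0 rfl).mono_left nhdsWithin_le_nhds
  · filter_upwards [self_mem_nhdsWithin] with t ht
    exact NNReal.coe_pos.2 ht

namespace IsContractionSemigroup

variable {S : ℝ≥0 → E →L[ℂ] E} (hS : IsContractionSemigroup S)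
include hS

theorem norm_apply_le (t : ℝ≥0) (f : E) : ‖S t f‖ ≤ ‖f‖ := by
  simpa using (S t).le_of_opNorm_le (hS.norm_le t) f

theorem tendsto_nhds_zero (f : E) : Tendsto (fun t => S t f) (𝓝 0) (𝓝 f) := by
  have h0 : S 0 f = f := by simp [hS.zero]
  rw [Metric.tendsto_nhds]
  intro ε hε
  have := (Metric.tendsto_nhds.1 (hS.tendsto f) ε hε)
  rw [eventually_nhdsWithin_iff] at this
  filter_upwards [this] with t ht
  rcases eq_or_ne t 0 with rfl | h
  · simpa [h0] using hε
  · exact ht (pos_iff_ne_zero.2 h)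

theorem norm_sub_le (s t : ℝ≥0) (f : E) : ‖S (s + t) f - S s f‖ ≤ ‖S t f - f‖ := by
  rw [hS.add, ContinuousLinearMap.comp_apply, ← map_sub]
  exact hS.norm_apply_le _ _

theorem continuous (f : E) : Continuous fun t => S t f := by
  rw [Metric.continuous_iff]
  intro s ε hε
  have := Metric.tendsto_nhds.1 (hS.tendsto_nhds_zero f) ε hε
  obtain ⟨δ, hδ, hd⟩ := Metric.eventually_nhds_iff.1 this
  refine ⟨δ, hδ, fun t ht => ?_⟩
  rcases le_total s t with h | h
  · obtain ⟨r, rfl⟩ := exists_add_of_le h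
    have hr : dist r 0 < δ := by
      simpa [NNReal.dist_eq] using ht
    rw [dist_eq_norm]
    exact (hS.norm_sub_le s r f).trans_lt (by simpa [dist_eq_norm] using hd hr)
  · obtain ⟨r, rfl⟩ := exists_add_of_le h
    have hr : dist r 0 < δ := by
      simpa [NNReal.dist_eq] using ht
    rw [dist_eq_norm, norm_sub_rev]
    exact (hS.norm_sub_le t r f).trans_lt (by simpa [dist_eq_norm] using hd hr)

/-- The difference quotient plus `l` is `(t⁻¹ + l) f - t⁻¹ S_t f`. By contractivity its norm is at
least `l‖f‖` for every `t > 0`, and this passes to the limit. -/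
theorem le_norm_add {f g : E} (h : (f, g) ∈ generatorGraph S) {l : ℝ} (hl : 0 ≤ l) :
    l * ‖f‖ ≤ ‖g + (l : ℂ) • f‖ := by
  rw [mem_generatorGraph_iff] at h
  have h2 := (h.add_const ((l : ℂ) • f)).norm
  refine ge_of_tendsto h2 ?_
  filter_upwards [self_mem_nhdsWithin] with t ht
  have ht : (0 : ℝ) < t := NNReal.coe_pos.2 ht
  have e1 : ((t : ℂ)⁻¹) • (f - S t f) + (l : ℂ) • f
      = (((t : ℝ)⁻¹ + l : ℝ) : ℂ) • f - ((t : ℂ)⁻¹) • S t f := by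
    push_cast
    module
  rw [e1]
  refine le_trans ?_ (norm_sub_norm_le _ _)
  rw [norm_smul, norm_smul, Complex.norm_real, norm_inv, Real.norm_of_nonneg (by positivity)]
  have e2 : ‖((t : ℝ) : ℂ)‖ = t := by simp
  rw [e2]
  have := mul_le_mul_of_nonneg_left (hS.norm_apply_le t f) (inv_nonneg.2 ht.le)
  linarith

variable [CompleteSpace E]

/-- The vector is `x = ∫₀¹ e^{-ls} S_s f ds`. Applying `e^{-lt} S_t` shifts the window of
integration to `[t, 1 + t]`, so only the two endpoints contribute to the derivative at `t = 0`,
giving `(B + l) x = f - e^{-l} S_1 f`. A finite window avoids improper integrals. -/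
theorem exists_mem_generatorGraph (l : ℝ) (f : E) :
    ∃ x, (x, f - (Real.exp (-l) : ℂ) • S 1 f - (l : ℂ) • x) ∈ generatorGraph S := by
  let u : ℝ → E := fun s => (Real.exp (-l * s) : ℂ) • S s.toNNReal f
  have hu : Continuous u := by
    refine Continuous.smul (by fun_prop) ((hS.continuous f).comp continuous_real_toNNReal)
  let I : ℝ → E := fun t => ∫ s in (0 : ℝ)..t, u s
  have hI : ∀ t, HasDerivAt I (u t) t := fun t => hu.integral_hasStrictDerivAt 0 t |>.hasDerivAt
  let x := I 1
  refine ⟨x, ?_⟩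
  have hshift : ∀ t : ℝ≥0, (Real.exp (-l * t) : ℂ) • S t x = I (1 + t) - I t := by
    intro t
    have e1 : (Real.exp (-l * t) : ℂ) • S t x
        = ∫ s in (0 : ℝ)..1, (Real.exp (-l * t) : ℂ) • S t (u s) := by
      rw [intervalIntegral.integral_smul]
      congr 1
      exact ((S t).intervalIntegral_comp_comm (hu.intervalIntegrable 0 1)).symm
    have e2 : ∫ s in (0 : ℝ)..1, (Real.exp (-l * t) : ℂ) • S t (u s)
        = ∫ s in (0 : ℝ)..1, u (s + t) := by
      refine intervalIntegral.integral_congr fun s hs => ?_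
      rw [Set.uIcc_of_le zero_le_one] at hs
      simp only [u, map_smul, smul_smul]
      rw [Real.toNNReal_add hs.1 (NNReal.coe_nonneg t), Real.toNNReal_coe, add_comm s.toNNReal t, hS.add]
      rw [ContinuousLinearMap.comp_apply]
      congr 1
      rw [← Complex.ofReal_mul, ← Real.exp_add]
      congr 2
      ring
    rw [e1, e2, intervalIntegral.integral_comp_add_right, zero_add]
    have := intervalIntegral.integral_add_adjacent_intervals (hu.intervalIntegrable (μ := volume) 0 t)
      (hu.intervalIntegrable (μ := volume) t (1 + t))
    simp only [I]
    rw [← this]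
    abel
  have hd : HasDerivAt (fun t : ℝ => I 1 - (I (1 + t) - I t)) (f - (Real.exp (-l) : ℂ) • S 1 f) 0 := by
    have h1 : HasDerivAt (fun t : ℝ => I (1 + t)) (u 1) 0 := by
      have := (hI (1 + 0)).comp_const_add 1 0
      simpa using this
    have := (h1.fun_sub (hI 0)).const_sub (I 1)
    convert this using 1
    simp [u, hS.zero]
  have hlim := (hasDerivAt_iff_tendsto_slope.1 hd).mono_left
    (nhdsWithin_mono (0 : ℝ) (fun t (ht : t ∈ Set.Ioi (0 : ℝ)) => ne_of_gt ht))
  have hlim' := hlim.comp tendsto_coe_nhdsGT_zero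
  have hexp : HasDerivAt (fun t : ℝ => (Real.exp (-l * t) : ℂ)) (-l : ℂ) 0 := by
    have h1 : HasDerivAt (fun t : ℝ => Real.exp (-l * t)) (-l) 0 := by
      have := ((hasDerivAt_id (0 : ℝ)).const_mul (-l)).exp
      simpa using this
    have := h1.ofReal_comp
    simpa using this
  have hexp' := ((hasDerivAt_iff_tendsto_slope.1 hexp).mono_left
    (nhdsWithin_mono (0 : ℝ) (fun t (ht : t ∈ Set.Ioi (0 : ℝ)) => ne_of_gt ht))).comp
      tendsto_coe_nhdsGT_zero
  -- Here `t⁻¹(x - S_t x)` is split into `t⁻¹(x - e^{-lt} S_t x)` and `t⁻¹(e^{-lt} - 1) S_t x`.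
  have hsum := hlim'.add (hexp'.smul (hS.tendsto x))
  rw [mem_generatorGraph_iff]
  have e : f - (Real.exp (-l) : ℂ) • S 1 f - (l : ℂ) • x
      = f - (Real.exp (-l) : ℂ) • S 1 f + (-(l : ℂ)) • x := by module
  rw [e]
  refine hsum.congr' ?_
  filter_upwards [self_mem_nhdsWithin] with t ht
  simp only [Function.comp_apply, slope_def_module, sub_zero, ← hshift, mul_zero, Real.exp_zero]
  have ez : I 1 - (I (1 + 0) - I 0) = 0 := by simp [I]
  rw [ez, sub_zero]
  have : ∀ (r : ℝ) (y : E), r • y = (r : ℂ) • y := fun r y => by rw [Complex.coe_smul]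
  simp only [this, x, Complex.real_smul]
  push_cast
  module

theorem exists_isBddInverse {l : ℝ} (hl : 0 < l) :
    ∃ R, IsBddInverse (generatorGraph S) ((l : ℂ) • 1) R ∧ ‖R‖ ≤ l⁻¹ := by
  have hb : ∀ φ ψ, (φ, ψ) ∈ generatorGraph S → l * ‖φ‖ ≤ ‖ψ + ((l : ℂ) • (1 : E →L[ℂ] E)) φ‖ :=
    fun φ ψ h => by simpa using hS.le_norm_add h hl.le
  obtain ⟨R, hR⟩ := MarkovAnderson.exists_isBddInverse hl hb (fun ψ => by
    -- The right-hand side `f - e^{-l} S_1 f` is made equal to `ψ` by inverting `1 - e^{-l} S_1`, a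
    -- Neumann series since `l > 0`.
    have hlt : ‖(Real.exp (-l) : ℂ) • S 1‖ < 1 := by
      rw [norm_smul, Complex.norm_real, Real.norm_of_nonneg (Real.exp_pos _).le]
      calc Real.exp (-l) * ‖S 1‖ ≤ Real.exp (-l) * 1 := by gcongr; exact hS.norm_le 1
        _ < 1 := by rw [mul_one]; exact Real.exp_lt_one_iff.2 (by linarith)
    have hu := isUnit_one_sub_of_norm_lt_one hlt
    obtain ⟨x, hx⟩ := hS.exists_mem_generatorGraph l (Ring.inverse (1 - (Real.exp (-l) : ℂ) • S 1) ψ)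
    refine ⟨x, ?_⟩
    convert hx using 2
    have := congrArg (fun Z : E →L[ℂ] E => Z ψ) (Ring.mul_inverse_cancel _ hu)
    simp only [mul_apply_eq_comp, sub_apply, smul_apply, one_apply_eq_self] at this
    rw [this]
    simp)
  exact ⟨R, hR, hR.norm_le hl hb⟩

end IsContractionSemigroup

end Semigroup

/-! ### Indicator functions span a dense subspace of `L²` -/

section Indicators

variable {Ω : Type*} [MeasurableSpace Ω] {μ : Measure Ω} [IsFiniteMeasure μ]

/-- The indicator function of a measurable set as an element of `L²`. -/
def indL2 (μ : Measure Ω) [IsFiniteMeasure μ] {A : Set Ω} (hA : MeasurableSet A) : Lp ℂ 2 μ :=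
  indicatorConstLp 2 hA (measure_ne_top μ A) 1

theorem eq_top_of_indL2_mem (M : Submodule ℂ (Lp ℂ 2 μ)) (hM : IsClosed (M : Set (Lp ℂ 2 μ)))
    (h : ∀ (A : Set Ω) (hA : MeasurableSet A), indL2 μ hA ∈ M) (f : Lp ℂ 2 μ) : f ∈ M := by
  refine Lp.induction (by norm_num) (fun f => f ∈ M) ?_ ?_ hM f
  · intro c s hs hμs
    rw [Lp.simpleFunc.coe_indicatorConst]
    have := M.smul_mem c (h s hs)
    rw [indL2, indicatorConstLp, ← MemLp.toLp_const_smul] at this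
    convert this using 1
    refine MemLp.toLp_congr _ _ (Eventually.of_forall fun x => ?_)
    by_cases hx : x ∈ s <;> simp [hx]
  · intro f g hf hg _ h1 h2
    exact M.add_mem h1 h2

theorem clm_ext_indL2 {F : Type*} [NormedAddCommGroup F] [NormedSpace ℂ F]
    {S T : Lp ℂ 2 μ →L[ℂ] F}
    (h : ∀ (A : Set Ω) (hA : MeasurableSet A), S (indL2 μ hA) = T (indL2 μ hA)) : S = T := by
  ext1 f
  exact eq_top_of_indL2_mem (LinearMap.eqLocus S.toLinearMap T.toLinearMap)
    (isClosed_eq S.continuous T.continuous) h f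

theorem eq_of_inner_indL2 {f g : Lp ℂ 2 μ}
    (h : ∀ (A : Set Ω) (hA : MeasurableSet A), inner ℂ (indL2 μ hA) f = inner ℂ (indL2 μ hA) g) :
    f = g := by
  have : innerSL ℂ f = innerSL ℂ g := clm_ext_indL2 fun A hA => by
    simp only [innerSL_apply_apply]
    rw [← inner_conj_symm, h A hA, inner_conj_symm]
  exact ext_inner_right ℂ fun v => by simpa using congrArg (fun T => T v) this

theorem constOne_eq_indL2 (μ : Measure Ω) [IsProbabilityMeasure μ] : constOne μ = indL2 μ MeasurableSet.univ :=
  (indicatorConstLp_univ 2 μ 1).symm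

end Indicators

/-! ### The Markov semigroup on `L²(Ω)` -/

namespace ShiftMarkovProcess

variable {d : ℕ} {Ω : Type*} [TopologicalSpace Ω] [MeasurableSpace Ω] [BorelSpace Ω]
  {μ : Measure Ω} (X : ShiftMarkovProcess d Ω μ)

instance (a : Ω) : IsProbabilityMeasure (X.P a) := X.isProbabilityMeasure a

theorem norm_evalL2 (t : ℝ≥0) (f : Lp ℂ 2 μ) : ‖X.evalL2 t f‖ = ‖f‖ :=
  (Lp.compMeasurePreservingₗᵢ ℂ _ (X.measurePreserving_eval t)).norm_map f

theorem inner_evalL2 (t : ℝ≥0) (f g : Lp ℂ 2 μ) :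
    inner ℂ (X.evalL2 t f) (X.evalL2 t g) = inner ℂ f g :=
  (Lp.compMeasurePreservingₗᵢ ℂ _ (X.measurePreserving_eval t)).inner_map_map f g

theorem norm_semigroupAdj_le (t : ℝ≥0) : ‖X.semigroupAdj t‖ ≤ 1 := by
  refine (ContinuousLinearMap.opNorm_comp_le _ _).trans ?_
  rw [LinearIsometryEquiv.norm_map]
  have : ∀ s, ‖X.evalL2 s‖ ≤ 1 := fun s => LinearIsometry.norm_toContinuousLinearMap_le _
  exact mul_le_one₀ (this t) (norm_nonneg _) (this 0)

theorem semigroupAdj_zero : X.semigroupAdj 0 = 1 := by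
  ext1 f
  refine ext_inner_left ℂ fun g => ?_
  rw [X.inner_semigroupAdj, inner_evalL2]
  rfl

/-- Writing `U_t` for the isometry `evalL2 t`, one has `S_t† f - f = U_t*(U_0 f - U_t f)` because
`U_t* U_t = 1`. Strong continuity of `S†` thus reduces to continuity of `t ↦ f(ω_t)` in `L²`. -/
theorem norm_semigroupAdj_sub_le (t : ℝ≥0) (f : Lp ℂ 2 μ) :
    ‖X.semigroupAdj t f - f‖ ≤ ‖X.evalL2 0 f - X.evalL2 t f‖ := by
  have e : X.semigroupAdj t f - f = (X.evalL2 t).adjoint (X.evalL2 0 f - X.evalL2 t f) := by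
    refine ext_inner_left ℂ fun g => ?_
    rw [inner_sub_right, X.inner_semigroupAdj, ContinuousLinearMap.adjoint_inner_right,
      inner_sub_right, inner_evalL2]
  rw [e]
  refine (ContinuousLinearMap.le_opNorm _ _).trans ?_
  rw [LinearIsometryEquiv.norm_map]
  have : ‖X.evalL2 t‖ ≤ 1 := LinearIsometry.norm_toContinuousLinearMap_le _
  exact mul_le_of_le_one_left (norm_nonneg _) this

/-- The set of right continuous paths need not be measurable, but a measurable set containing those
started at `a` inherits outer measure one. All path properties are used through such measurable
supersets. -/
theorem ae_of_rightContinuous (a : Ω) {G : Set (ℝ≥0 → Ω)} (hG : MeasurableSet G)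
    (h : ∀ ω : ℝ≥0 → Ω, (∀ t, ContinuousWithinAt ω (Set.Ici t) t) → ω 0 = a → ω ∈ G) :
    ∀ᵐ ω ∂(X.P a), ω ∈ G := by
  refine (mem_ae_iff_prob_eq_one hG).2 (le_antisymm prob_le_one ?_)
  exact (X.right_continuous a).symm.le.trans (measure_mono fun ω hω => h ω hω.1 hω.2)

theorem ae_start (a : Ω) {C : Set Ω} (hC : MeasurableSet C) :
    ∀ᵐ ω ∂(X.P a), ω 0 ∈ C ↔ a ∈ C := by
  have h0 : MeasurableSet {ω : ℝ≥0 → Ω | ω 0 ∈ C} := measurable_pi_apply (0 : ℝ≥0) hC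
  refine X.ae_of_rightContinuous a (G := {ω | ω 0 ∈ C ↔ a ∈ C}) ?_ ?_
  · by_cases ha : a ∈ C
    · simpa [ha] using h0
    · simp only [ha, iff_false]
      exact h0.compl
  · rintro ω - rfl
    exact Iff.rfl

theorem lintegral_law {g : (ℝ≥0 → Ω) → ℝ≥0∞} (hg : Measurable g) :
    ∫⁻ ω, g ω ∂X.law = ∫⁻ a, ∫⁻ ω, g ω ∂(X.P a) ∂μ :=
  Measure.lintegral_bind X.P.measurable.aemeasurable hg.aemeasurable

/-- Under `P a` the path starts in `C` almost surely exactly when `a ∈ C`. Arguing with one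
measurable `C` at a time avoids the event `ω 0 = a`, which need not be measurable. -/
theorem setLIntegral_law {g : (ℝ≥0 → Ω) → ℝ≥0∞} (hg : Measurable g) {C : Set Ω}
    (hC : MeasurableSet C) :
    ∫⁻ ω in {ω | ω 0 ∈ C}, g ω ∂X.law = ∫⁻ a in C, ∫⁻ ω, g ω ∂(X.P a) ∂μ := by
  have h0 : MeasurableSet {ω : ℝ≥0 → Ω | ω 0 ∈ C} := measurable_pi_apply (0 : ℝ≥0) hC
  rw [← lintegral_indicator h0, X.lintegral_law (hg.indicator h0), ← lintegral_indicator hC]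
  refine lintegral_congr fun a => ?_
  by_cases ha : a ∈ C
  · rw [Set.indicator_of_mem ha]
    refine lintegral_congr_ae ?_
    filter_upwards [X.ae_start a hC] with ω hω
    exact Set.indicator_of_mem (show ω ∈ {ω : ℝ≥0 → Ω | ω 0 ∈ C} from hω.2 ha) g
  · rw [Set.indicator_of_notMem ha, ← lintegral_zero (μ := X.P a)]
    refine lintegral_congr_ae ?_
    filter_upwards [X.ae_start a hC] with ω hω
    exact Set.indicator_of_notMem (show ω ∉ {ω : ℝ≥0 → Ω | ω 0 ∈ C} from fun h => ha (hω.1 h)) g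

/-- The transition probability `a ↦ ℙ_a(ω_t ∈ A)`. -/
def trans (t : ℝ≥0) (A : Set Ω) (a : Ω) : ℝ≥0∞ := X.P a {ω | ω t ∈ A}

theorem measurable_trans (t : ℝ≥0) {A : Set Ω} (hA : MeasurableSet A) :
    Measurable (X.trans t A) :=
  X.P.measurable_coe (measurable_pi_apply t hA)

theorem trans_le_one (t : ℝ≥0) (A : Set Ω) (a : Ω) : X.trans t A a ≤ 1 := prob_le_one

theorem law_eval (t : ℝ≥0) {A : Set Ω} (hA : MeasurableSet A) :
    X.law {ω | ω t ∈ A} = μ A :=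
  (X.measurePreserving_eval t).measure_preimage hA.nullMeasurableSet

theorem B_graph : X.B.graph = generatorGraph X.semigroupAdj := generator_graph _

variable [IsProbabilityMeasure μ]

instance : IsProbabilityMeasure X.law := by
  have h := (X.measurePreserving_eval 0).measure_preimage MeasurableSet.univ.nullMeasurableSet
  exact ⟨by simpa using h⟩

theorem memLp_trans (t : ℝ≥0) {A : Set Ω} (hA : MeasurableSet A) :
    MemLp (fun a => ((X.trans t A a).toReal : ℂ)) 2 μ := by
  refine MemLp.of_bound (C := 1) ?_ (Eventually.of_forall fun a => ?_)
  · exact (Complex.measurable_ofReal.comp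
      (X.measurable_trans t hA).ennreal_toReal).aestronglyMeasurable
  · rw [Complex.norm_real, Real.norm_of_nonneg ENNReal.toReal_nonneg]
    exact ENNReal.toReal_mono ENNReal.one_ne_top (X.trans_le_one t A a)

theorem evalL2_indL2 (t : ℝ≥0) {A : Set Ω} (hA : MeasurableSet A) :
    X.evalL2 t (indL2 μ hA) = indL2 X.law (measurable_pi_apply t hA) :=
  Lp.indicatorConstLp_compMeasurePreserving hA _ 1 (X.measurePreserving_eval t)

theorem inner_evalL2_indL2 (t : ℝ≥0) {A C : Set Ω} (hA : MeasurableSet A) (hC : MeasurableSet C) :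
    inner ℂ (X.evalL2 0 (indL2 μ hC)) (X.evalL2 t (indL2 μ hA))
      = ((∫⁻ a in C, X.trans t A a ∂μ).toReal : ℂ) := by
  have hA' : MeasurableSet {ω : ℝ≥0 → Ω | ω t ∈ A} := measurable_pi_apply t hA
  have h0 : MeasurableSet {ω : ℝ≥0 → Ω | ω 0 ∈ C} := measurable_pi_apply (0 : ℝ≥0) hC
  rw [evalL2_indL2, evalL2_indL2, indL2, indL2, L2.inner_indicatorConstLp_indicatorConstLp]
  have := X.setLIntegral_law (g := {ω : ℝ≥0 → Ω | ω t ∈ A}.indicator 1)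
    (measurable_one.indicator hA') hC
  simp only [lintegral_indicator_one hA'] at this
  rw [Measure.restrict_apply hA'] at this
  simp only [trans]
  rw [← this, Set.inter_comm]
  simp [Measure.real]
  rfl

/-- The adjoint of evaluation at time 0 acts as conditional expectation given `ω_0`. On the
indicator of `ω_t ∈ A` this is the transition probability. -/
theorem adjoint_evalL2_zero_evalL2_indL2 (t : ℝ≥0) {A : Set Ω} (hA : MeasurableSet A) :
    (X.evalL2 0).adjoint (X.evalL2 t (indL2 μ hA)) = (X.memLp_trans t hA).toLp _ := by
  refine eq_of_inner_indL2 fun C hC => ?_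
  rw [ContinuousLinearMap.adjoint_inner_right, X.inner_evalL2_indL2]
  rw [indL2, L2.inner_indicatorConstLp_one,
    setIntegral_congr_ae hC ((MemLp.coeFn_toLp (X.memLp_trans t hA)).mono fun _ h _ => h),
    integral_complex_ofReal, integral_toReal (X.measurable_trans t hA).aemeasurable
      (Eventually.of_forall fun a => (X.trans_le_one t A a).trans_lt ENNReal.one_lt_top)]

/-- Tested on indicators of `A` and `C`, both sides are the probability of `ω_0 ∈ C`, `ω_{s+t} ∈ A`,
once the path is conditioned at time `t` by the Markov property. -/
theorem semigroupAdj_add (s t : ℝ≥0) :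
    X.semigroupAdj (s + t) = X.semigroupAdj s ∘L X.semigroupAdj t := by
  -- The Markov property is available only at positive times.
  rcases eq_or_ne t 0 with rfl | ht
  · rw [semigroupAdj_zero, add_zero]; rfl
  refine clm_ext_indL2 fun C hC => eq_of_inner_indL2 fun A hA => ?_
  rw [ContinuousLinearMap.comp_apply, inner_semigroupAdj,
    inner_semigroupAdj X s, ← ContinuousLinearMap.adjoint_inner_left (X.evalL2 0) _
      (X.evalL2 s (indL2 μ hA)), adjoint_evalL2_zero_evalL2_indL2, inner_semigroupAdj, ← inner_conj_symm, inner_evalL2_indL2, ← inner_conj_symm]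
  congr 1
  have h0 : MeasurableSet {ω : ℝ≥0 → Ω | ω 0 ∈ C} := measurable_pi_apply (0 : ℝ≥0) hC
  have e : X.evalL2 t ((X.memLp_trans s hA).toLp _)
      = ((X.memLp_trans s hA).comp_measurePreserving (X.measurePreserving_eval t)).toLp _ :=
    Lp.toLp_compMeasurePreserving _ _
  have hm : Measurable fun ω : ℝ≥0 → Ω => X.trans s A (ω t) :=
    (X.measurable_trans s hA).comp (measurable_pi_apply t)
  rw [evalL2_indL2, e, indL2, L2.inner_indicatorConstLp_one, setIntegral_congr_ae
    (measurable_pi_apply (0 : ℝ≥0) hC) ((MemLp.coeFn_toLp _).mono fun _ h _ => h)]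
  simp only [Function.comp_def]
  rw [integral_complex_ofReal, integral_toReal hm.aemeasurable
      (Eventually.of_forall fun a => (X.trans_le_one s A _).trans_lt ENNReal.one_lt_top)]
  congr 2
  have := X.setLIntegral_law hm hC
  refine Eq.trans ?_ this.symm
  refine lintegral_congr fun a => ?_
  exact X.markov t (pos_iff_ne_zero.2 ht) a {ω | ω s ∈ A} (measurable_pi_apply s hA)

theorem evalL2_constOne (t : ℝ≥0) : X.evalL2 t (constOne μ) = X.evalL2 0 (constOne μ) := by
  rw [constOne_eq_indL2, evalL2_indL2, evalL2_indL2]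
  rfl

theorem semigroupAdj_constOne (t : ℝ≥0) : X.semigroupAdj t (constOne μ) = constOne μ := by
  refine ext_inner_left ℂ fun g => ?_
  rw [inner_semigroupAdj, ← evalL2_constOne X t, inner_evalL2]

theorem inner_constOne_semigroupAdj (t : ℝ≥0) (f : Lp ℂ 2 μ) :
    inner ℂ (constOne μ) (X.semigroupAdj t f) = inner ℂ (constOne μ) f := by
  rw [inner_semigroupAdj, evalL2_constOne, inner_evalL2]

/-- Invariance gives `ω_t ∈ A` and `ω_0 ∈ A` the same probability, so the two one-sided differences
have equal mass. Right continuity at time 0 controls only one of them directly. -/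
theorem law_symmDiff (t : ℝ≥0) {A : Set Ω} (hA : MeasurableSet A) :
    X.law (symmDiff {ω | ω t ∈ A} {ω | ω 0 ∈ A}) = 2 * X.law ({ω | ω 0 ∈ A} \ {ω | ω t ∈ A}) := by
  have ht : MeasurableSet {ω : ℝ≥0 → Ω | ω t ∈ A} := measurable_pi_apply t hA
  have h0 : MeasurableSet {ω : ℝ≥0 → Ω | ω 0 ∈ A} := measurable_pi_apply (0 : ℝ≥0) hA
  have h1 := measure_inter_add_sdiff (μ := X.law) {ω | ω t ∈ A} h0
  have h2 := measure_inter_add_sdiff (μ := X.law) {ω | ω 0 ∈ A} ht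
  rw [X.law_eval t hA] at h1
  rw [X.law_eval 0 hA, Set.inter_comm, ← h1] at h2
  have h3 := (ENNReal.add_right_inj (measure_ne_top _ _)).1 h2
  rw [measure_symmDiff_eq ht.nullMeasurableSet h0.nullMeasurableSet, h3, two_mul]

theorem tendsto_law_symmDiff_of_isOpen {U : Set Ω} (hU : IsOpen U) :
    Tendsto (fun t => X.law (symmDiff {ω | ω t ∈ U} {ω | ω 0 ∈ U})) (𝓝[>] 0) (𝓝 0) := by
  have hUm := hU.measurableSet
  simp only [X.law_symmDiff _ hUm]
  suffices h : Tendsto (fun t => X.law ({ω | ω 0 ∈ U} \ {ω | ω t ∈ U})) (𝓝[>] 0) (𝓝 0) by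
    simpa using ENNReal.Tendsto.const_mul (a := 2) h (Or.inr (by norm_num))
  -- Along a sequence of times, staying in `U` eventually is a countable condition, hence measurable
  -- for the product σ-algebra.
  refine tendsto_of_seq_tendsto fun u hu => ?_
  have hm : ∀ t, MeasurableSet {ω : ℝ≥0 → Ω | ω t ∈ U} := fun t => measurable_pi_apply t hUm
  rw [← measure_empty (μ := X.law)]
  refine tendsto_measure_of_ae_tendsto_indicator_of_isFiniteMeasure atTop MeasurableSet.empty
    (fun n => (hm 0).diff (hm (u n))) ?_
  have hG : MeasurableSet {ω : ℝ≥0 → Ω | ω 0 ∈ U → ∀ᶠ n in atTop, ω (u n) ∈ U} := by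
    simp only [eventually_atTop]
    have e : {ω : ℝ≥0 → Ω | ω 0 ∈ U → ∃ N, ∀ n ≥ N, ω (u n) ∈ U}
        = {ω | ω 0 ∈ U}ᶜ ∪ ⋃ N, ⋂ n, ⋂ (_ : n ≥ N), {ω | ω (u n) ∈ U} := by
      ext ω
      simp [imp_iff_not_or]
    rw [e]
    exact (hm 0).compl.union (MeasurableSet.iUnion fun N => MeasurableSet.iInter fun n =>
      MeasurableSet.iInter fun _ => hm _)
  have hae : ∀ᵐ ω ∂X.law, ω 0 ∈ U → ∀ᶠ n in atTop, ω (u n) ∈ U := by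
    refine (mem_ae_iff (s := {ω : ℝ≥0 → Ω | ω 0 ∈ U → ∀ᶠ n in atTop, ω (u n) ∈ U})).2 ?_
    rw [law, Measure.bind_apply hG.compl X.P.measurable.aemeasurable,
      ← lintegral_zero (μ := μ)]
    refine lintegral_congr fun a => ?_
    refine mem_ae_iff.1 (X.ae_of_rightContinuous a hG fun ω hω _ h0 => ?_)
    have h1 : Tendsto ω (𝓝[>] 0) (𝓝 (ω 0)) :=
      (hω 0).mono_left (nhdsWithin_mono _ Set.Ioi_subset_Ici_self)
    exact (h1.comp hu).eventually (hU.mem_nhds h0)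
  filter_upwards [hae] with ω hω
  by_cases h0 : ω 0 ∈ U
  · filter_upwards [hω h0] with n hn
    simp [hn]
  · simp [h0]

/-- A π-λ argument from the open sets. It needs no approximation by continuous functions, so no
separation or metrizability of `Ω` enters. -/
theorem tendsto_law_symmDiff {A : Set Ω} (hA : MeasurableSet A) :
    Tendsto (fun t => X.law (symmDiff {ω | ω t ∈ A} {ω | ω 0 ∈ A})) (𝓝[>] 0) (𝓝 0) := by
  induction A, hA using MeasurableSpace.induction_on_inter
    (BorelSpace.measurable_eq.trans (borel.eq_1 Ω)) isPiSystem_isOpen with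
  | empty => simp
  | basic U hU => exact X.tendsto_law_symmDiff_of_isOpen hU
  | compl A hA ih =>
    refine ih.congr fun t => ?_
    rw [← compl_symmDiff_compl]
    rfl
  | iUnion f hd hf ih =>
    have hsub : ∀ t, X.law (symmDiff {ω | ω t ∈ ⋃ i, f i} {ω | ω 0 ∈ ⋃ i, f i})
        ≤ ∑' i, X.law (symmDiff {ω | ω t ∈ f i} {ω | ω 0 ∈ f i}) := fun t => by
      refine (measure_mono ?_).trans (measure_iUnion_le _)
      intro ω hω
      simp only [Set.mem_symmDiff, Set.mem_ofPred_eq, Set.mem_iUnion] at hω ⊢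
      rcases hω with ⟨⟨i, hi⟩, h⟩ | ⟨⟨i, hi⟩, h⟩
      · exact ⟨i, Or.inl ⟨hi, fun h' => h ⟨i, h'⟩⟩⟩
      · exact ⟨i, Or.inr ⟨hi, fun h' => h ⟨i, h'⟩⟩⟩
    refine tendsto_of_tendsto_of_tendsto_of_le_of_le tendsto_const_nhds ?_ (fun _ => zero_le) hsub
    simp only [← lintegral_count]
    rw [← lintegral_zero (μ := (Measure.count : Measure ℕ))]
    -- The sum over the disjoint pieces is an integral for counting measure. Its terms are at most
    -- `2 μ (f i)`, which is summable.
    refine tendsto_lintegral_filter_of_dominated_convergence (fun i => 2 * μ (f i))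
      (Eventually.of_forall fun t => measurable_of_countable _)
      (Eventually.of_forall fun t => Eventually.of_forall fun i => ?_) ?_
      (Eventually.of_forall ih)
    · rw [X.law_symmDiff _ (hf i)]
      gcongr
      exact (measure_mono Set.sdiff_subset).trans (X.law_eval 0 (hf i)).le
    · rw [lintegral_count, ENNReal.tsum_mul_left, ← measure_iUnion hd hf]
      exact ENNReal.mul_ne_top (by norm_num) (measure_ne_top _ _)

theorem tendsto_evalL2 (f : Lp ℂ 2 μ) :
    Tendsto (fun t => X.evalL2 t f) (𝓝[>] 0) (𝓝 (X.evalL2 0 f)) := by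
  let M : Submodule ℂ (Lp ℂ 2 μ) :=
    { carrier := {f | Tendsto (fun t => X.evalL2 t f) (𝓝[>] 0) (𝓝 (X.evalL2 0 f))}
      zero_mem' := by simp
      add_mem' := fun ha hb => by
        simp only [Set.mem_ofPred_eq, map_add] at *
        exact ha.add hb
      smul_mem' := fun c a ha => by
        simp only [Set.mem_ofPred_eq, map_smul] at *
        exact ha.const_smul c }
  refine eq_top_of_indL2_mem M ?_ (fun A hA => ?_) f
  · refine isClosed_of_closure_subset fun f hf => ?_
    change Tendsto (fun t => X.evalL2 t f) (𝓝[>] 0) (𝓝 (X.evalL2 0 f))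
    rw [Metric.tendsto_nhds]
    intro ε hε
    obtain ⟨g, hg, hfg⟩ := Metric.mem_closure_iff.1 hf (ε / 3) (by positivity)
    filter_upwards [Metric.tendsto_nhds.1 hg (ε / 3) (by positivity)] with t ht
    have hd : ∀ s, dist (X.evalL2 s f) (X.evalL2 s g) = dist f g := fun s => by
      rw [dist_eq_norm, ← map_sub, norm_evalL2, dist_eq_norm]
    have := dist_triangle4 (X.evalL2 t f) (X.evalL2 t g) (X.evalL2 0 g) (X.evalL2 0 f)
    rw [hd, dist_comm (X.evalL2 0 g), hd] at this
    linarith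
  · change Tendsto (fun t => X.evalL2 t (indL2 μ hA)) (𝓝[>] 0) (𝓝 (X.evalL2 0 (indL2 μ hA)))
    simp only [evalL2_indL2]
    exact tendsto_indicatorConstLp_set (by norm_num) (X.tendsto_law_symmDiff hA)

theorem isContractionSemigroup : IsContractionSemigroup X.semigroupAdj where
  zero := X.semigroupAdj_zero
  add := X.semigroupAdj_add
  norm_le := X.norm_semigroupAdj_le
  tendsto f := by
    rw [tendsto_iff_norm_sub_tendsto_zero]
    have h := ((X.tendsto_evalL2 f).const_sub (X.evalL2 0 f)).norm
    rw [sub_self, norm_zero] at h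
    exact squeeze_zero (fun _ => norm_nonneg _) (fun t => X.norm_semigroupAdj_sub_le t f) h

theorem constOne_mem_graph_B : (constOne μ, 0) ∈ X.B.graph := by
  rw [B_graph, mem_generatorGraph_iff]
  simp [semigroupAdj_constOne]

theorem inner_constOne_B {f g : Lp ℂ 2 μ} (h : (f, g) ∈ X.B.graph) :
    inner ℂ (constOne μ) g = 0 := by
  rw [B_graph, mem_generatorGraph_iff] at h
  have h1 := (tendsto_const_nhds (x := constOne μ)).inner (𝕜 := ℂ) h
  refine tendsto_nhds_unique h1 ?_
  simp [inner_smul_right, inner_sub_right, inner_constOne_semigroupAdj]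

end ShiftMarkovProcess

/-! ### Ampliation to `ℓ²(ι; E)` -/

section Ampliation

variable {E : Type*} [NormedAddCommGroup E] [NormedSpace ℂ E] {ι : Type*}

theorem mem_ampliation_graph_iff (A : E →ₗ.[ℂ] E) (φ ψ : lp (fun _ : ι => E) 2) :
    (φ, ψ) ∈ (ampliation ι A).graph ↔ ∀ x, (φ x, ψ x) ∈ A.graph := by
  rw [ampliation_graph]
  exact Iff.rfl

theorem IsBddInverse.ampliation {A : E →ₗ.[ℂ] E} {l : ℂ} {R : E →L[ℂ] E}
    (h : IsBddInverse A.graph (l • 1) R) :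
    ∃ R' : lp (fun _ : ι => E) 2 →L[ℂ] lp (fun _ : ι => E) 2,
      IsBddInverse (ampliation ι A).graph (l • 1) R' ∧ ‖R'‖ ≤ ‖R‖ := by
  refine ⟨lp.mapCLM 2 (fun _ => R) (norm_nonneg R) (fun _ => le_rfl), ⟨fun φ ψ hφ => ?_, fun ψ => ?_⟩,
    lp.norm_mapCLM_le 2 _ _ _⟩
  · rw [mem_ampliation_graph_iff] at hφ
    ext x
    exact h.left_inv _ _ (hφ x)
  · rw [mem_ampliation_graph_iff]
    exact fun x => h.right_mem (ψ x)

end Ampliation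

/-! ### Multiplication operators, the constant function and the mean -/

section Multiplication

variable {Ω : Type*} [MeasurableSpace Ω] {μ : Measure Ω}

theorem coeFn_mulL2 (u : Lp ℝ ∞ μ) (f : Lp ℂ 2 μ) :
    (mulL2 u f : Ω → ℂ) =ᵐ[μ] fun ω => (u ω : ℂ) * f ω := by
  filter_upwards [Lp.coeFn_lpSMul (r := 2) u f] with ω h
  change (u • f : Lp ℂ 2 μ) ω = _
  rw [h, Pi.smul_apply', Complex.real_smul]

theorem inner_mulL2 (u : Lp ℝ ∞ μ) (f g : Lp ℂ 2 μ) :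
    inner ℂ (mulL2 u f) g = inner ℂ f (mulL2 u g) := by
  rw [L2.inner_def, L2.inner_def]
  refine integral_congr_ae ?_
  filter_upwards [coeFn_mulL2 u f, coeFn_mulL2 u g] with ω h1 h2
  rw [h1, h2]
  simp
  ring

theorem mulL2_zero : mulL2 (0 : Lp ℝ ∞ μ) = 0 :=
  norm_le_zero_iff.1 ((norm_mulL2_le 0).trans norm_zero.le)

variable [IsProbabilityMeasure μ]

theorem inner_constOne (f : Lp ℂ 2 μ) : inner ℂ (constOne μ) f = ∫ ω, f ω ∂μ := by
  rw [constOne_eq_indL2, indL2, L2.inner_indicatorConstLp_one, Measure.restrict_univ]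

theorem norm_constOne : ‖constOne μ‖ = 1 := by
  rw [constOne_eq_indL2, indL2, norm_indicatorConstLp (by norm_num) (by norm_num)]
  simp

theorem coeFn_constOne : (constOne μ : Ω → ℂ) =ᵐ[μ] fun _ => 1 := Lp.coeFn_const 2 μ 1

theorem inner_constOne_mulL2_constOne (u : Lp ℝ ∞ μ) :
    inner ℂ (constOne μ) (mulL2 u (constOne μ)) = ((∫ ω, u ω ∂μ : ℝ) : ℂ) := by
  rw [inner_constOne, ← integral_complex_ofReal]
  refine integral_congr_ae ?_
  filter_upwards [coeFn_mulL2 u (constOne μ), coeFn_constOne (μ := μ)] with ω h1 h2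
  rw [h1, h2, mul_one]

/-- Projection onto the non-random functions, `φ(x, ω) ↦ ∫ φ(x, ω') dμ(ω')`. -/
def meanPart (d : ℕ) (μ : Measure Ω) [IsProbabilityMeasure μ] :
    lp (fun _ : Fin d → ℤ => Lp ℂ 2 μ) 2 →L[ℂ] lp (fun _ : Fin d → ℤ => Lp ℂ 2 μ) 2 :=
  lp.mapCLM 2 (fun _ => InnerProductSpace.rankOne ℂ (constOne μ) (constOne μ)) (K := 1) zero_le_one
    (fun _ => by rw [InnerProductSpace.norm_rankOne, norm_constOne, mul_one])

theorem meanPart_apply {d : ℕ} (φ : lp (fun _ : Fin d → ℤ => Lp ℂ 2 μ) 2) (x : Fin d → ℤ) :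
    meanPart d μ φ x = inner ℂ (constOne μ) (φ x) • constOne μ := rfl

end Multiplication

/-! ### Symmetry and null vectors of the hopping and potential terms at `z = 0` -/

namespace ShiftMarkovProcess

section Lattice

variable {d : ℕ} {Ω : Type*} [MeasurableSpace Ω] {μ : Measure Ω}

theorem translate_apply (ζ : Fin d → ℤ) (φ : AugSpace d μ) (x : Fin d → ℤ) :
    translate μ ζ φ x = φ (x - ζ) := rfl

theorem norm_translate_apply (ζ : Fin d → ℤ) (φ : AugSpace d μ) :
    ‖translate μ ζ φ‖ = ‖φ‖ := (reindex (Equiv.subRight ζ)).norm_map φ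

theorem inner_map_eq_of_isometry {E : Type*} [NormedAddCommGroup E] [InnerProductSpace ℂ E]
    (U U' : E →L[ℂ] E) (hU : ∀ x, ‖U x‖ = ‖x‖) (h : ∀ x, U (U' x) = x) (x y : E) :
    inner ℂ (U x) y = inner ℂ x (U' y) := by
  conv_lhs => rw [← h y]
  exact LinearIsometry.inner_map_map (⟨U.toLinearMap, hU⟩ : E →ₗᵢ[ℂ] E) x (U' y)

theorem inner_translate (ζ : Fin d → ℤ) (φ ψ : AugSpace d μ) :
    inner ℂ (translate μ ζ φ) ψ = inner ℂ φ (translate μ (-ζ) ψ) := by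
  refine inner_map_eq_of_isometry _ _ (norm_translate_apply ζ) (fun x => ?_) φ ψ
  ext1; funext y
  rw [translate_apply, translate_apply, sub_neg_eq_add, sub_add_cancel]

theorem norm_translate_le (ζ : Fin d → ℤ) : ‖translate μ ζ‖ ≤ 1 :=
  LinearIsometry.norm_toContinuousLinearMap_le _

variable [IsProbabilityMeasure μ]

theorem meanPart_deltaOne : meanPart d μ (deltaOne d μ) = deltaOne d μ := by
  ext1; funext x
  rw [meanPart_apply, deltaOne]
  rcases eq_or_ne x 0 with rfl | h
  · rw [lp.single_apply_self, inner_self_eq_norm_sq_to_K, norm_constOne]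
    simp
  · rw [lp.single_apply_ne _ _ _ h]
    simp

theorem inner_deltaOne (φ : AugSpace d μ) :
    inner ℂ (deltaOne d μ) φ = inner ℂ (constOne μ) (φ 0) := lp.inner_single_left _ _ _

theorem norm_deltaOne : ‖deltaOne d μ‖ = 1 := by
  rw [deltaOne, lp.norm_single (by norm_num), norm_constOne]

end Lattice

variable {d : ℕ} {Ω : Type*} [TopologicalSpace Ω] [MeasurableSpace Ω] [BorelSpace Ω]
  {μ : Measure Ω} (X : ShiftMarkovProcess d Ω μ)

theorem Vhat_apply (v₀ : Lp ℝ ∞ μ) (φ : AugSpace d μ) (x : Fin d → ℤ) :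
    X.Vhat v₀ φ x = mulL2 (X.v v₀ x - v₀) (φ x) := rfl

theorem shift_apply (ζ : Fin d → ℤ) (φ : AugSpace d μ) (x : Fin d → ℤ) :
    X.shift ζ φ x = X.shiftL2 ζ (φ x) := rfl

theorem inner_Vhat (v₀ : Lp ℝ ∞ μ) (φ ψ : AugSpace d μ) :
    inner ℂ (X.Vhat v₀ φ) ψ = inner ℂ φ (X.Vhat v₀ ψ) := by
  rw [lp.inner_eq_tsum, lp.inner_eq_tsum]
  exact tsum_congr fun x => inner_mulL2 _ _ _

theorem v_zero (v₀ : Lp ℝ ∞ μ) : X.v v₀ 0 = v₀ := by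
  ext1
  filter_upwards [Lp.coeFn_compMeasurePreserving v₀ (X.σ_measurePreserving 0)] with ω h
  rw [v, h, Function.comp_apply, X.σ_zero, id]

theorem integral_v_sub [IsProbabilityMeasure μ] (v₀ : Lp ℝ ∞ μ) (x : Fin d → ℤ) :
    ∫ ω, (X.v v₀ x - v₀ : Lp ℝ ∞ μ) ω ∂μ = 0 := by
  have hi : ∀ u : Lp ℝ ∞ μ, Integrable u μ := fun u =>
    (Lp.memLp u).integrable le_top
  rw [integral_congr_ae (Lp.coeFn_sub _ _)]
  simp only [Pi.sub_apply]
  rw [integral_sub (hi _) (hi _), v,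
    integral_congr_ae (Lp.coeFn_compMeasurePreserving v₀ (X.σ_measurePreserving x))]
  have h := integral_map (μ := μ) (f := v₀) (X.σ_measurePreserving x).aemeasurable
    (by rw [(X.σ_measurePreserving x).map_eq]; exact (Lp.aestronglyMeasurable v₀))
  rw [(X.σ_measurePreserving x).map_eq] at h
  rw [h]
  simp

theorem inner_constOne_potential [IsProbabilityMeasure μ] (v₀ : Lp ℝ ∞ μ) (x : Fin d → ℤ) :
    inner ℂ (constOne μ) (mulL2 (X.v v₀ x - v₀) (constOne μ)) = 0 := by
  rw [inner_constOne_mulL2_constOne, integral_v_sub, Complex.ofReal_zero]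

theorem shiftL2_constOne [IsProbabilityMeasure μ] (ζ : Fin d → ℤ) :
    X.shiftL2 ζ (constOne μ) = constOne μ := by
  rw [constOne_eq_indL2]
  exact Lp.indicatorConstLp_compMeasurePreserving MeasurableSet.univ _ 1 (X.σ_measurePreserving ζ)

theorem shiftL2_shiftL2_neg (ζ : Fin d → ℤ) (f : Lp ℂ 2 μ) :
    X.shiftL2 ζ (X.shiftL2 (-ζ) f) = f := by
  ext1
  have h1 : X.shiftL2 ζ (X.shiftL2 (-ζ) f) =ᵐ[μ] X.shiftL2 (-ζ) f ∘ X.σ ζ :=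
    Lp.coeFn_compMeasurePreserving _ (X.σ_measurePreserving ζ)
  have h2 : X.shiftL2 (-ζ) f =ᵐ[μ] f ∘ X.σ (-ζ) :=
    Lp.coeFn_compMeasurePreserving f (X.σ_measurePreserving (-ζ))
  have h3 := (X.σ_measurePreserving ζ).quasiMeasurePreserving.ae_eq_comp h2
  filter_upwards [h1, h3] with ω e1 e3
  rw [e1, e3]
  have := congrFun (X.σ_add (-ζ) ζ) ω
  simp only [Function.comp_apply, neg_add_cancel, X.σ_zero, id] at this ⊢
  rw [this]

theorem norm_shift_apply (ζ : Fin d → ℤ) (φ : AugSpace d μ) :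
    ‖X.shift ζ φ‖ = ‖φ‖ := by
  rw [lp.norm_eq_tsum_rpow (by norm_num), lp.norm_eq_tsum_rpow (by norm_num)]
  simp only [shift_apply, LinearIsometry.norm_map]

theorem inner_translate_shift (ζ : Fin d → ℤ) (φ ψ : AugSpace d μ) :
    inner ℂ (translate μ ζ (X.shift ζ φ)) ψ = inner ℂ φ (translate μ (-ζ) (X.shift (-ζ) ψ)) := by
  refine inner_map_eq_of_isometry (translate μ ζ ∘L X.shift ζ) (translate μ (-ζ) ∘L X.shift (-ζ))
    (fun x => ?_) (fun x => ?_) φ ψ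
  · rw [ContinuousLinearMap.comp_apply, norm_translate_apply, norm_shift_apply]
  ext1; funext y
  simp only [translate_apply, shift_apply, ContinuousLinearMap.comp_apply, shiftL2_shiftL2_neg,
    sub_neg_eq_add, sub_add_cancel]

theorem norm_translate_comp_shift_le (ζ : Fin d → ℤ) : ‖translate μ ζ ∘L X.shift ζ‖ ≤ 1 :=
  ContinuousLinearMap.opNorm_le_bound _ zero_le_one fun φ => by
    rw [ContinuousLinearMap.comp_apply, norm_translate_apply, norm_shift_apply, one_mul]

theorem summable_norm_h (𝓚 : HoppingKernel d) : Summable fun ζ => ‖𝓚.h ζ‖ := by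
  obtain ⟨m, hm, hs⟩ := 𝓚.exp_bounded
  refine hs.of_nonneg_of_le (fun _ => norm_nonneg _) fun y => ?_
  refine le_mul_of_one_le_left (norm_nonneg _) (Real.one_le_exp ?_)
  exact mul_nonneg hm.le (norm_nonneg _)

theorem hasSum_Khat_zero (𝓚 : HoppingKernel d) :
    HasSum (fun ζ => 𝓚.h ζ • (translate μ ζ - translate μ ζ ∘L X.shift ζ)) (X.Khat 𝓚 0) := by
  have hs : Summable (fun ζ => 𝓚.h ζ • (translate μ ζ - translate μ ζ ∘L X.shift ζ)) := by
    refine Summable.of_norm_bounded ((summable_norm_h 𝓚).mul_right 2) fun ζ => ?_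
    rw [norm_smul]
    gcongr
    refine (norm_sub_le _ _).trans ?_
    linarith [norm_translate_le (μ := μ) ζ, X.norm_translate_comp_shift_le ζ]
  convert hs.hasSum using 1
  rw [Khat]
  simp

/-- Translations, with or without the shift, are invertible isometries whose adjoints belong to
`-ζ`. Reindexing the sum by `ζ ↦ -ζ` then matches `h(ζ)` with the conjugate of `h(-ζ)`. -/
theorem inner_Khat_zero (𝓚 : HoppingKernel d) (φ ψ : AugSpace d μ) :
    inner ℂ (X.Khat 𝓚 0 φ) ψ = inner ℂ φ (X.Khat 𝓚 0 ψ) := by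
  have h1 : ∀ φ : AugSpace d μ, HasSum (fun ζ => 𝓚.h ζ • (translate μ ζ φ - translate μ ζ (X.shift ζ φ)))
      (X.Khat 𝓚 0 φ) := fun φ => by
    have := (X.hasSum_Khat_zero 𝓚).mapL (ContinuousLinearMap.apply ℂ (AugSpace d μ) φ)
    simpa using this
  have h2 := (h1 ψ).mapL (innerSL ℂ φ)
  have h3 := ((h1 φ).mapL (innerSL ℂ ψ)).star
  have h4 := (Equiv.neg (Fin d → ℤ)).hasSum_iff.2 h3
  simp only [innerSL_apply_apply] at h2 h4
  have e : inner ℂ (X.Khat 𝓚 0 φ) ψ = star (inner ℂ ψ (X.Khat 𝓚 0 φ)) := (inner_conj_symm _ _).symm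
  rw [e]
  refine h4.unique ?_
  convert h2 using 1
  funext ζ
  rw [Function.comp_apply, Equiv.neg_apply, RCLike.star_def, inner_conj_symm, inner_smul_left,
    inner_smul_right, inner_sub_left, inner_sub_right, inner_translate, inner_translate_shift,
    neg_neg, ← 𝓚.self_adjoint]

/-- At `z = 0` the phase is 1, so the two terms of each summand cancel on shift-invariant vectors.
This applies to every non-random function. -/
theorem Khat_zero_eq_zero (𝓚 : HoppingKernel d) {φ : AugSpace d μ} (h : ∀ ζ, X.shift ζ φ = φ) :
    X.Khat 𝓚 0 φ = 0 := by
  have := (X.hasSum_Khat_zero 𝓚).mapL (ContinuousLinearMap.apply ℂ (AugSpace d μ) φ)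
  simp only [ContinuousLinearMap.apply_apply, smul_apply, sub_apply,
    ContinuousLinearMap.comp_apply, h, sub_self, smul_zero] at this
  exact this.unique hasSum_zero

variable [IsProbabilityMeasure μ]

theorem Khat_zero_meanPart (𝓚 : HoppingKernel d) (φ : AugSpace d μ) :
    X.Khat 𝓚 0 (meanPart d μ φ) = 0 := by
  refine X.Khat_zero_eq_zero 𝓚 fun ζ => ?_
  ext1; funext x
  rw [shift_apply, meanPart_apply, map_smul, shiftL2_constOne]

theorem Khat_zero_deltaOne (𝓚 : HoppingKernel d) : X.Khat 𝓚 0 (deltaOne d μ) = 0 := by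
  rw [← meanPart_deltaOne, Khat_zero_meanPart]

theorem Vhat_deltaOne (v₀ : Lp ℝ ∞ μ) : X.Vhat v₀ (deltaOne d μ) = 0 := by
  ext1; funext x
  rw [Vhat_apply, deltaOne]
  rcases eq_or_ne x 0 with rfl | h
  · rw [v_zero, sub_self, mulL2_zero]
    rfl
  · rw [lp.single_apply_ne _ _ _ h, map_zero]
    rfl

theorem deltaOne_mem_graph : (deltaOne d μ, 0) ∈ (ampliation (Fin d → ℤ) X.B).graph := by
  rw [mem_ampliation_graph_iff]
  intro x
  rw [deltaOne]
  rcases eq_or_ne x 0 with rfl | h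
  · rw [lp.single_apply_self]
    exact X.constOne_mem_graph_B
  · rw [lp.single_apply_ne _ _ _ h]
    exact X.B.graph.zero_mem

end ShiftMarkovProcess

/-! ### Geometry of truncated sectors -/

section Sector

theorem isClosed_truncSector (T γ p c : ℝ) : IsClosed (truncSector T γ p c) := by
  have h1 : IsClosed {w : ℂ | γ / T ≤ w.re} := isClosed_le continuous_const Complex.continuous_re
  have h2 : IsClosed {w : ℂ | |w.im| ≤ p * (w.re + c)} :=
    isClosed_le (by fun_prop) (by fun_prop)
  exact h1.inter h2

/-- The vertices of the cones containing `n` and avoided by `w` differ by 1, so `‖n - w‖ ≥ p/(1 +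
p)`. This absorbs the cost of translating `n` by `γ/T` into the truncated sector. -/
theorem infDist_truncSector_le_of_outside_cone {T γ p c₀ : ℝ} (hT : 0 < T) (hγ : 0 < γ) (hp : 0 < p)
    {n w : ℂ} (hn : 0 ≤ n.re) (hn' : |n.im| ≤ p * (n.re + c₀))
    (hw : p * (w.re + (c₀ + 1)) ≤ |w.im|) :
    Metric.infDist w (truncSector T γ p (c₀ + 1)) ≤ (1 + γ / T * ((1 + p) / p)) * ‖n - w‖ := by
  have hpos : 0 < γ / T := by positivity
  have hmem : n + (γ / T : ℝ) ∈ truncSector T γ p (c₀ + 1) := by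
    refine ⟨by simp [hn], ?_⟩
    simp only [Complex.add_im, Complex.ofReal_im, add_zero, Complex.add_re, Complex.ofReal_re]
    nlinarith
  refine (Metric.infDist_le_dist_of_mem hmem).trans ?_
  rw [dist_comm, dist_eq_norm]
  have h1 : ‖n + (γ / T : ℝ) - w‖ ≤ ‖n - w‖ + γ / T := by
    have : n + (γ / T : ℝ) - w = (n - w) + (γ / T : ℝ) := by ring
    rw [this]
    refine (norm_add_le _ _).trans ?_
    rw [Complex.norm_real, Real.norm_of_nonneg hpos.le]
  have h2 : p ≤ (1 + p) * ‖n - w‖ := by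
    have a1 : |w.im| - |n.im| ≤ ‖n - w‖ := by
      have := Complex.abs_im_le_norm (n - w)
      rw [Complex.sub_im] at this
      have := abs_sub_abs_le_abs_sub w.im n.im
      rw [abs_sub_comm] at this
      linarith
    have a2 : n.re - w.re ≤ ‖n - w‖ := by
      have := (le_abs_self _).trans (Complex.abs_re_le_norm (n - w))
      rwa [Complex.sub_re] at this
    nlinarith
  have h3 : 1 ≤ (1 + p) / p * ‖n - w‖ := by
    rw [div_mul_eq_mul_div, le_div_iff₀ hp]; linarith
  nlinarith

/-- Points of the cone missed by the sector lie between its vertex `-c` and the truncation line, a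
bounded region. The bound does not depend on `γ`, so it may be used to choose `γ`. -/
theorem norm_le_of_notMem_truncSector {T γ p c : ℝ} (hT : 0 < T) (hγ : γ < 1) (hp : 0 < p)
    {w : ℂ} (hw : w ∉ truncSector T γ p c) (hc : |w.im| < p * (w.re + c)) :
    w.re ≤ γ / T ∧ ‖w‖ ≤ (1 + p) * (1 / T + |c|) := by
  have h1 : w.re < γ / T := by
    by_contra h
    exact hw ⟨not_lt.1 h, hc.le⟩
  have h1' : γ / T < 1 / T := by gcongr
  have h2 : 0 < w.re + c := by
    have := (abs_nonneg _).trans_lt hc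
    exact (mul_pos_iff_of_pos_left hp).1 this
  have hT' : 0 < 1 / T := by positivity
  have h3 : |w.re| ≤ 1 / T + |c| := by
    rw [abs_le]
    constructor <;> linarith [le_abs_self c, abs_nonneg c]
  refine ⟨h1.le, (Complex.norm_le_abs_re_add_abs_im w).trans ?_⟩
  have : |w.im| ≤ p * (1 / T + |c|) := by
    refine hc.le.trans ?_
    have := le_abs_self c
    gcongr
    linarith
  linarith

theorem infDist_truncSector_le {T γ p c : ℝ} (hT : 0 < T) (hγ0 : 0 < γ) (hγ : γ < 1) (hp : 0 < p)
    (hc : 0 < c) (w : ℂ) : Metric.infDist w (truncSector T γ p c) ≤ ‖w‖ + 1 / T := by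
  have hmem : ((γ / T : ℝ) : ℂ) ∈ truncSector T γ p c := by
    refine ⟨by simp, ?_⟩
    simp only [Complex.ofReal_im, Complex.ofReal_re, abs_zero]
    positivity
  refine (Metric.infDist_le_dist_of_mem hmem).trans ?_
  rw [dist_eq_norm]
  refine (norm_sub_le _ _).trans ?_
  rw [Complex.norm_real, Real.norm_of_nonneg (by positivity)]
  gcongr

/-- For `l > c` the sector is stable under dilations of factor at least 1 about `-l`. If a point of
the segment from `-l` to `w` lay in it, then so would `w`. -/
theorem segment_notMem_truncSector {T γ p c l : ℝ} (hT : 0 < T) (hγ0 : 0 < γ) (hp : 0 < p)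
    (hl : 0 < l) (hlc : c < l) {w : ℂ} (hw : w ∉ truncSector T γ p c) {s : ℝ}
    (hs : s ∈ Set.Icc (0 : ℝ) 1) : -(l : ℂ) + s * (w + l) ∉ truncSector T γ p c := by
  have hγT : 0 < γ / T := by positivity
  rintro ⟨h1, h2⟩
  apply hw
  simp only [Complex.add_re, Complex.neg_re, Complex.ofReal_re, Complex.mul_re, Complex.ofReal_im,
    Complex.add_im, Complex.neg_im, Complex.mul_im, zero_mul, sub_zero, add_zero, neg_zero,
    zero_add] at h1 h2
  rcases hs.1.eq_or_lt with rfl | hs0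
  · linarith
  have hs1 := hs.2
  constructor
  · by_contra! h
    nlinarith
  · rw [abs_mul, abs_of_pos hs0] at h2
    by_contra! h
    have : s * (p * (w.re + c)) < s * |w.im| := by gcongr
    nlinarith [mul_nonneg (mul_nonneg hp.le (sub_nonneg.2 hs1)) (sub_pos.2 hlc).le]

/-- If `A + T` is bounded below by the distance to a truncated sector and `A + T + l` is invertible
for a large `l`, then `A + T - w` is invertible for all `w` outside of the sector. -/
theorem exists_resolvent_of_lowerBound {E : Type*} [NormedAddCommGroup E] [NormedSpace ℂ E]
    [CompleteSpace E] {G : Submodule ℂ (E × E)} {S R : E →L[ℂ] E} {T γ p c l C : ℝ} (hT : 0 < T)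
    (hγ0 : 0 < γ) (hp : 0 < p) (hc : 0 < c) (hl : 0 < l) (hlc : c < l) (hC : 0 < C)
    (hR : IsBddInverse G (S + (l : ℂ) • 1) R)
    (hb : ∀ w ∉ truncSector T γ p c, ∀ φ ψ, (φ, ψ) ∈ G →
      Metric.infDist w (truncSector T γ p c) * ‖φ‖ ≤ C * ‖ψ + (S - w • 1) φ‖)
    {w : ℂ} (hw : w ∉ truncSector T γ p c) :
    ∃ R', IsBddInverse G (S - w • 1) R' ∧ ‖R'‖ ≤ C / Metric.infDist w (truncSector T γ p c) := by
  have hne : (truncSector T γ p c).Nonempty := by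
    refine ⟨(γ / T : ℝ), by simp, ?_⟩
    simp only [Complex.ofReal_im, Complex.ofReal_re, abs_zero]
    positivity
  have hpos : ∀ w ∉ truncSector T γ p c, 0 < Metric.infDist w (truncSector T γ p c) := fun w hw =>
    ((isClosed_truncSector T γ p c).notMem_iff_infDist_pos hne).1 hw
  have hb' : ∀ w ∉ truncSector T γ p c, ∀ κ ≤ Metric.infDist w (truncSector T γ p c) / C,
      ∀ φ ψ, (φ, ψ) ∈ G → κ * ‖φ‖ ≤ ‖ψ + (S - w • 1) φ‖ := by
    intro w hw κ hκ φ ψ h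
    refine (mul_le_mul_of_nonneg_right hκ (norm_nonneg _)).trans ?_
    rw [div_mul_eq_mul_div, div_le_iff₀ hC, mul_comm _ C]
    exact hb w hw φ ψ h
  let g : ℝ → ℂ := fun s => -(l : ℂ) + s * (w + l)
  have hg : Continuous fun s => Metric.infDist (g s) (truncSector T γ p c) :=
    (Metric.continuous_infDist_pt _).comp (by fun_prop)
  -- The minimum of the distance over the compact segment is the uniform lower bound that the
  -- continuity method requires.
  obtain ⟨s₀, hs₀, hmin⟩ := isCompact_Icc.exists_isMinOn (Set.nonempty_Icc.2 zero_le_one)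
    hg.continuousOn (s := Set.Icc (0 : ℝ) 1)
  have hgs : ∀ s ∈ Set.Icc (0 : ℝ) 1, g s ∉ truncSector T γ p c := fun s hs =>
    segment_notMem_truncSector hT hγ0 hp hl hlc hw hs
  obtain ⟨R', hR'⟩ := hR.exists_of_segment (S := -((w + l) • (1 : E →L[ℂ] E)))
    (div_pos (hpos _ (hgs s₀ hs₀)) hC) (fun s hs φ ψ h => by
      have := hb' (g s) (hgs s hs) _ (div_le_div_of_nonneg_right (hmin hs) hC.le) φ ψ h
      have e : S + (l : ℂ) • 1 + (s : ℂ) • -((w + l) • (1 : E →L[ℂ] E)) = S - g s • 1 := by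
        simp only [g]
        module
      rwa [e])
  have e : S + (l : ℂ) • 1 + -((w + l) • (1 : E →L[ℂ] E)) = S - w • 1 := by
    rw [add_smul]; abel
  rw [e] at hR'
  refine ⟨R', hR', ?_⟩
  rw [← inv_div]
  exact hR'.norm_le (div_pos (hpos w hw) hC) (hb' w hw _ le_rfl)

/-- The elementary inequality behind the bound near the origin. -/
theorem le_mul_of_coercive {T χ M γ N N₁ F S a : ℝ} (hT : 0 < T) (hM : 0 ≤ M)
    (hγ : (M + 1) * γ ≤ 1 / 2) (hN : 0 ≤ N) (hF : 0 ≤ F) (ha : 0 ≤ a)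
    (hsum : N ^ 2 = S + a + N₁ ^ 2) (hS : S ≤ M * N₁ ^ 2 + χ * F ^ 2) (hχ : 0 ≤ χ)
    (hc : (N₁ ^ 2 + a) / T - γ / T * N ^ 2 ≤ F * N) :
    N ≤ (2 * (M + 1) * T + 2 * χ + 1) * F := by
  have h1 : N₁ ^ 2 + a ≤ γ * N ^ 2 + T * (F * N) := by
    have : (N₁ ^ 2 + a) / T - γ / T * N ^ 2 = (N₁ ^ 2 + a - γ * N ^ 2) / T := by ring
    rw [this, div_le_iff₀ hT] at hc
    linarith
  have h2 : N ^ 2 ≤ 2 * (M + 1) * T * (F * N) + 2 * χ * F ^ 2 := by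
    have a1 : N ^ 2 ≤ (M + 1) * (N₁ ^ 2 + a) + χ * F ^ 2 := by nlinarith
    have a2 : (M + 1) * (N₁ ^ 2 + a) ≤ (M + 1) * (γ * N ^ 2 + T * (F * N)) := by gcongr
    have a3 : (M + 1) * γ * N ^ 2 ≤ 1 / 2 * N ^ 2 := by gcongr
    nlinarith
  -- If the bound fails then `F ≤ N`, so the `F²` term is at most `F N`, and dividing the quadratic
  -- inequality by `N` gives a contradiction.
  by_contra! h
  set α := 2 * (M + 1) * T
  have hα : 0 ≤ α := by positivity
  have hFN : F ≤ N := by nlinarith [mul_nonneg hα hF, mul_nonneg hχ hF]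
  have hN0 : 0 < N := lt_of_le_of_lt (by positivity) h
  have h3 : (α + 2 * χ + 1) * F * N < N * N := by gcongr
  nlinarith [mul_nonneg hF hN, mul_le_mul_of_nonneg_left hFN (mul_nonneg hχ hF)]

end Sector

/-! ### Orthogonal splitting into mean and fluctuation -/

section Lattice

theorem hasSum_norm_sq {ι E : Type*} [NormedAddCommGroup E] [InnerProductSpace ℂ E]
    (φ : lp (fun _ : ι => E) 2) : HasSum (fun x => ‖φ x‖ ^ 2) (‖φ‖ ^ 2) := by
  have h := (lp.hasSum_inner (𝕜 := ℂ) φ φ).mapL Complex.reCLM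
  simp only [Complex.reCLM_apply] at h
  convert h using 1
  · funext x
    exact norm_sq_eq_re_inner (𝕜 := ℂ) (φ x)
  · exact norm_sq_eq_re_inner (𝕜 := ℂ) φ

theorem le_norm_of_re_inner {E : Type*} [NormedAddCommGroup E] [InnerProductSpace ℂ E] {φ f : E}
    {κ : ℝ} (h : κ * ‖φ‖ ^ 2 ≤ (inner ℂ φ f).re) : κ * ‖φ‖ ≤ ‖f‖ := by
  rcases (norm_nonneg φ).eq_or_lt with h0 | h0
  · rw [← h0, mul_zero]; exact norm_nonneg f
  have := h.trans ((Complex.re_le_norm _).trans (norm_inner_le_norm φ f))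
  refine le_of_mul_le_mul_right ?_ h0
  linarith

variable {Ω : Type*} [MeasurableSpace Ω] {μ : Measure Ω} [IsProbabilityMeasure μ]

theorem inner_constOne_self : inner ℂ (constOne μ) (constOne μ) = 1 := by
  rw [inner_self_eq_norm_sq_to_K, norm_constOne]; simp

theorem inner_constOne_sub_mean (f : Lp ℂ 2 μ) :
    inner ℂ (constOne μ) (f - inner ℂ (constOne μ) f • constOne μ) = 0 := by
  rw [inner_sub_right, inner_smul_right, inner_constOne_self, mul_one, sub_self]

theorem norm_sq_eq_mean_add (f : Lp ℂ 2 μ) :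
    ‖f‖ ^ 2 = ‖inner ℂ (constOne μ) f‖ ^ 2
      + ‖f - inner ℂ (constOne μ) f • constOne μ‖ ^ 2 := by
  have h := norm_add_sq_eq_norm_sq_add_norm_sq_of_inner_eq_zero (𝕜 := ℂ)
    (inner ℂ (constOne μ) f • constOne μ) (f - inner ℂ (constOne μ) f • constOne μ)
    (by rw [inner_smul_left, inner_constOne_sub_mean, mul_zero])
  rw [add_sub_cancel, norm_smul, norm_constOne, mul_one] at h
  rw [pow_two, h]
  ring

theorem norm_sub_mean_le (f : Lp ℂ 2 μ) :
    ‖f - inner ℂ (constOne μ) f • constOne μ‖ ≤ ‖f‖ := by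
  have := norm_sq_eq_mean_add f
  refine le_of_sq_le_sq ?_ (norm_nonneg _)
  nlinarith [sq_nonneg ‖inner ℂ (constOne μ) f‖]

theorem norm_sq_eq_meanPart_add {d : ℕ} (φ : AugSpace d μ) :
    ‖φ‖ ^ 2 = ‖meanPart d μ φ‖ ^ 2 + ‖φ - meanPart d μ φ‖ ^ 2 := by
  refine (hasSum_norm_sq φ).unique ?_
  convert (hasSum_norm_sq (meanPart d μ φ)).add (hasSum_norm_sq (φ - meanPart d μ φ)) using 1
  funext x
  rw [norm_sq_eq_mean_add, meanPart_apply, norm_smul, norm_constOne, mul_one]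
  rfl

end Lattice

/-! ### Coercivity of the generator and control of the non-random components -/

namespace ShiftMarkovProcess

variable {d : ℕ} {Ω : Type*} [TopologicalSpace Ω] [MeasurableSpace Ω] [BorelSpace Ω]
  {μ : Measure Ω} (X : ShiftMarkovProcess d Ω μ)

/-- The bounded part `i K̂_z + i V̂` of `L̂_z`. -/
def hop (𝓚 : HoppingKernel d) (v₀ : Lp ℝ ∞ μ) (z : EuclideanSpace ℂ (Fin d)) :
    AugSpace d μ →L[ℂ] AugSpace d μ :=
  Complex.I • X.Khat 𝓚 z + Complex.I • X.Vhat v₀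

theorem re_inner_hop_zero (𝓚 : HoppingKernel d) (v₀ : Lp ℝ ∞ μ) (φ : AugSpace d μ) :
    (inner ℂ φ (X.hop 𝓚 v₀ 0 φ)).re = 0 := by
  have h1 : ∀ S : AugSpace d μ →L[ℂ] AugSpace d μ, (∀ φ ψ, inner ℂ (S φ) ψ = inner ℂ φ (S ψ)) →
      (inner ℂ φ (S φ)).im = 0 := fun S hS => by
    rw [← Complex.conj_eq_iff_im, inner_conj_symm, hS]
  rw [hop, add_apply, smul_apply, smul_apply, inner_add_right, inner_smul_right, inner_smul_right]
  simp [h1 _ (X.inner_Khat_zero 𝓚), h1 _ (X.inner_Vhat v₀)]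

variable [IsProbabilityMeasure μ]

/-- The spectral gap of the generator on the mean-zero functions. -/
def HasGap (T : ℝ) : Prop :=
  ∀ f g, (f, g) ∈ X.B.graph → inner ℂ (constOne μ) f = 0 →
    1 / T * ‖f‖ ^ 2 ≤ (inner ℂ f g).re

/-- Sectoriality of the generator on the mean-zero functions. -/
def IsSectorial (b q : ℝ) : Prop :=
  ∀ f g, (f, g) ∈ X.B.graph → inner ℂ (constOne μ) f = 0 →
    |(inner ℂ f g).im| ≤ q * |(inner ℂ f g).re + b * ‖f‖ ^ 2|

variable {X} {T b q χ : ℝ}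

theorem sub_mean_mem_graph {f g : Lp ℂ 2 μ} (h : (f, g) ∈ X.B.graph) :
    (f - inner ℂ (constOne μ) f • constOne μ, g) ∈ X.B.graph := by
  have := X.B.graph.sub_mem h (X.B.graph.smul_mem (inner ℂ (constOne μ) f) X.constOne_mem_graph_B)
  simpa using this

/-- The range of `B` is orthogonal to constants, so removing the mean does not change the form. This
extends the gap and sector hypotheses to the whole domain. -/
theorem inner_sub_mean {f g : Lp ℂ 2 μ} (h : (f, g) ∈ X.B.graph) :
    inner ℂ (f - inner ℂ (constOne μ) f • constOne μ) g = inner ℂ f g := by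
  rw [inner_sub_left, inner_smul_left, X.inner_constOne_B h, mul_zero, sub_zero]

theorem HasGap.re_inner_ge (hgap : X.HasGap T) {f g : Lp ℂ 2 μ} (h : (f, g) ∈ X.B.graph) :
    1 / T * ‖f - inner ℂ (constOne μ) f • constOne μ‖ ^ 2 ≤ (inner ℂ f g).re := by
  have := hgap _ _ (sub_mean_mem_graph h) (inner_constOne_sub_mean f)
  rwa [inner_sub_mean h] at this

theorem IsSectorial.abs_im_inner_le (hs : X.IsSectorial b q) (hgap : X.HasGap T) (hT : 0 < T)
    {f g : Lp ℂ 2 μ} (h : (f, g) ∈ X.B.graph) :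
    |(inner ℂ f g).im| ≤ |q| * ((inner ℂ f g).re + |b| * ‖f‖ ^ 2) := by
  have h1 := hs _ _ (sub_mean_mem_graph h) (inner_constOne_sub_mean f)
  rw [inner_sub_mean h] at h1
  have h2 : 0 ≤ (inner ℂ f g).re := le_trans (by positivity) (hgap.re_inner_ge h)
  refine h1.trans ?_
  refine (mul_le_mul_of_nonneg_right (le_abs_self q) (abs_nonneg _)).trans ?_
  gcongr
  refine (abs_add_le _ _).trans ?_
  rw [abs_of_nonneg h2, abs_mul, abs_of_nonneg (sq_nonneg (‖_‖ : ℝ))]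
  gcongr
  exact norm_sub_mean_le f

theorem HasGap.norm_le (hgap : X.HasGap T) (hT : 0 < T) {f g : Lp ℂ 2 μ}
    (h : (f, g) ∈ X.B.graph) (h0 : inner ℂ (constOne μ) f = 0) : ‖f‖ ≤ T * ‖g‖ := by
  have := le_norm_of_re_inner (hgap f g h h0)
  rwa [one_div, inv_mul_le_iff₀ hT] at this

/-- With `P` the projection onto constants, `B + T⁻¹P` is reached from the invertible `B + T⁻¹`
along `B + T⁻¹(1 + s(P - 1))`. The gap and the `P` term together bound this family below by `1/T`.
The solution for mean-zero `u` has mean zero because `B` has mean-zero range. -/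
theorem HasGap.exists_solution (hgap : X.HasGap T) (hT : 0 < T) {u : Lp ℂ 2 μ}
    (hu : inner ℂ (constOne μ) u = 0) :
    ∃ g, (g, u) ∈ X.B.graph ∧ inner ℂ (constOne μ) g = 0 := by
  have hT' : 0 < 1 / T := by positivity
  obtain ⟨R, hR, -⟩ := X.isContractionSemigroup.exists_isBddInverse hT'
  rw [← X.B_graph] at hR
  set P := InnerProductSpace.rankOne ℂ (constOne μ) (constOne μ) with hP
  obtain ⟨R', hR'⟩ := hR.exists_of_segment (S := ((1 / T : ℝ) : ℂ) • (P - 1)) hT'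
    (fun s hs φ ψ h => by
      apply le_norm_of_re_inner
      have e : inner ℂ φ (ψ + (((1 / T : ℝ) : ℂ) • (1 : Lp ℂ 2 μ →L[ℂ] Lp ℂ 2 μ)
          + (s : ℂ) • ((1 / T : ℝ) : ℂ) • (P - 1)) φ)
          = inner ℂ φ ψ + ((1 / T * ((1 - s) * ‖φ‖ ^ 2
            + s * ‖inner ℂ (constOne μ) φ‖ ^ 2) : ℝ) : ℂ) := by
        have e1 : inner ℂ φ (P φ) = ((‖inner ℂ (constOne μ) φ‖ ^ 2 : ℝ) : ℂ) := by
          rw [hP, InnerProductSpace.rankOne_apply, inner_smul_right,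
            ← inner_conj_symm φ (constOne μ), Complex.mul_conj, Complex.normSq_eq_norm_sq]
        have e2 : inner ℂ φ φ = ((‖φ‖ ^ 2 : ℝ) : ℂ) := by
          rw [inner_self_eq_norm_sq_to_K]; simp
        simp only [add_apply, smul_apply, sub_apply, one_apply_eq_self, inner_add_right,
          inner_smul_right, inner_sub_right, e1, e2]
        push_cast
        ring
      rw [e, Complex.add_re, Complex.ofReal_re]
      have h1 := hgap.re_inner_ge h
      have h2 := norm_sq_eq_mean_add φ
      have h3 : 0 ≤ 1 / T * ((1 - s) * ‖φ - inner ℂ (constOne μ) φ • constOne μ‖ ^ 2) := by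
        have := hs.2
        exact mul_nonneg hT'.le (mul_nonneg (by linarith) (sq_nonneg _))
      rw [h2]
      linarith)
  have e : ((1 / T : ℝ) : ℂ) • (1 : Lp ℂ 2 μ →L[ℂ] Lp ℂ 2 μ) + ((1 / T : ℝ) : ℂ) • (P - 1)
      = ((1 / T : ℝ) : ℂ) • P := by module
  rw [e] at hR'
  have hm := hR'.right_mem u
  have h0 := X.inner_constOne_B hm
  rw [inner_sub_right, hu, smul_apply, hP, InnerProductSpace.rankOne_apply, inner_smul_right,
    inner_smul_right, inner_constOne_self, mul_one, zero_sub, neg_eq_zero, mul_eq_zero] at h0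
  have h0' : inner ℂ (constOne μ) (R' u) = 0 :=
    h0.resolve_left (by exact_mod_cast hT'.ne')
  refine ⟨R' u, ?_, h0'⟩
  simpa [hP, h0'] using hm

variable (X)

/-- The bounded part of the operator `L̂_0 + T⁻¹ |δ_0 ⊗ 1⟩⟨δ_0 ⊗ 1|`. -/
def liftedHop (𝓚 : HoppingKernel d) (v₀ : Lp ℝ ∞ μ) (T : ℝ) : AugSpace d μ →L[ℂ] AugSpace d μ :=
  X.hop 𝓚 v₀ 0 +
    ((1 / T : ℝ) : ℂ) • InnerProductSpace.rankOne ℂ (deltaOne d μ) (deltaOne d μ)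

variable {X}

theorem inner_liftedHop (𝓚 : HoppingKernel d) (v₀ : Lp ℝ ∞ μ) (φ : AugSpace d μ) :
    inner ℂ φ (X.liftedHop 𝓚 v₀ T φ)
      = inner ℂ φ (X.hop 𝓚 v₀ 0 φ) + ((1 / T * ‖inner ℂ (deltaOne d μ) φ‖ ^ 2 : ℝ) : ℂ) := by
  rw [liftedHop, add_apply, inner_add_right, smul_apply, InnerProductSpace.rankOne_apply,
    inner_smul_right, inner_smul_right, ← inner_conj_symm φ (deltaOne d μ), Complex.mul_conj,
    Complex.normSq_eq_norm_sq]
  push_cast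
  rfl

theorem HasGap.re_inner_ampliation_ge (hgap : X.HasGap T) {φ ψ : AugSpace d μ}
    (h : (φ, ψ) ∈ (ampliation (Fin d → ℤ) X.B).graph) :
    1 / T * ‖φ - meanPart d μ φ‖ ^ 2 ≤ (inner ℂ φ ψ).re := by
  rw [mem_ampliation_graph_iff] at h
  have h1 := (hasSum_norm_sq (φ - meanPart d μ φ)).mul_left (1 / T)
  have h2 := (lp.hasSum_inner (𝕜 := ℂ) φ ψ).mapL Complex.reCLM
  exact hasSum_le (fun x => hgap.re_inner_ge (h x)) h1 h2

theorem IsSectorial.abs_im_inner_ampliation_le (hs : X.IsSectorial b q) (hgap : X.HasGap T)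
    (hT : 0 < T) {φ ψ : AugSpace d μ} (h : (φ, ψ) ∈ (ampliation (Fin d → ℤ) X.B).graph) :
    |(inner ℂ φ ψ).im| ≤ |q| * ((inner ℂ φ ψ).re + |b| * ‖φ‖ ^ 2) := by
  rw [mem_ampliation_graph_iff] at h
  have h1 := (hasSum_norm_sq φ).mul_left |b|
  have h2 := (lp.hasSum_inner (𝕜 := ℂ) φ ψ).mapL Complex.reCLM
  have h3 := (lp.hasSum_inner (𝕜 := ℂ) φ ψ).mapL Complex.imCLM
  have h4 := (h2.add h1).mul_left |q|
  rw [abs_le]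
  refine ⟨neg_le.1 (hasSum_le (fun x => ?_) h3.neg h4), hasSum_le (fun x => ?_) h3 h4⟩
  · exact (neg_le_abs _).trans (hs.abs_im_inner_le hgap hT (h x))
  · exact (le_abs_self _).trans (hs.abs_im_inner_le hgap hT (h x))

/-- Bound on the numerical range of the lifted operator. -/
theorem numericalRange_lifted (hgap : X.HasGap T) (hs : X.IsSectorial b q) (hT : 0 < T)
    (𝓚 : HoppingKernel d) (v₀ : Lp ℝ ∞ μ) {φ ψ : AugSpace d μ}
    (h : (φ, ψ) ∈ (ampliation (Fin d → ℤ) X.B).graph) :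
    1 / T * (‖φ - meanPart d μ φ‖ ^ 2 + ‖inner ℂ (deltaOne d μ) φ‖ ^ 2)
        ≤ (inner ℂ φ (ψ + X.liftedHop 𝓚 v₀ T φ)).re ∧
      |(inner ℂ φ (ψ + X.liftedHop 𝓚 v₀ T φ)).im| ≤
        |q| * (inner ℂ φ (ψ + X.liftedHop 𝓚 v₀ T φ)).re
          + (|q| * |b| + ‖X.hop 𝓚 v₀ 0‖) * ‖φ‖ ^ 2 := by
  have h1 := hgap.re_inner_ampliation_ge h
  have h2 := hs.abs_im_inner_ampliation_le hgap hT h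
  have e := X.re_inner_hop_zero 𝓚 v₀ φ
  have h3 : |(inner ℂ φ (X.hop 𝓚 v₀ 0 φ)).im| ≤ ‖X.hop 𝓚 v₀ 0‖ * ‖φ‖ ^ 2 := by
    refine (Complex.abs_im_le_norm _).trans ((norm_inner_le_norm _ _).trans ?_)
    have := (X.hop 𝓚 v₀ 0).le_opNorm φ
    nlinarith [norm_nonneg φ]
  rw [inner_add_right, inner_liftedHop]
  simp only [Complex.add_re, Complex.add_im, Complex.ofReal_re, Complex.ofReal_im, e, add_zero,
    zero_add]
  have h4 : 0 ≤ |q| * (1 / T * ‖inner ℂ (deltaOne d μ) φ‖ ^ 2) := by positivity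
  refine ⟨by linarith, (abs_add_le _ _).trans ?_⟩
  linarith

/-- With `g = B⁻¹(v_x - v₀)` and `a` the mean of `φ x`, the projection of the equation at `x` onto
mean-zero functions reads `B(φ₁(x) + i a g) = Q y`. Here `y` is the right-hand side with the
contribution of `φ₁` through the hopping, the potential and `w` removed. The gap bounds the argument
of `B`, and `‖g‖ ≥ χ` isolates `|a|`. -/
theorem mean_component_le (hgap : X.HasGap T) (hT : 0 < T) (𝓚 : HoppingKernel d) (v₀ : Lp ℝ ∞ μ)
    (hv : ∀ x : Fin d → ℤ, x ≠ 0 → ∀ f, (f, mulL2 (X.v v₀ x - v₀) (constOne μ)) ∈ X.B.graph →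
      inner ℂ (constOne μ) f = 0 → χ ≤ ‖f‖)
    {φ ψ : AugSpace d μ} (h : (φ, ψ) ∈ (ampliation (Fin d → ℤ) X.B).graph) (w : ℂ)
    {x : Fin d → ℤ} (hx : x ≠ 0) :
    ‖inner ℂ (constOne μ) (φ x)‖ * χ ≤ ‖(φ - meanPart d μ φ) x‖
      + T * ‖(ψ + (X.liftedHop 𝓚 v₀ T - w • 1) φ
        - (X.hop 𝓚 v₀ 0 - w • 1) (φ - meanPart d μ φ)) x‖ := by
  rw [mem_ampliation_graph_iff] at h
  set a := inner ℂ (constOne μ) (φ x) with ha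
  set u := mulL2 (X.v v₀ x - v₀) (constOne μ) with hu
  have hu0 : inner ℂ (constOne μ) u = 0 := X.inner_constOne_potential v₀ x
  obtain ⟨g, hg, hg0⟩ := hgap.exists_solution hT hu0
  set y := (ψ + (X.liftedHop 𝓚 v₀ T - w • 1) φ
        - (X.hop 𝓚 v₀ 0 - w • 1) (φ - meanPart d μ φ)) x with hy
  have hey : y = ψ x + (Complex.I * a) • u - (w * a) • constOne μ := by
    have e1 : ψ + (X.liftedHop 𝓚 v₀ T - w • 1) φ
        - (X.hop 𝓚 v₀ 0 - w • 1) (φ - meanPart d μ φ)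
        = ψ + Complex.I • X.Vhat v₀ (meanPart d μ φ) - w • meanPart d μ φ
          + (((1 / T : ℝ) : ℂ) * inner ℂ (deltaOne d μ) φ) • deltaOne d μ := by
      have hK := X.Khat_zero_meanPart 𝓚 φ
      rw [liftedHop, sub_apply, sub_apply, map_sub, add_apply]
      have : X.hop 𝓚 v₀ 0 (meanPart d μ φ) = Complex.I • X.Vhat v₀ (meanPart d μ φ) := by
        rw [hop, add_apply, smul_apply, smul_apply, hK, smul_zero, zero_add]
      rw [this]
      simp only [smul_apply, one_apply_eq_self, InnerProductSpace.rankOne_apply]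
      module
    have e2 : deltaOne d μ x = 0 := lp.single_apply_ne _ _ _ hx
    rw [hy, e1]
    change ψ x + Complex.I • (X.Vhat v₀ (meanPart d μ φ)) x - w • (meanPart d μ φ) x
      + (((1 / T : ℝ) : ℂ) * inner ℂ (deltaOne d μ) φ) • deltaOne d μ x = _
    rw [e2, smul_zero, add_zero, Vhat_apply, meanPart_apply, map_smul, ← hu, ← ha, smul_smul,
      smul_smul]
  have hψ := X.inner_constOne_B (h x)
  -- Projecting removes the constant term `w a`, while `B φ(x)` and the potential term already have
  -- mean zero.
  have hQ : y - inner ℂ (constOne μ) y • constOne μ = ψ x + (Complex.I * a) • u := by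
    rw [hey, inner_sub_right, inner_add_right, hψ, inner_smul_right, hu0, inner_smul_right,
      inner_constOne_self]
    module
  have hmem : ((φ - meanPart d μ φ) x + (Complex.I * a) • g, ψ x + (Complex.I * a) • u)
      ∈ X.B.graph :=
    X.B.graph.add_mem (sub_mean_mem_graph (h x)) (X.B.graph.smul_mem (Complex.I * a) hg)
  have hm0 : inner ℂ (constOne μ) ((φ - meanPart d μ φ) x + (Complex.I * a) • g) = 0 := by
    rw [inner_add_right, inner_smul_right, hg0, mul_zero, add_zero]
    exact inner_constOne_sub_mean (φ x)
  have hb := hgap.norm_le hT hmem hm0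
  rw [← hQ] at hb
  have hb' := hb.trans (mul_le_mul_of_nonneg_left (norm_sub_mean_le y) hT.le)
  have h1 : ‖(Complex.I * a) • g‖ ≤ ‖(φ - meanPart d μ φ) x‖
      + ‖(φ - meanPart d μ φ) x + (Complex.I * a) • g‖ := by
    have := norm_sub_le ((φ - meanPart d μ φ) x + (Complex.I * a) • g) ((φ - meanPart d μ φ) x)
    rw [add_sub_cancel_left] at this
    linarith
  rw [norm_smul, norm_mul, Complex.norm_I, one_mul] at h1
  have h2 : ‖a‖ * χ ≤ ‖a‖ * ‖g‖ := by
    gcongr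
    exact hv x hx g hg hg0
  linarith

/-- Square and sum the site estimate over `x ≠ 0`. The site `x = 0`, where the potential difference
vanishes, is subtracted on the left and is controlled by the rank-one lift instead. -/
theorem meanPart_sub_le (hgap : X.HasGap T) (hT : 0 < T) (hχ : 0 < χ) (𝓚 : HoppingKernel d)
    (v₀ : Lp ℝ ∞ μ)
    (hv : ∀ x : Fin d → ℤ, x ≠ 0 → ∀ f, (f, mulL2 (X.v v₀ x - v₀) (constOne μ)) ∈ X.B.graph →
      inner ℂ (constOne μ) f = 0 → χ ≤ ‖f‖)
    {φ ψ : AugSpace d μ} (h : (φ, ψ) ∈ (ampliation (Fin d → ℤ) X.B).graph) {w : ℂ} {κ : ℝ}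
    (hκ : ‖X.hop 𝓚 v₀ 0‖ + ‖w‖ ≤ κ) :
    ‖meanPart d μ φ‖ ^ 2 - ‖inner ℂ (deltaOne d μ) φ‖ ^ 2
      ≤ (2 + 4 * T ^ 2 * κ ^ 2) / χ ^ 2 * ‖φ - meanPart d μ φ‖ ^ 2
        + 4 * T ^ 2 / χ ^ 2 * ‖ψ + (X.liftedHop 𝓚 v₀ T - w • 1) φ‖ ^ 2 := by
  set f := ψ + (X.liftedHop 𝓚 v₀ T - w • 1) φ with hf
  set φ₁ := φ - meanPart d μ φ with hφ₁
  set m := (X.hop 𝓚 v₀ 0 - w • 1) φ₁ with hm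
  have h1 : χ ^ 2 * (‖meanPart d μ φ‖ ^ 2 - ‖inner ℂ (deltaOne d μ) φ‖ ^ 2)
      ≤ 2 * ‖φ₁‖ ^ 2 + 2 * T ^ 2 * ‖f - m‖ ^ 2 := by
    have s1 := ((hasSum_norm_sq (meanPart d μ φ)).sub
      (hasSum_ite_eq (0 : Fin d → ℤ) (‖inner ℂ (deltaOne d μ) φ‖ ^ 2))).mul_left (χ ^ 2)
    have s2 := ((hasSum_norm_sq φ₁).mul_left 2).add ((hasSum_norm_sq (f - m)).mul_left (2 * T ^ 2))
    refine hasSum_le (fun x => ?_) s1 s2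
    rw [meanPart_apply, norm_smul, norm_constOne, mul_one]
    by_cases hx : x = 0
    · subst hx
      rw [inner_deltaOne]
      simp only [if_true, sub_self, mul_zero]
      positivity
    · rw [if_neg hx, sub_zero]
      have := mean_component_le hgap hT 𝓚 v₀ hv h w hx
      rw [← hφ₁, ← hf, ← hm] at this
      have h0 : 0 ≤ ‖inner ℂ (constOne μ) (φ x)‖ * χ := by positivity
      have h3 := pow_le_pow_left₀ h0 this 2
      nlinarith [sq_nonneg (‖φ₁ x‖ - T * ‖(f - m) x‖)]
  have h2 : ‖f - m‖ ≤ ‖f‖ + κ * ‖φ₁‖ := by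
    refine (norm_sub_le _ _).trans ?_
    gcongr
    refine (ContinuousLinearMap.le_opNorm _ _).trans ?_
    gcongr
    refine (norm_sub_le _ _).trans (le_trans ?_ hκ)
    gcongr
    rw [norm_smul]
    exact mul_le_of_le_one_right (norm_nonneg _) ContinuousLinearMap.norm_id_le
  have h3 : ‖f - m‖ ^ 2 ≤ 2 * ‖f‖ ^ 2 + 2 * κ ^ 2 * ‖φ₁‖ ^ 2 := by
    have := pow_le_pow_left₀ (norm_nonneg _) h2 2
    nlinarith [sq_nonneg (‖f‖ - κ * ‖φ₁‖)]
  have h4 : 2 * T ^ 2 * ‖f - m‖ ^ 2 ≤ 2 * T ^ 2 * (2 * ‖f‖ ^ 2 + 2 * κ ^ 2 * ‖φ₁‖ ^ 2) := by gcongr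
  have hχ2 : 0 < χ ^ 2 := by positivity
  have e : (2 + 4 * T ^ 2 * κ ^ 2) / χ ^ 2 * ‖φ₁‖ ^ 2 + 4 * T ^ 2 / χ ^ 2 * ‖f‖ ^ 2
      = ((2 + 4 * T ^ 2 * κ ^ 2) * ‖φ₁‖ ^ 2 + 4 * T ^ 2 * ‖f‖ ^ 2) / χ ^ 2 := by ring
  rw [e, le_div_iff₀ hχ2]
  nlinarith

end ShiftMarkovProcess

/-! ### From the numerical range to lower bounds -/

section NumericalRange

variable {E : Type*} [NormedAddCommGroup E] [InnerProductSpace ℂ E]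

theorem inner_sub_smul_self (φ ξ : E) (w : ℂ) :
    inner ℂ φ (ξ - w • φ) = inner ℂ φ ξ - w * ((‖φ‖ ^ 2 : ℝ) : ℂ) := by
  rw [inner_sub_right, inner_smul_right, inner_self_eq_norm_sq_to_K]
  simp

/-- Apply the planar estimate to `n = ⟨φ, ξ⟩/‖φ‖²`, using `‖n - w‖‖φ‖ ≤ ‖ξ - wφ‖` by Cauchy–Schwarz.
-/
theorem infDist_mul_norm_le_of_outside_cone {T γ p c₀ : ℝ} (hT : 0 < T) (hγ : 0 < γ) (hp : 0 < p)
    {φ ξ : E} {w : ℂ} (hre : 0 ≤ (inner ℂ φ ξ).re)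
    (him : |(inner ℂ φ ξ).im| ≤ p * ((inner ℂ φ ξ).re + c₀ * ‖φ‖ ^ 2))
    (hw : p * (w.re + (c₀ + 1)) ≤ |w.im|) :
    Metric.infDist w (truncSector T γ p (c₀ + 1)) * ‖φ‖
      ≤ (1 + γ / T * ((1 + p) / p)) * ‖ξ - w • φ‖ := by
  rcases (norm_nonneg φ).eq_or_lt with h0 | h0
  · rw [← h0, mul_zero]; positivity
  have h2 : 0 < ‖φ‖ ^ 2 := by positivity
  set n : ℂ := inner ℂ φ ξ / ((‖φ‖ ^ 2 : ℝ) : ℂ) with hn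
  have hnre : n.re = (inner ℂ φ ξ).re / ‖φ‖ ^ 2 := by rw [hn, Complex.div_ofReal_re]
  have hnim : n.im = (inner ℂ φ ξ).im / ‖φ‖ ^ 2 := by rw [hn, Complex.div_ofReal_im]
  have h1 := infDist_truncSector_le_of_outside_cone (T := T) (γ := γ) (p := p) (c₀ := c₀) hT hγ hp
    (n := n) (w := w) (by rw [hnre]; positivity) (by
      rw [hnre, hnim, abs_div, abs_of_pos h2, div_le_iff₀ h2]
      refine him.trans (le_of_eq ?_)
      field_simp) hw
  have h3 : ‖n - w‖ * ‖φ‖ ≤ ‖ξ - w • φ‖ := by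
    have e : inner ℂ φ (ξ - w • φ) = (n - w) * ((‖φ‖ ^ 2 : ℝ) : ℂ) := by
      rw [inner_sub_smul_self, sub_mul, hn, div_mul_cancel₀]
      exact_mod_cast h2.ne'
    have := norm_inner_le_norm (𝕜 := ℂ) φ (ξ - w • φ)
    rw [e, norm_mul, Complex.norm_real, Real.norm_of_nonneg h2.le] at this
    refine le_of_mul_le_mul_left ?_ h0
    linarith
  have h4 : 0 ≤ 1 + γ / T * ((1 + p) / p) := by positivity
  nlinarith

end NumericalRange

/-! ### The lifted operator: lower bound and resolvent -/

namespace ShiftMarkovProcess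

variable {d : ℕ} {Ω : Type*} [TopologicalSpace Ω] [MeasurableSpace Ω] [BorelSpace Ω]
  {μ : Measure Ω} [IsProbabilityMeasure μ] {X : ShiftMarkovProcess d Ω μ} {T b q χ : ℝ}

/-- Outside the cone, `w` is far enough from the numerical range. Inside the cone but off the
sector, `w` is bounded and `Re w ≤ γ/T`, so the estimate on the non-random components has constants
uniform in `w` and closes against the form bound. -/
theorem exists_lowerBound (hgap : X.HasGap T) (hs : X.IsSectorial b q) (hT : 0 < T) (hχ : 0 < χ)
    (𝓚 : HoppingKernel d) (v₀ : Lp ℝ ∞ μ)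
    (hv : ∀ x : Fin d → ℤ, x ≠ 0 → ∀ f, (f, mulL2 (X.v v₀ x - v₀) (constOne μ)) ∈ X.B.graph →
      inner ℂ (constOne μ) f = 0 → χ ≤ ‖f‖) :
    ∃ γ p c C : ℝ, 0 < γ ∧ γ < 1 ∧ 0 < p ∧ 0 < c ∧ 0 < C ∧
      ∀ w ∉ truncSector T γ p c, ∀ φ ψ, (φ, ψ) ∈ (ampliation (Fin d → ℤ) X.B).graph →
        Metric.infDist w (truncSector T γ p c) * ‖φ‖
          ≤ C * ‖ψ + (X.liftedHop 𝓚 v₀ T - w • 1) φ‖ := by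
  obtain ⟨p, hp⟩ : ∃ p, p = |q| + 1 := ⟨_, rfl⟩
  have hp0 : 0 < p := by rw [hp]; positivity
  obtain ⟨c₀, hc₀⟩ : ∃ c₀, c₀ = (|q| * |b| + ‖X.hop 𝓚 v₀ 0‖) / p := ⟨_, rfl⟩
  have hc0 : 0 ≤ c₀ := by rw [hc₀]; positivity
  obtain ⟨r, hr⟩ : ∃ r, r = (1 + p) * (1 / T + |c₀ + 1|) := ⟨_, rfl⟩
  have hr0 : 0 ≤ r := by rw [hr]; positivity
  obtain ⟨κ, hκ⟩ : ∃ κ, κ = ‖X.hop 𝓚 v₀ 0‖ + r := ⟨_, rfl⟩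
  obtain ⟨M, hM⟩ : ∃ M, M = (2 + 4 * T ^ 2 * κ ^ 2) / χ ^ 2 := ⟨_, rfl⟩
  have hM0 : 0 ≤ M := by rw [hM]; positivity
  -- Then `(M + 1)γ = 1/2`, so the loss `γ/T` in the real part is absorbed. `M` depends on `w` only
  -- through the radius `r`, which is fixed before `γ`.
  obtain ⟨γ, hγ⟩ : ∃ γ, γ = 1 / (2 * (M + 1)) := ⟨_, rfl⟩
  have hγ0 : 0 < γ := by rw [hγ]; positivity
  have hγM : (M + 1) * γ = 1 / 2 := by rw [hγ]; field_simp
  have hγ1 : γ < 1 := by nlinarith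
  obtain ⟨D, hD⟩ : ∃ D, D = 4 * T ^ 2 / χ ^ 2 := ⟨_, rfl⟩
  have hD0 : 0 ≤ D := by rw [hD]; positivity
  obtain ⟨Ca, hCa⟩ : ∃ Ca, Ca = 1 + γ / T * ((1 + p) / p) := ⟨_, rfl⟩
  have hCa0 : 0 < Ca := by rw [hCa]; positivity
  obtain ⟨Cb, hCb⟩ : ∃ Cb, Cb = 2 * (M + 1) * T + 2 * D + 1 := ⟨_, rfl⟩
  have hCb0 : 0 < Cb := by rw [hCb]; positivity
  refine ⟨γ, p, c₀ + 1, Ca + (r + 1 / T) * Cb, hγ0, hγ1, hp0, by positivity, by positivity, ?_⟩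
  intro w hw φ ψ h
  obtain ⟨h1, h2⟩ := numericalRange_lifted hgap hs hT 𝓚 v₀ h
  have hre : 0 ≤ (inner ℂ φ (ψ + X.liftedHop 𝓚 v₀ T φ)).re := le_trans (by positivity) h1
  have ef : ψ + (X.liftedHop 𝓚 v₀ T - w • 1) φ = ψ + X.liftedHop 𝓚 v₀ T φ - w • φ := by
    rw [sub_apply, smul_apply, one_apply_eq_self]; abel
  set f := ψ + (X.liftedHop 𝓚 v₀ T - w • 1) φ with hf
  rcases le_or_gt (p * (w.re + (c₀ + 1))) |w.im| with hc | hc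
  · have h3 := infDist_mul_norm_le_of_outside_cone hT hγ0 hp0 hre (c₀ := c₀) (by
      have : p * (c₀ * ‖φ‖ ^ 2) = (|q| * |b| + ‖X.hop 𝓚 v₀ 0‖) * ‖φ‖ ^ 2 := by
        rw [hc₀]; field_simp
      rw [mul_add, this]
      refine h2.trans ?_
      gcongr
      rw [hp]; linarith) hc
    rw [← ef, ← hCa] at h3
    refine h3.trans ?_
    have : 0 ≤ (r + 1 / T) * Cb * ‖f‖ := by positivity
    linarith
  · obtain ⟨hw1, hw2⟩ := norm_le_of_notMem_truncSector hT hγ1 hp0 hw hc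
    rw [← hr] at hw2
    have h3 := meanPart_sub_le hgap hT hχ 𝓚 v₀ hv h (w := w) (κ := κ) (by rw [hκ]; gcongr)
    rw [← hf, ← hM, ← hD] at h3
    have h4 : ‖φ‖ ≤ Cb * ‖f‖ := by
      rw [hCb]
      refine le_mul_of_coercive (N₁ := ‖φ - meanPart d μ φ‖) hT hM0 hγM.le (norm_nonneg _)
        (norm_nonneg _) (sq_nonneg ‖inner ℂ (deltaOne d μ) φ‖) ?_ h3 hD0 ?_
      · rw [norm_sq_eq_meanPart_add φ]; ring
      · have h5 := (Complex.re_le_norm _).trans (norm_inner_le_norm (𝕜 := ℂ) φ f)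
        rw [ef, inner_sub_smul_self, ← ef, Complex.sub_re, Complex.re_mul_ofReal] at h5
        have h6 : w.re * ‖φ‖ ^ 2 ≤ γ / T * ‖φ‖ ^ 2 := by gcongr
        rw [div_eq_inv_mul, ← one_div]
        linarith
    have h5 := infDist_truncSector_le hT hγ0 hγ1 hp0 (show 0 < c₀ + 1 by positivity) w
    calc Metric.infDist w (truncSector T γ p (c₀ + 1)) * ‖φ‖
        ≤ (r + 1 / T) * (Cb * ‖f‖) := by
          gcongr
          exact h5.trans (by linarith)
      _ ≤ _ := by nlinarith [mul_nonneg hCa0.le (norm_nonneg f)]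

/-- The resolvent of the lifted operator outside of a truncated sector. -/
theorem exists_resolvent_lifted (hgap : X.HasGap T) (hs : X.IsSectorial b q) (hT : 0 < T)
    (hχ : 0 < χ) (𝓚 : HoppingKernel d) (v₀ : Lp ℝ ∞ μ)
    (hv : ∀ x : Fin d → ℤ, x ≠ 0 → ∀ f, (f, mulL2 (X.v v₀ x - v₀) (constOne μ)) ∈ X.B.graph →
      inner ℂ (constOne μ) f = 0 → χ ≤ ‖f‖) :
    ∃ γ p c C : ℝ, 0 < γ ∧ γ < 1 ∧ 0 < p ∧ 0 < c ∧ 0 < C ∧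
      ∀ w ∉ truncSector T γ p c,
        ∃ R, IsBddInverse (ampliation (Fin d → ℤ) X.B).graph (X.liftedHop 𝓚 v₀ T - w • 1) R ∧
          ‖R‖ ≤ C / Metric.infDist w (truncSector T γ p c) := by
  obtain ⟨γ, p, c, C, hγ0, hγ1, hp, hc, hC, hb⟩ := exists_lowerBound hgap hs hT hχ 𝓚 v₀ hv
  refine ⟨γ, p, c, C, hγ0, hγ1, hp, hc, hC, fun w hw => ?_⟩
  -- Here `l > c`, so the segment to `w` avoids the sector, and `‖liftedHop‖/l ≤ 1/2`, so the
  -- bounded terms are a small perturbation of `B + l`.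
  obtain ⟨l, hl⟩ : ∃ l, l = c + 1 + 2 * ‖X.liftedHop 𝓚 v₀ T‖ := ⟨_, rfl⟩
  have hl0 : 0 < l := by rw [hl]; positivity
  obtain ⟨R, hR, hRn⟩ := X.isContractionSemigroup.exists_isBddInverse hl0
  rw [← X.B_graph] at hR
  obtain ⟨R', hR', hRn'⟩ := hR.ampliation (ι := Fin d → ℤ)
  obtain ⟨R'', hR'', -⟩ := hR'.exists_add (S := X.liftedHop 𝓚 v₀ T) (by
    calc ‖X.liftedHop 𝓚 v₀ T‖ * ‖R'‖ ≤ ‖X.liftedHop 𝓚 v₀ T‖ * l⁻¹ := by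
          gcongr; exact hRn'.trans hRn
      _ ≤ 1 / 2 := by
        rw [← div_eq_mul_inv, div_le_iff₀ hl0, hl]
        linarith)
  rw [add_comm] at hR''
  refine exists_resolvent_of_lowerBound hT hγ0 hp hc hl0 ?_ hC hR'' hb hw
  rw [hl]
  linarith [norm_nonneg (X.liftedHop 𝓚 v₀ T)]

end ShiftMarkovProcess

/-! ### Removing the rank-one lift -/

section Perturbation

open InnerProductSpace (rankOne)

variable {H : Type*} [NormedAddCommGroup H] [InnerProductSpace ℂ H]

theorem IsBddInverse.resolvent_identity {G : Submodule ℂ (H × H)} {S R R' : H →L[ℂ] H} {w w' : ℂ}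
    (h : IsBddInverse G (S - w • 1) R) (h' : IsBddInverse G (S - w' • 1) R') (ψ : H) :
    R ψ - R' ψ = (w - w') • R (R' ψ) := by
  have h1 := h.left_inv _ _ (h'.right_mem ψ)
  have e : ψ - (S - w' • (1 : H →L[ℂ] H)) (R' ψ) + (S - w • (1 : H →L[ℂ] H)) (R' ψ)
      = ψ - (w - w') • R' ψ := by
    simp only [sub_apply, smul_apply, one_apply_eq_self]
    module
  rw [e, map_sub, map_smul] at h1
  exact sub_eq_iff_eq_add.2 ((sub_eq_iff_eq_add.1 h1).trans (add_comm _ _))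

/-- `e` is a unit vector in the kernel of `A + S` and of its adjoint, where `G` is the graph
of `A`. -/
structure IsReducingKernelVector (G : Submodule ℂ (H × H)) (S : H →L[ℂ] H) (e : H) : Prop where
  norm_eq : ‖e‖ = 1
  mem : (e, -S e) ∈ G
  inner_eq : ∀ φ ψ, (φ, ψ) ∈ G → inner ℂ e (ψ + S φ) = 0

variable {G : Submodule ℂ (H × H)} {S R : H →L[ℂ] H} {e : H} {l w : ℂ}

theorem IsReducingKernelVector.inner_self (he : IsReducingKernelVector G S e) :
    inner ℂ e e = 1 := by
  rw [inner_self_eq_norm_sq_to_K, he.norm_eq]; simp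

/-- The lift moves the eigenvalue of `e` from `0` to `l`. -/
theorem IsReducingKernelVector.resolvent_apply (he : IsReducingKernelVector G S e)
    (hR : IsBddInverse G (S + l • rankOne ℂ e e - w • 1) R) : (l - w) • R e = e := by
  have h := hR.left_inv _ _ he.mem
  have e1 : -S e + (S + l • rankOne ℂ e e - w • (1 : H →L[ℂ] H)) e = (l - w) • e := by
    simp only [sub_apply, add_apply, smul_apply, one_apply_eq_self,
      InnerProductSpace.rankOne_apply, he.inner_self]
    module
  rwa [e1, map_smul] at h

theorem IsReducingKernelVector.inner_resolvent (he : IsReducingKernelVector G S e)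
    (hR : IsBddInverse G (S + l • rankOne ℂ e e - w • 1) R) (ψ : H) :
    (l - w) * inner ℂ e (R ψ) = inner ℂ e ψ := by
  have h := he.inner_eq _ _ (hR.right_mem ψ)
  have e1 : ψ - (S + l • rankOne ℂ e e - w • (1 : H →L[ℂ] H)) (R ψ) + S (R ψ)
      = ψ - (l * inner ℂ e (R ψ)) • e + w • R ψ := by
    simp only [sub_apply, add_apply, smul_apply, one_apply_eq_self,
      InnerProductSpace.rankOne_apply]
    module
  rw [e1, inner_add_right, inner_sub_right, inner_smul_right, inner_smul_right,
    he.inner_self] at h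
  linear_combination -h

theorem norm_rankOne_comp_le (u e : H) (R : H →L[ℂ] H) :
    ‖rankOne ℂ u e ∘L R‖ ≤ ‖u‖ * ‖e‖ * ‖R‖ := by
  refine (ContinuousLinearMap.opNorm_comp_le _ _).trans ?_
  rw [InnerProductSpace.norm_rankOne]

/-- The resolvent of `A + S` from the one of `A + S + l |e⟩⟨e|`. -/
theorem IsReducingKernelVector.exists_resolvent (he : IsReducingKernelVector G S e)
    (hR : IsBddInverse G (S + l • rankOne ℂ e e - w • 1) R) (hw : w ≠ 0) (hl : l - w ≠ 0) :
    ∃ R', IsBddInverse G (S - w • 1) R' ∧ ‖R'‖ ≤ ‖R‖ + (1 / ‖w‖ + 1 / ‖l - w‖) := by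
  have hRe : R e = (l - w)⁻¹ • e := by
    rw [eq_inv_smul_iff₀ hl, he.resolvent_apply hR]
  have hF : 1 - l * inner ℂ e (R e) = -w / (l - w) := by
    rw [hRe, inner_smul_right, he.inner_self]
    field_simp
    ring
  have hF0 : 1 - l * inner ℂ e (R e) ≠ 0 := by
    rw [hF]; exact div_ne_zero (neg_ne_zero.2 hw) hl
  have h := hR.sub_rankOne e l hF0
  have e1 : S + l • rankOne ℂ e e - w • 1 - l • rankOne ℂ e e = S - w • 1 := by abel
  rw [e1] at h
  refine ⟨_, h, (norm_add_le _ _).trans ?_⟩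
  gcongr
  refine ContinuousLinearMap.opNorm_le_bound _ (by positivity) fun ψ => ?_
  have hw' : 0 < ‖w‖ := norm_pos_iff.2 hw
  have hl' : 0 < ‖l - w‖ := norm_pos_iff.2 hl
  have e2 : inner ℂ e (R ψ) = inner ℂ e ψ / (l - w) := by
    rw [eq_div_iff hl, mul_comm, he.inner_resolvent hR]
  rw [smul_apply, ContinuousLinearMap.comp_apply, InnerProductSpace.rankOne_apply, hF, hRe, e2,
    smul_smul, smul_smul, norm_smul, he.norm_eq, mul_one]
  have e3 : l / (-w / (l - w)) * (inner ℂ e ψ / (l - w)) * (l - w)⁻¹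
      = -(l / (w * (l - w))) * inner ℂ e ψ := by
    field_simp
  rw [e3, norm_mul, norm_neg, norm_div, norm_mul]
  have h4 : ‖inner ℂ e ψ‖ ≤ ‖ψ‖ := by
    simpa [he.norm_eq] using norm_inner_le_norm (𝕜 := ℂ) e ψ
  have h5 : ‖l‖ ≤ ‖w‖ + ‖l - w‖ := by
    simpa using norm_add_le w (l - w)
  -- This is the norm form of `l/(w(l - w)) = 1/w + 1/(l - w)`: removing the lift costs only the
  -- distances to `0` and to `l`.
  have h6 : ‖l‖ / (‖w‖ * ‖l - w‖) ≤ 1 / ‖w‖ + 1 / ‖l - w‖ := by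
    rw [div_add_div _ _ hw'.ne' hl'.ne']
    gcongr
    linarith
  gcongr

theorem mem_partIn_graph_iff (L : H →ₗ.[ℂ] H) (M : Submodule ℂ H) (φ ψ : M) :
    (φ, ψ) ∈ (partIn L M).graph ↔ ((φ : H), (ψ : H)) ∈ L.graph := by
  rw [partIn, Submodule.toLinearPMap_graph_eq]
  · rfl
  · rintro ⟨x, y⟩ hx h0
    have hx' : ((x : H), (y : H)) ∈ L.graph := hx
    exact Subtype.ext (L.graph_fst_eq_zero_snd hx' (by simpa using h0))

/-- The part of `A + S` in the complement of `e` has no spectrum where `A + S + l |e⟩⟨e|` has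
a resolvent. -/
theorem IsReducingKernelVector.notMem_spec_partIn {A : H →ₗ.[ℂ] H}
    (he : IsReducingKernelVector A.graph S e)
    (hR : IsBddInverse A.graph (S + l • rankOne ℂ e e - w • 1) R) (hl : l - w ≠ 0) :
    w ∉ spec (partIn (S.toLinearMap +ᵥ A) (ℂ ∙ e)ᗮ) := by
  -- The lifted resolvent preserves the complement of `e`, where the rank-one term vanishes. Its
  -- restriction is the resolvent sought.
  have hmaps : ∀ ψ : ((ℂ ∙ e)ᗮ : Submodule ℂ H), R ψ ∈ ((ℂ ∙ e)ᗮ : Submodule ℂ H) := fun ψ => by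
    have h1 := he.inner_resolvent hR ψ
    rw [Submodule.mem_orthogonal_singleton_iff_inner_right.1 ψ.2] at h1
    exact Submodule.mem_orthogonal_singleton_iff_inner_right.2
      ((mul_eq_zero.1 h1).resolve_left hl)
  simp only [spec, Set.mem_ofPred_eq, not_not]
  refine ⟨(R ∘L ((ℂ ∙ e)ᗮ : Submodule ℂ H).subtypeL).codRestrict _ hmaps, ?_⟩
  rw [isResolventAt_iff]
  refine ⟨fun φ ψ h => ?_, fun ψ => ?_⟩
  · rw [mem_partIn_graph_iff, mem_graph_vadd_iff] at h
    have h1 := hR.left_inv _ _ h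
    have h2 : inner ℂ e (φ : H) = 0 := Submodule.mem_orthogonal_singleton_iff_inner_right.1 φ.2
    refine Subtype.ext ?_
    refine Eq.trans ?_ h1
    change R ((ψ : H) + -(w • (φ : H))) = R _
    congr 1
    simp only [smul_apply, one_apply_eq_self, sub_apply, add_apply,
      InnerProductSpace.rankOne_apply, h2]
    module
  · rw [mem_partIn_graph_iff, mem_graph_vadd_iff]
    have h1 := hR.right_mem (ψ : H)
    have h2 : inner ℂ e (R (ψ : H)) = 0 :=
      Submodule.mem_orthogonal_singleton_iff_inner_right.1 (hmaps ψ)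
    convert h1 using 2
    · rfl
    change (ψ : H) - (-(w • R (ψ : H))) - S (R (ψ : H)) = _
    simp only [smul_apply, one_apply_eq_self, sub_apply, add_apply,
      InnerProductSpace.rankOne_apply, h2]
    module

/-- A zero of `1 - l ⟨e, R e⟩` is a non-degenerate eigenvalue, where `R` is the resolvent of
`A + S + l |e⟩⟨e|`. -/
theorem isNondegenerateEigenvalue_of_eq_zero {A : H →ₗ.[ℂ] H}
    (hR : IsBddInverse A.graph (S + l • rankOne ℂ e e - w • 1) R)
    (hF : l * inner ℂ e (R e) = 1) (hg : inner ℂ e (R (R e)) ≠ 0) :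
    IsNondegenerateEigenvalue (S.toLinearMap +ᵥ A) w := by
  have hmem := hR.right_mem e
  have e1 : e - (S + l • rankOne ℂ e e - w • (1 : H →L[ℂ] H)) (R e) = w • R e - S (R e) := by
    simp only [sub_apply, add_apply, smul_apply, one_apply_eq_self,
      InnerProductSpace.rankOne_apply, smul_smul, hF, one_smul]
    abel
  rw [e1, ← mem_graph_vadd_iff, LinearPMap.mem_graph_iff] at hmem
  obtain ⟨φ, hφ, hφ'⟩ := hmem
  simp only at hφ hφ'
  -- The eigenvector is `R e`. This identity makes any eigenvector a multiple of it. If `(A + S -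
  -- w)η = R e`, pairing the identity with `e` gives `⟨e, R R e⟩ = 0`, which is excluded.
  have key : ∀ η : (S.toLinearMap +ᵥ A).domain,
      R ((S.toLinearMap +ᵥ A) η - w • (η : H)) + (l * inner ℂ e (η : H)) • R e = η := fun η => by
    have h1 := (mem_graph_vadd_iff A S _ _).1 ((S.toLinearMap +ᵥ A).mem_graph η)
    have h2 := hR.left_inv _ _ h1
    refine Eq.trans ?_ h2
    rw [← map_smul, ← map_add]
    congr 1
    simp only [smul_apply, one_apply_eq_self, sub_apply, add_apply,
      InnerProductSpace.rankOne_apply]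
    module
  refine ⟨φ, ?_, ?_, fun η hη => ?_, fun η hη => ?_⟩
  · intro h0
    rw [← hφ, h0, inner_zero_right, mul_zero] at hF
    exact zero_ne_one hF
  · rw [hφ', hφ]
  · have := key η
    rw [hη, sub_self, map_zero, zero_add, ← hφ] at this
    exact ⟨_, this.symm⟩
  · have := key η
    rw [hη, hφ] at this
    have h2 := congrArg (fun y => inner ℂ e y) this
    simp only [inner_add_right, inner_smul_right] at h2
    apply hg
    linear_combination h2 - inner ℂ e (η : H) * hF

end Perturbation

/-! ### The perturbed eigenvalue by the implicit function theorem -/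

section AnalyticPerturbation

open InnerProductSpace (rankOne)
open scoped ContDiff

variable {H : Type*} [NormedAddCommGroup H] [InnerProductSpace ℂ H] [CompleteSpace H]
  {V : Type*} [NormedAddCommGroup V] [NormedSpace ℂ V]

/-- The resolvent of `A + S z + l |e⟩⟨e|` near `(z, w) = (0, 0)`, where `R₀` is the resolvent
at `(0, 0)`. -/
def nearResolvent (S : V → H →L[ℂ] H) (R₀ : H →L[ℂ] H) (zw : V × ℂ) : H →L[ℂ] H :=
  R₀ * Ring.inverse (1 + (S zw.1 - S 0 - zw.2 • 1) * R₀)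

theorem analyticAt_nearResolvent {S : V → H →L[ℂ] H} (hS : AnalyticAt ℂ S 0) (R₀ : H →L[ℂ] H) :
    AnalyticAt ℂ (nearResolvent S R₀) (0, 0) := by
  have h1 : AnalyticAt ℂ (fun zw : V × ℂ => S zw.1) (0, 0) :=
    hS.comp_of_eq analyticAt_fst rfl
  have h2 : AnalyticAt ℂ (fun zw : V × ℂ => 1 + (S zw.1 - S 0 - zw.2 • 1) * R₀) (0, 0) :=
    analyticAt_const.add ((((h1.sub analyticAt_const).sub
      (analyticAt_snd.smul analyticAt_const))).mul analyticAt_const)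
  have h3 : AnalyticAt ℂ (Ring.inverse : (H →L[ℂ] H) → H →L[ℂ] H)
      (1 + (S (0 : V) - S 0 - (0 : ℂ) • 1) * R₀) := by
    have := analyticAt_inverse (𝕜 := ℂ) (1 : (H →L[ℂ] H)ˣ)
    simpa using this
  exact analyticAt_const.mul (h3.comp_of_eq h2 rfl)

theorem eventually_isBddInverse_nearResolvent {G : Submodule ℂ (H × H)} {S : V → H →L[ℂ] H}
    (hS : AnalyticAt ℂ S 0) {P R₀ : H →L[ℂ] H} (hR₀ : IsBddInverse G (S 0 + P - (0 : ℂ) • 1) R₀) :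
    ∀ᶠ zw in 𝓝 ((0, 0) : V × ℂ),
      IsBddInverse G (S zw.1 + P - zw.2 • 1) (nearResolvent S R₀ zw) := by
  have hc : ContinuousAt (fun zw : V × ℂ => 1 + (S zw.1 - S 0 - zw.2 • 1) * R₀) (0, 0) := by
    have h1 : ContinuousAt (fun zw : V × ℂ => S zw.1) (0, 0) :=
      ContinuousAt.comp_of_eq hS.continuousAt continuousAt_fst rfl
    exact continuousAt_const.add ((((h1.sub continuousAt_const).sub
      (continuousAt_snd.smul continuousAt_const))).mul continuousAt_const)
  have hu : {x : H →L[ℂ] H | IsUnit x} ∈ 𝓝 (1 + (S (0 : V) - S 0 - (0 : ℂ) • 1) * R₀) :=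
    Units.isOpen.mem_nhds (by simp)
  filter_upwards [hc hu] with zw h
  have := hR₀.add_of_isUnit h
  have e : S zw.1 + P - zw.2 • (1 : H →L[ℂ] H)
      = S 0 + P - (0 : ℂ) • 1 + (S zw.1 - S 0 - zw.2 • 1) := by module
  rw [e]
  exact this

/-- Persistence of the non-degenerate eigenvalue `0` under an analytic perturbation, with an
estimate of the resolvent near that eigenvalue. -/
theorem exists_eigenvalue [CompleteSpace V] {A : H →ₗ.[ℂ] H} {S : V → H →L[ℂ] H} {e : H} {l : ℂ} (hl : l ≠ 0)
    (hS : AnalyticAt ℂ S 0) (he : IsReducingKernelVector A.graph (S 0) e) {R₀ : H →L[ℂ] H}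
    (hR₀ : IsBddInverse A.graph (S 0 + l • rankOne ℂ e e - (0 : ℂ) • 1) R₀) {ρ : ℝ} (hρ : 0 < ρ) :
    ∃ r C : ℝ, 0 < r ∧ r ≤ ρ ∧ 0 < C ∧ ∃ E : V → ℂ, ∀ᶠ z in 𝓝 (0 : V),
      AnalyticAt ℂ E z ∧ ‖E z‖ < r ∧
      IsNondegenerateEigenvalue ((S z).toLinearMap +ᵥ A) (E z) ∧
      ∀ w, w ≠ E z → ‖w‖ < r →
        ∃ R, IsBddInverse A.graph (S z - w • 1) R ∧ ‖R‖ ≤ C / ‖w - E z‖ := by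
  have hres := eventually_isBddInverse_nearResolvent hS hR₀
  have han := analyticAt_nearResolvent hS R₀
  generalize nearResolvent S R₀ = Q at hres han
  have hlpos : 0 < ‖l‖ := norm_pos_iff.2 hl
  let F : V × ℂ → ℂ := fun zw => 1 - l * inner ℂ e (Q zw e)
  have hF : AnalyticAt ℂ F (0, 0) := by
    have h1 := ((innerSL ℂ e ∘L ContinuousLinearMap.apply ℂ H e).analyticAt
      (Q (0, 0))).comp_of_eq han rfl
    exact analyticAt_const.sub (analyticAt_const.mul h1)
  -- At `z = 0` the resolvent acts on `e` as `(l - w)⁻¹`, so `F` is explicit there, with derivative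
  -- `-1/l ≠ 0` at the origin.
  have hFw : ∀ᶠ w in 𝓝 (0 : ℂ), F (0, w) = -w / (l - w) := by
    have h1 : Tendsto (fun w : ℂ => ((0 : V), w)) (𝓝 0) (𝓝 (0, 0)) :=
      (Continuous.prodMk_right (0 : V)).tendsto 0
    have h2 : ∀ᶠ w in 𝓝 (0 : ℂ), l - w ≠ 0 := by
      have : ContinuousAt (fun w : ℂ => l - w) 0 := by fun_prop
      exact this.eventually_ne (by simpa using hl)
    filter_upwards [h1.eventually hres, h2] with w hw hlw
    have h3 := he.resolvent_apply hw
    have h4 : Q (0, w) e = (l - w)⁻¹ • e := by rw [eq_inv_smul_iff₀ hlw, h3]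
    simp only [F]
    rw [h4, inner_smul_right, he.inner_self]
    field_simp
    ring
  have hF0 : F (0, 0) = 0 := by simpa using hFw.self_of_nhds
  have hder : HasDerivAt (fun w => F (0, w)) (-1 / l) 0 := by
    have h1 : HasDerivAt (fun w : ℂ => -w / (l - w)) (-1 / l) 0 := by
      have := (hasDerivAt_neg (0 : ℂ)).fun_div ((hasDerivAt_id' (0 : ℂ)).const_sub l)
        (by simpa using hl)
      refine this.congr_deriv ?_
      field_simp
      ring
    exact h1.congr_of_eventuallyEq hFw
  have hcd : ContDiffAt ℂ ω F (0, 0) := hF.contDiffAt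
  have hinv : (fderiv ℂ F (0, 0) ∘L ContinuousLinearMap.inr ℂ V ℂ).IsInvertible := by
    have h1 : HasFDerivAt (fun w : ℂ => F (0, w))
        (fderiv ℂ F (0, 0) ∘L ContinuousLinearMap.inr ℂ V ℂ) 0 :=
      HasFDerivAt.comp (0 : ℂ) (f := fun w : ℂ => ((0 : V), w)) (g := F)
        hF.differentiableAt.hasFDerivAt (hasFDerivAt_prodMk_right (0 : V) (0 : ℂ))
    have h2 := h1.unique hder.hasFDerivAt
    rw [h2]
    have hne : -1 / l ≠ 0 := div_ne_zero (by norm_num) hl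
    refine ⟨ContinuousLinearEquiv.unitsEquivAut ℂ (Units.mk0 _ hne), ?_⟩
    ext
    simp
  let E := hcd.implicitFunction (by simp) hinv
  have hE0 : E 0 = 0 := hcd.implicitFunction_apply_self (by simp) hinv
  have hEan : AnalyticAt ℂ E 0 := (hcd.contDiffAt_implicitFunction (by simp) hinv).analyticAt
  have hEF : ∀ᶠ z in 𝓝 (0 : V), F (z, E z) = 0 := by
    have := hcd.eventually_apply_implicitFunction (by simp) hinv
    rwa [hF0] at this
  -- uniform control of the resolvent near the origin
  obtain ⟨M, hM⟩ : ∃ M, M = ‖Q (0, 0)‖ + 1 := ⟨_, rfl⟩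
  have hMpos : 0 < M := by rw [hM]; positivity
  have hbd : ∀ᶠ zw in 𝓝 ((0, 0) : V × ℂ), ‖Q zw‖ < M :=
    han.continuousAt.norm.eventually_lt continuousAt_const (by rw [hM]; linarith)
  -- Two independent spectral parameters are kept, since the resolvent identity between `w` and `E
  -- z` produces a product of two different resolvents. At the origin the value is `l⁻²`; half of it
  -- is retained nearby.
  have hg : ∀ᶠ y in 𝓝 ((0, 0, 0) : V × ℂ × ℂ),
      1 / (2 * ‖l‖ ^ 2) < ‖inner ℂ e (Q (y.1, y.2.1) (Q (y.1, y.2.2) e))‖ := by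
    have c1 : ContinuousAt (fun y : V × ℂ × ℂ => Q (y.1, y.2.1)) (0, 0, 0) :=
      ContinuousAt.comp_of_eq han.continuousAt (by fun_prop) rfl
    have c2 : ContinuousAt (fun y : V × ℂ × ℂ => Q (y.1, y.2.2)) (0, 0, 0) :=
      ContinuousAt.comp_of_eq han.continuousAt (by fun_prop) rfl
    have c3 : ContinuousAt (fun y : V × ℂ × ℂ => inner ℂ e (Q (y.1, y.2.1) (Q (y.1, y.2.2) e)))
        (0, 0, 0) := continuousAt_const.inner ((c1.clm_apply (c2.clm_apply continuousAt_const)))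
    refine continuousAt_const.eventually_lt c3.norm ?_
    have h0 := he.resolvent_apply hres.self_of_nhds
    simp only [sub_zero] at h0
    have h1 : Q (0, 0) e = l⁻¹ • e := by rw [eq_inv_smul_iff₀ hl, h0]
    simp only [h1, map_smul, inner_smul_right, he.inner_self]
    rw [mul_one, norm_mul, norm_inv]
    have h2 : ‖l‖⁻¹ * ‖l‖⁻¹ = 2 * (1 / (2 * ‖l‖ ^ 2)) := by field_simp
    have h3 : 0 < 1 / (2 * ‖l‖ ^ 2) := by positivity
    linarith
  have hmix : ∀ᶠ y in 𝓝 ((0, 0, 0) : V × ℂ × ℂ),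
      1 / (2 * ‖l‖ ^ 2) < ‖inner ℂ e (Q (y.1, y.2.1) (Q (y.1, y.2.2) e))‖ ∧
      ‖Q (y.1, y.2.1)‖ < M ∧ IsBddInverse A.graph (S y.1 + l • rankOne ℂ e e - y.2.1 • 1)
        (Q (y.1, y.2.1)) := by
    have t : Tendsto (fun y : V × ℂ × ℂ => (y.1, y.2.1)) (𝓝 (0, 0, 0)) (𝓝 (0, 0)) :=
      Continuous.tendsto' (by fun_prop) _ _ rfl
    exact hg.and ((t.eventually hbd).and (t.eventually hres))
  obtain ⟨δ, hδ, hball⟩ := Metric.eventually_nhds_iff.1 hmix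
  have hball' : ∀ z w w', ‖z‖ < δ → ‖w‖ < δ → ‖w'‖ < δ →
      1 / (2 * ‖l‖ ^ 2) < ‖inner ℂ e (Q (z, w) (Q (z, w') e))‖ ∧
      ‖Q (z, w)‖ < M ∧ IsBddInverse A.graph (S z + l • rankOne ℂ e e - w • 1) (Q (z, w)) := by
    intro z w w' h1 h2 h3
    refine hball (y := (z, w, w')) ?_
    simp only [Prod.dist_eq, dist_zero_right, max_lt_iff]
    exact ⟨h1, h2, h3⟩
  have hr : 0 < min δ ρ := lt_min hδ hρ
  refine ⟨min δ ρ, 2 * min δ ρ * M + 2 * ‖l‖ ^ 2 * M ^ 2, hr, min_le_right _ _, by positivity, E, ?_⟩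
  have hEsmall : ∀ᶠ z in 𝓝 (0 : V), ‖E z‖ < min δ ρ :=
    hEan.continuousAt.norm.eventually_lt continuousAt_const (by rw [hE0, norm_zero]; exact hr)
  have hzsmall : ∀ᶠ z in 𝓝 (0 : V), ‖z‖ < δ :=
    (continuous_norm.tendsto' 0 0 norm_zero).eventually_lt_const hδ
  filter_upwards [hEan.eventually_analyticAt, hEsmall, hEF, hzsmall] with z h1 h2 h3 hz
  have hEδ : ‖E z‖ < δ := h2.trans_le (min_le_left _ _)
  obtain ⟨g1, -, g3⟩ := hball' z (E z) (E z) hz hEδ hEδ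
  have hlower : 0 < 1 / (2 * ‖l‖ ^ 2) := by positivity
  have hFE : l * inner ℂ e (Q (z, E z) e) = 1 := (sub_eq_zero.1 h3).symm
  refine ⟨h1, h2, ?_, fun w hw hwr => ?_⟩
  · refine isNondegenerateEigenvalue_of_eq_zero g3 hFE ?_
    exact norm_pos_iff.1 (hlower.trans g1)
  · have hwδ : ‖w‖ < δ := hwr.trans_le (min_le_left _ _)
    obtain ⟨k1, k2, k3⟩ := hball' z w (E z) hz hwδ hEδ
    have hid := k3.resolvent_identity g3 e
    -- As `F` vanishes at `E z`, the resolvent identity factors out `w - E z` exactly. This gives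
    -- `|F| ≥ |w - E z|/(2|l|)`, uniformly in `z`.
    have hFw' : 1 - l * inner ℂ e (Q (z, w) e)
        = -(l * (w - E z) * inner ℂ e (Q (z, w) (Q (z, E z) e))) := by
      have h5 := congrArg (fun y => inner ℂ e y) hid
      simp only [inner_sub_right, inner_smul_right] at h5
      linear_combination -l * h5 - hFE
    have hwE : 0 < ‖w - E z‖ := norm_pos_iff.2 (sub_ne_zero.2 hw)
    have hFlow : ‖w - E z‖ / (2 * ‖l‖) ≤ ‖1 - l * inner ℂ e (Q (z, w) e)‖ := by
      rw [hFw', norm_neg, norm_mul, norm_mul]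
      calc ‖w - E z‖ / (2 * ‖l‖) = ‖l‖ * ‖w - E z‖ * (1 / (2 * ‖l‖ ^ 2)) := by field_simp
        _ ≤ _ := by gcongr
    have hFpos : 0 < ‖1 - l * inner ℂ e (Q (z, w) e)‖ := lt_of_lt_of_le (by positivity) hFlow
    have key := k3.sub_rankOne e l (norm_pos_iff.1 hFpos)
    have e1 : S z + l • rankOne ℂ e e - w • 1 - l • rankOne ℂ e e = S z - w • 1 := by abel
    rw [e1] at key
    refine ⟨_, key, (norm_add_le _ _).trans ?_⟩
    have b1 : ‖Q (z, w)‖ ≤ 2 * min δ ρ * M / ‖w - E z‖ := by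
      rw [le_div_iff₀ hwE]
      have : ‖w - E z‖ ≤ 2 * min δ ρ := (norm_sub_le _ _).trans (by linarith)
      nlinarith [norm_nonneg (Q (z, w)), norm_nonneg (w - E z)]
    have b2 : ‖(l / (1 - l * inner ℂ e (Q (z, w) e))) • (rankOne ℂ (Q (z, w) e) e ∘L Q (z, w))‖
        ≤ 2 * ‖l‖ ^ 2 * M ^ 2 / ‖w - E z‖ := by
      rw [norm_smul, norm_div]
      have b3 : ‖rankOne ℂ (Q (z, w) e) e ∘L Q (z, w)‖ ≤ M ^ 2 := by
        refine (norm_rankOne_comp_le _ _ _).trans ?_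
        have := (Q (z, w)).le_opNorm e
        rw [he.norm_eq, mul_one] at this ⊢
        rw [pow_two]
        gcongr
        exact this.trans k2.le
      have b4 : ‖l‖ / ‖1 - l * inner ℂ e (Q (z, w) e)‖ ≤ 2 * ‖l‖ ^ 2 / ‖w - E z‖ := by
        rw [div_le_div_iff₀ hFpos hwE]
        rw [div_le_iff₀ (by positivity)] at hFlow
        nlinarith
      calc _ ≤ 2 * ‖l‖ ^ 2 / ‖w - E z‖ * M ^ 2 := by gcongr
        _ = _ := by ring
    rw [add_div]
    linarith

end AnalyticPerturbation

/-! ### Analyticity of exponential sums -/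

section ExponentialSums

open scoped Nat

variable {V W ι : Type*} [NormedAddCommGroup V] [NormedSpace ℂ V] [NormedAddCommGroup W]
  [NormedSpace ℂ W]

/-- The `n`-th term of the power series of `z ↦ exp(ℓ z) c`. -/
def expTerm (ℓ : V →L[ℂ] ℂ) (c : W) (n : ℕ) : ContinuousMultilinearMap ℂ (fun _ : Fin n => V) W :=
  ((ContinuousMultilinearMap.mkPiAlgebra ℂ (Fin n) ℂ).compContinuousLinearMap
    (fun _ => ℓ)).smulRight (((n ! : ℂ)⁻¹) • c)

theorem expTerm_apply (ℓ : V →L[ℂ] ℂ) (c : W) (n : ℕ) (m : Fin n → V) :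
    expTerm ℓ c n m = (∏ i, ℓ (m i)) • ((n ! : ℂ)⁻¹) • c := by
  simp [expTerm]

theorem norm_expTerm_le (ℓ : V →L[ℂ] ℂ) (c : W) (n : ℕ) :
    ‖expTerm ℓ c n‖ ≤ ‖ℓ‖ ^ n / n ! * ‖c‖ := by
  refine ContinuousMultilinearMap.opNorm_le_bound (by positivity) fun m => ?_
  rw [expTerm_apply, norm_smul, norm_smul, norm_inv, norm_prod]
  have h : ∏ i, ‖ℓ (m i)‖ ≤ ‖ℓ‖ ^ n * ∏ i, ‖m i‖ := by
    calc ∏ i, ‖ℓ (m i)‖ ≤ ∏ i, ‖ℓ‖ * ‖m i‖ :=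
          Finset.prod_le_prod (fun _ _ => norm_nonneg _) (fun i _ => ℓ.le_opNorm (m i))
      _ = _ := by rw [Finset.prod_mul_distrib]; simp
  have h2 : ‖(n ! : ℂ)‖ = n ! := by simp
  rw [h2]
  calc _ ≤ (‖ℓ‖ ^ n * ∏ i, ‖m i‖) * ((n ! : ℝ)⁻¹ * ‖c‖) := by gcongr
    _ = _ := by ring

variable [CompleteSpace W]

/-- Sums of exponentials of linear forms with exponentially decaying coefficients are analytic. -/
theorem analyticAt_tsum_exp {ℓ : ι → V →L[ℂ] ℂ} {c : ι → W} {r : ℝ} (hr : 0 < r)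
    (hs : Summable fun i => Real.exp (r * ‖ℓ i‖) * ‖c i‖) :
    AnalyticAt ℂ (fun z => ∑' i, Complex.exp (ℓ i z) • c i) 0 := by
  -- From `(r‖ℓ‖)^n/n! ≤ e^{r‖ℓ‖}`: the hypothesis bounds the coefficients of every order at once,
  -- so the radius of convergence is at least `r`.
  have hbound : ∀ n i, ‖expTerm (ℓ i) (c i) n‖ * r ^ n ≤ Real.exp (r * ‖ℓ i‖) * ‖c i‖ := by
    intro n i
    calc ‖expTerm (ℓ i) (c i) n‖ * r ^ n ≤ (‖ℓ i‖ ^ n / n ! * ‖c i‖) * r ^ n := by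
          gcongr; exact norm_expTerm_le _ _ _
      _ = (r * ‖ℓ i‖) ^ n / n ! * ‖c i‖ := by ring
      _ ≤ _ := by
        gcongr
        exact Real.pow_div_factorial_le_exp _ (by positivity) n
  have hsum : ∀ n, Summable fun i => ‖expTerm (ℓ i) (c i) n‖ := by
    intro n
    refine (hs.mul_right ((r ^ n)⁻¹)).of_nonneg_of_le (fun _ => norm_nonneg _) fun i => ?_
    rw [← div_eq_mul_inv, le_div_iff₀ (by positivity)]
    exact hbound n i
  let P : FormalMultilinearSeries ℂ V W := fun n => ∑' i, expTerm (ℓ i) (c i) n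
  refine ⟨P, ENNReal.ofReal r, ?_, by simpa using hr, ?_⟩
  · refine P.le_radius_of_bound (r := r.toNNReal) (∑' i, Real.exp (r * ‖ℓ i‖) * ‖c i‖) fun n => ?_
    rw [Real.coe_toNNReal r hr.le]
    calc ‖P n‖ * r ^ n ≤ (∑' i, ‖expTerm (ℓ i) (c i) n‖) * r ^ n := by
          gcongr
          exact norm_tsum_le_tsum_norm (hsum n)
      _ = ∑' i, ‖expTerm (ℓ i) (c i) n‖ * r ^ n := by rw [tsum_mul_right]
      _ ≤ _ := ((hsum n).mul_right _).tsum_le_tsum (hbound n) hs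
  · intro y hy
    have hy' : ‖y‖ < r := by
      simpa [Metric.eball_ofReal] using hy
    have hPn : ∀ n, HasSum (fun i => expTerm (ℓ i) (c i) n fun _ => y) (P n fun _ => y) := fun n =>
      ContinuousMultilinearMap.hasSum_eval (hsum n).of_norm.hasSum _
    have hterm : ∀ i n, expTerm (ℓ i) (c i) n (fun _ => y)
        = ((ℓ i y) ^ n / n ! : ℂ) • c i := fun i n => by
      rw [expTerm_apply, smul_smul, div_eq_mul_inv]
      simp
    have hexp : ∀ i, HasSum (fun n => expTerm (ℓ i) (c i) n fun _ => y)
        (Complex.exp (ℓ i y) • c i) := fun i => by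
      simp only [hterm]
      have := NormedSpace.exp_series_hasSum_exp' (𝕂 := ℂ) (ℓ i y)
      rw [← Complex.exp_eq_exp_ℂ] at this
      have h2 := this.smul_const (c i)
      simpa [div_eq_inv_mul] using h2
    have hnorm : ∀ i, HasSum (fun n => ‖expTerm (ℓ i) (c i) n fun _ => y‖)
        (Real.exp ‖ℓ i y‖ * ‖c i‖) := fun i => by
      have := (NormedSpace.exp_series_hasSum_exp' (𝕂 := ℝ) ‖ℓ i y‖).mul_right ‖c i‖
      rw [← Real.exp_eq_exp_ℝ] at this
      have e : (fun n => ‖expTerm (ℓ i) (c i) n fun _ => y‖)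
          = fun n => ((n ! : ℝ)⁻¹ • ‖ℓ i y‖ ^ n) * ‖c i‖ := by
        funext n
        rw [hterm, norm_smul, norm_div, norm_pow]
        simp [div_eq_inv_mul]
      rw [e]
      exact this
    -- Absolute summability over pairs (index, order) permits exchanging the sum of exponentials
    -- with the power series.
    have hprod : Summable fun x : ι × ℕ => expTerm (ℓ x.1) (c x.1) x.2 fun _ => y := by
      refine Summable.of_norm ((summable_prod_of_nonneg fun _ => norm_nonneg _).2
        ⟨fun i => (hnorm i).summable, ?_⟩)
      simp only [(hnorm _).tsum_eq]
      refine hs.of_nonneg_of_le (fun _ => by positivity) fun i => ?_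
      gcongr
      calc ‖ℓ i y‖ ≤ ‖ℓ i‖ * ‖y‖ := (ℓ i).le_opNorm y
        _ ≤ r * ‖ℓ i‖ := by rw [mul_comm]; gcongr
    have h1 := hprod.hasSum.prod_fiberwise hexp
    have h2 := ((Equiv.prodComm ℕ ι).hasSum_iff.2 hprod.hasSum).prod_fiberwise hPn
    rw [zero_add, h1.tsum_eq]
    exact h2

end ExponentialSums

/-! ### Analyticity of the hopping term in `z` -/

section Hopping

variable {d : ℕ}

/-- The linear form `z ↦ -i z·ζ`. -/
def phaseForm (ζ : Fin d → ℤ) : EuclideanSpace ℂ (Fin d) →L[ℂ] ℂ :=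
  (-Complex.I) • innerSL ℂ (WithLp.toLp 2 fun i => (ζ i : ℂ))

theorem phaseForm_apply (ζ : Fin d → ℤ) (z : EuclideanSpace ℂ (Fin d)) :
    phaseForm ζ z = -Complex.I * ∑ i, z i * (ζ i : ℂ) := by
  simp [phaseForm, PiLp.inner_apply]

theorem norm_phaseForm (ζ : Fin d → ℤ) : ‖phaseForm ζ‖ = latticeNorm ζ := by
  rw [phaseForm, norm_smul, innerSL_apply_norm, latticeNorm, EuclideanSpace.norm_eq,
    EuclideanSpace.norm_eq]
  simp

variable {Ω : Type*} [TopologicalSpace Ω] [MeasurableSpace Ω] [BorelSpace Ω]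
  {μ : Measure Ω} (X : ShiftMarkovProcess d Ω μ)

/-- Only the shifted translations carry a phase, and the norm of the phase form is `latticeNorm`.
The exponential moment of `h` is thus the summability condition for exponential sums, with radius
`m`. -/
theorem ShiftMarkovProcess.analyticAt_Khat (𝓚 : HoppingKernel d) :
    AnalyticAt ℂ (X.Khat 𝓚) 0 := by
  obtain ⟨m, hm, hs⟩ := 𝓚.exp_bounded
  let c : (Fin d → ℤ) → AugSpace d μ →L[ℂ] AugSpace d μ :=
    fun ζ => 𝓚.h ζ • (translate μ ζ ∘L X.shift ζ)
  have hc : ∀ ζ, ‖c ζ‖ ≤ ‖𝓚.h ζ‖ := fun ζ => by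
    rw [norm_smul]
    exact mul_le_of_le_one_right (norm_nonneg _) (X.norm_translate_comp_shift_le ζ)
  have hsum : Summable fun ζ => Real.exp (m * ‖phaseForm ζ‖) * ‖c ζ‖ := by
    refine hs.of_nonneg_of_le (fun _ => by positivity) fun ζ => ?_
    rw [norm_phaseForm]
    gcongr
    exact hc ζ
  have h1 := analyticAt_tsum_exp hm hsum
  have h2 : AnalyticAt ℂ (fun _ : EuclideanSpace ℂ (Fin d) => ∑' ζ, 𝓚.h ζ • translate μ ζ) 0 :=
    analyticAt_const
  refine (h2.sub h1).congr ?_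
  filter_upwards [Metric.ball_mem_nhds (0 : EuclideanSpace ℂ (Fin d)) hm] with z hz
  have hz' : ‖z‖ < m := by simpa using hz
  have s1 : Summable fun ζ => 𝓚.h ζ • translate μ ζ := by
    refine Summable.of_norm_bounded (summable_norm_h 𝓚) fun ζ => ?_
    rw [norm_smul]
    exact mul_le_of_le_one_right (norm_nonneg _) (norm_translate_le ζ)
  have s2 : Summable fun ζ => Complex.exp (phaseForm ζ z) • c ζ := by
    refine Summable.of_norm_bounded hsum fun ζ => ?_
    rw [norm_smul]
    gcongr
    refine (Complex.norm_exp_le_exp_norm _).trans (Real.exp_le_exp.2 ?_)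
    refine ((phaseForm ζ).le_opNorm z).trans ?_
    rw [mul_comm]
    gcongr
  rw [Pi.sub_apply, ← s1.tsum_sub s2, Khat]
  refine tsum_congr fun ζ => ?_
  rw [smul_sub, phaseForm_apply, smul_comm (𝓚.h ζ)]

end Hopping

/-! ### Spectrum and resolvent of the perturbed operator -/

section SpectralPerturbation

open InnerProductSpace (rankOne)

theorem truncSector_subset {T γ p c t : ℝ} (hT : 0 < T) (hp : 0 < p) (ht : 0 ≤ t) :
    truncSector T γ p c ⊆ truncSector T (γ - t) p (c + t) := by
  rintro w ⟨h1, h2⟩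
  refine ⟨le_trans (by gcongr; linarith) h1, h2.trans ?_⟩
  gcongr
  linarith

/-- Enlarging by `t` moves the vertical edge by `t/T` and the slanted edges vertically by `p t`. A
point beyond the new boundary is therefore at distance of order `t` from the old sector. -/
theorem mul_min_le_dist_of_notMem_truncSector {T γ p c t : ℝ} (hp : 0 < p)
    (ht : 0 ≤ t) {w s : ℂ} (hw : w ∉ truncSector T (γ - t) p (c + t))
    (hs : s ∈ truncSector T γ p c) : t * min (1 / T) (p / (1 + p)) ≤ dist w s := by
  obtain ⟨hs1, hs2⟩ := hs
  rw [dist_comm, dist_eq_norm]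
  have a1 := (le_abs_self _).trans (Complex.abs_re_le_norm (s - w))
  rw [Complex.sub_re] at a1
  by_cases h : (γ - t) / T ≤ w.re
  · have h2 : p * (w.re + (c + t)) < |w.im| := by
      by_contra! h'
      exact hw ⟨h, h'⟩
    have a2 : |w.im| - |s.im| ≤ ‖s - w‖ := by
      have h3 := Complex.abs_im_le_norm (s - w)
      rw [Complex.sub_im, abs_sub_comm] at h3
      exact (abs_sub_abs_le_abs_sub w.im s.im).trans h3
    calc t * min (1 / T) (p / (1 + p)) ≤ t * (p / (1 + p)) := by gcongr; exact min_le_right _ _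
      _ = (t * p) / (1 + p) := by ring
      _ ≤ ‖s - w‖ := by
        rw [div_le_iff₀ (by positivity)]
        nlinarith
  · calc t * min (1 / T) (p / (1 + p)) ≤ t * (1 / T) := by gcongr; exact min_le_left _ _
      _ = γ / T - (γ - t) / T := by ring
      _ ≤ ‖s - w‖ := by linarith

theorem ofReal_mem_truncSector {T γ p c a : ℝ} (hp : 0 < p) (ha : γ / T ≤ a) (hac : 0 ≤ a + c) :
    (a : ℂ) ∈ truncSector T γ p c := by
  refine ⟨by simpa using ha, ?_⟩
  simp only [Complex.ofReal_im, Complex.ofReal_re, abs_zero]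
  positivity

theorem IsNondegenerateEigenvalue.mem_spec {H : Type*} [NormedAddCommGroup H] [NormedSpace ℂ H]
    {L : H →ₗ.[ℂ] H} {w : ℂ} (h : IsNondegenerateEigenvalue L w) : w ∈ spec L := by
  rintro ⟨R, hR⟩
  obtain ⟨φ, hφ, hφ', -⟩ := h
  apply hφ
  have := hR.left_inv φ
  rwa [hφ', sub_self, map_zero, eq_comm] at this

variable {H : Type*} [NormedAddCommGroup H] [InnerProductSpace ℂ H]
  {G : Submodule ℂ (H × H)} {S₀ : H →L[ℂ] H} {e : H} {T γ p c C : ℝ}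

/-- Since `γ < 1`, the lifted eigenvalue `1/T` lies in the sector. The costs `1/|w|` and `1/|1/T -
w|` of removing the lift are then each at most the inverse distance, giving `C + 2`. -/
theorem IsReducingKernelVector.exists_resolvent_le (hT : 0 < T) (hγ1 : γ < 1)
    (hp : 0 < p) (hc : 0 < c) (hC : 0 < C) (he : IsReducingKernelVector G S₀ e)
    (hres : ∀ w ∉ truncSector T γ p c,
      ∃ R, IsBddInverse G (S₀ + ((1 / T : ℝ) : ℂ) • rankOne ℂ e e - w • 1) R ∧
        ‖R‖ ≤ C / Metric.infDist w (truncSector T γ p c))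
    {w : ℂ} (hw : w ∉ {0} ∪ truncSector T γ p c) :
    ∃ R, IsBddInverse G (S₀ - w • 1) R ∧
      ‖R‖ ≤ (C + 2) / Metric.infDist w ({0} ∪ truncSector T γ p c) := by
  have hmem : ((1 / T : ℝ) : ℂ) ∈ truncSector T γ p c :=
    ofReal_mem_truncSector hp (by gcongr) (by positivity)
  rw [Set.mem_union, Set.mem_singleton_iff, not_or] at hw
  have hl : ((1 / T : ℝ) : ℂ) - w ≠ 0 := by
    intro h
    rw [sub_eq_zero] at h
    exact hw.2 (h ▸ hmem)
  obtain ⟨R, hR, hRn⟩ := hres w hw.2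
  obtain ⟨R', hR', hRn'⟩ := he.exists_resolvent hR hw.1 hl
  refine ⟨R', hR', hRn'.trans ?_⟩
  have hcl : IsClosed ({0} ∪ truncSector T γ p c) :=
    isClosed_singleton.union (isClosed_truncSector T γ p c)
  have hpos : 0 < Metric.infDist w ({0} ∪ truncSector T γ p c) :=
    (hcl.notMem_iff_infDist_pos ⟨0, Or.inl rfl⟩).1 (by simpa using hw)
  have h1 : Metric.infDist w ({0} ∪ truncSector T γ p c) ≤ ‖w‖ := by
    simpa using Metric.infDist_le_dist_of_mem
      (show (0 : ℂ) ∈ {0} ∪ truncSector T γ p c from Or.inl rfl) (x := w)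
  have h2 : Metric.infDist w ({0} ∪ truncSector T γ p c) ≤ ‖((1 / T : ℝ) : ℂ) - w‖ := by
    rw [← dist_eq_norm, dist_comm]
    exact Metric.infDist_le_dist_of_mem (Or.inr hmem)
  have h3 : Metric.infDist w ({0} ∪ truncSector T γ p c)
      ≤ Metric.infDist w (truncSector T γ p c) :=
    Metric.infDist_le_infDist_of_subset Set.subset_union_right ⟨_, hmem⟩
  have e1 : (C + 2) / Metric.infDist w ({0} ∪ truncSector T γ p c)
      = C / Metric.infDist w ({0} ∪ truncSector T γ p c)
        + (1 / Metric.infDist w ({0} ∪ truncSector T γ p c)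
          + 1 / Metric.infDist w ({0} ∪ truncSector T γ p c)) := by ring
  rw [e1]
  have h4 : C / Metric.infDist w (truncSector T γ p c)
      ≤ C / Metric.infDist w ({0} ∪ truncSector T γ p c) := by gcongr
  gcongr
  exact hRn.trans h4

variable [CompleteSpace H] {V : Type*} [NormedAddCommGroup V] [NormedSpace ℂ V] [CompleteSpace V]

/-- Analytic perturbation theory for an operator whose spectrum consists of a non-degenerate
eigenvalue `0` and a part in a truncated sector. -/
theorem exists_spectral_perturbation {A : H →ₗ.[ℂ] H} {S : V → H →L[ℂ] H} (hT : 0 < T)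
    (hγ0 : 0 < γ) (hγ1 : γ < 1) (hp : 0 < p) (hc : 0 < c) (hC : 0 < C) (hS : AnalyticAt ℂ S 0)
    (he : IsReducingKernelVector A.graph (S 0) e)
    (hres : ∀ w ∉ truncSector T γ p c,
      ∃ R, IsBddInverse A.graph (S 0 + ((1 / T : ℝ) : ℂ) • rankOne ℂ e e - w • 1) R ∧
        ‖R‖ ≤ C / Metric.infDist w (truncSector T γ p c)) :
    ∃ ε : ℝ, 0 < ε ∧
      ∃ (E : V → ℂ) (σplus : V → Set ℂ) (γ' c' : V → ℝ) (A' C' : ℝ),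
        AnalyticOnNhd ℂ E (Metric.ball 0 ε) ∧
        ∀ z : V, ‖z‖ < ε →
          spec ((S z).toLinearMap +ᵥ A) = {E z} ∪ σplus z ∧
          IsNondegenerateEigenvalue ((S z).toLinearMap +ᵥ A) (E z) ∧
          ‖E z‖ < γ / (4 * T) ∧
          σplus z ⊆ truncSector T (γ' z) p (c' z) ∧
          γ - A' * ‖z‖ ≤ γ' z ∧ γ' z ≤ γ ∧ γ / 4 < γ' z ∧
          c ≤ c' z ∧ c' z ≤ c + A' * ‖z‖ ∧
          ∀ w ∉ {E z} ∪ truncSector T (γ' z) p (c' z),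
            ∃ R, IsResolventAt ((S z).toLinearMap +ᵥ A) w R ∧
              ‖R‖ ≤ C' / Metric.infDist w ({E z} ∪ truncSector T (γ' z) p (c' z)) := by
  have h0 : (0 : ℂ) ∉ truncSector T γ p c := fun h => by
    have := h.1
    have h' : 0 < γ / T := by positivity
    simp only [Complex.zero_re] at this
    linarith
  obtain ⟨R₀, hR₀, -⟩ := hres 0 h0
  have hl : ((1 / T : ℝ) : ℂ) ≠ 0 := by exact_mod_cast (by positivity : (1 / T : ℝ) ≠ 0)
  obtain ⟨r, C₂, hr, hrρ, hC₂, E, hE⟩ := exists_eigenvalue hl hS he hR₀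
    (show 0 < γ / (4 * T) by positivity)
  obtain ⟨K, hK, hKb⟩ := hS.differentiableAt.isBigO_sub.exists_pos
  rw [Asymptotics.isBigOWith_iff] at hKb
  obtain ⟨C₁, hC₁⟩ : ∃ C₁, C₁ = C + 2 := ⟨_, rfl⟩
  have hC₁0 : 0 < C₁ := by rw [hC₁]; positivity
  obtain ⟨η, hη⟩ : ∃ η, η = min (1 / T) (p / (1 + p)) := ⟨_, rfl⟩
  have hη0 : 0 < η := by rw [hη]; exact lt_min (by positivity) (by positivity)
  -- Chosen so that enlarging the sector by `A'‖z‖` leaves distance at least `2 C₁ K ‖z‖` to the old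
  -- one, as the Neumann series with `‖S z - S 0‖ ≤ K‖z‖` requires.
  obtain ⟨A', hA'⟩ : ∃ A', A' = 2 * C₁ * K / η := ⟨_, rfl⟩
  have hA'0 : 0 < A' := by rw [hA']; positivity
  have hA'η : A' * η = 2 * C₁ * K := by rw [hA']; field_simp
  have hsmall : ∀ {a b : ℝ}, 0 < b → ∀ᶠ z in 𝓝 (0 : V), a * ‖z‖ < b := fun {a b} hb => by
    have : Tendsto (fun z : V => a * ‖z‖) (𝓝 0) (𝓝 0) :=
      Continuous.tendsto' (by fun_prop) _ _ (by simp)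
    exact this.eventually_lt_const hb
  -- The two smallness conditions keep `w` with `‖w‖ ≥ r` far enough from `0` for the Neumann
  -- series, and keep `γ - A'‖z‖ > γ/4`.
  obtain ⟨ε, hε, hball⟩ := Metric.eventually_nhds_iff.1
    (hE.and (hKb.and ((hsmall (a := 2 * C₁ * K) hr).and
      (hsmall (a := A') (show 0 < 3 * γ / 4 by positivity)))))
  refine ⟨ε, hε, E, fun z => spec ((S z).toLinearMap +ᵥ A) \ {E z}, fun z => γ - A' * ‖z‖,
    fun z => c + A' * ‖z‖, A', 4 * C₁ + C₂, fun z hz => (hball hz).1.1, fun z hz => ?_⟩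
  obtain ⟨⟨-, hEr, hEnd, hnear⟩, hSz, hz1, hz2⟩ := hball (y := z) (by simpa using hz)
  rw [sub_zero] at hSz
  have ht : 0 ≤ A' * ‖z‖ := by positivity
  have hsub := truncSector_subset (γ := γ) (c := c) hT hp ht
  have hresz : ∀ w ∉ {E z} ∪ truncSector T (γ - A' * ‖z‖) p (c + A' * ‖z‖),
      ∃ R, IsResolventAt ((S z).toLinearMap +ᵥ A) w R ∧ ‖R‖ ≤ (4 * C₁ + C₂) /
        Metric.infDist w ({E z} ∪ truncSector T (γ - A' * ‖z‖) p (c + A' * ‖z‖)) := by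
    intro w hw
    set Z := {E z} ∪ truncSector T (γ - A' * ‖z‖) p (c + A' * ‖z‖) with hZ
    have hcl : IsClosed Z := isClosed_singleton.union (isClosed_truncSector _ _ _ _)
    have hpos : 0 < Metric.infDist w Z :=
      (hcl.notMem_iff_infDist_pos ⟨E z, Or.inl rfl⟩).1 hw
    have hdE : Metric.infDist w Z ≤ ‖w - E z‖ := by
      rw [← dist_eq_norm]
      exact Metric.infDist_le_dist_of_mem (Or.inl rfl)
    have hwE : w ≠ E z := fun h => hw (Or.inl h)
    have hwS : w ∉ truncSector T (γ - A' * ‖z‖) p (c + A' * ‖z‖) := fun h => hw (Or.inr h)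
    rcases lt_or_ge ‖w‖ r with hwr | hwr
    · obtain ⟨R, hR, hRn⟩ := hnear w hwE hwr
      refine ⟨R, (isResolventAt_vadd_iff _ _ _ _).2 hR, hRn.trans ?_⟩
      gcongr
      linarith
    · have hw0 : w ∉ {0} ∪ truncSector T γ p c := by
        rintro (h | h)
        · rw [Set.mem_singleton_iff] at h
          rw [h, norm_zero] at hwr
          linarith
        · exact hwS (hsub h)
      obtain ⟨R, hR, hRn⟩ := he.exists_resolvent_le hT hγ1 hp hc hC hres hw0
      rw [← hC₁] at hRn
      set D := Metric.infDist w ({0} ∪ truncSector T γ p c) with hD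
      have hne : (({0} : Set ℂ) ∪ truncSector T γ p c).Nonempty := ⟨0, Or.inl rfl⟩
      have hDpos : 0 < D := ((isClosed_singleton.union
        (isClosed_truncSector T γ p c)).notMem_iff_infDist_pos hne).1 hw0
      have hD1 : 2 * C₁ * K * ‖z‖ ≤ D := by
        refine (Metric.le_infDist hne).2 ?_
        rintro s (hs | hs)
        · rw [Set.mem_singleton_iff.1 hs, dist_zero_right]
          linarith
        · have := mul_min_le_dist_of_notMem_truncSector hp ht hwS hs
          rw [← hη] at this
          calc 2 * C₁ * K * ‖z‖ = A' * ‖z‖ * η := by rw [← hA'η]; ring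
            _ ≤ _ := this
      -- Replacing `E z` by `0` costs a factor 2, since `‖E z‖ < r ≤ ‖w‖` gives `‖w - E z‖ ≤ 2‖w‖`.
      have hD2 : Metric.infDist w Z / 2 ≤ D := by
        refine (Metric.le_infDist hne).2 ?_
        rintro s (hs | hs)
        · rw [Set.mem_singleton_iff.1 hs, dist_zero_right]
          have := norm_sub_le w (E z)
          linarith
        · have : Metric.infDist w Z ≤ dist w s :=
            Metric.infDist_le_dist_of_mem (Or.inr (hsub hs))
          linarith
      obtain ⟨R', hR', hRn'⟩ := hR.exists_add (S := S z - S 0) (by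
        calc ‖S z - S 0‖ * ‖R‖ ≤ (K * ‖z‖) * (C₁ / D) := by gcongr
          _ = (C₁ * K * ‖z‖) / D := by ring
          _ ≤ 1 / 2 := by rw [div_le_iff₀ hDpos]; linarith)
      have e1 : S 0 - w • 1 + (S z - S 0) = S z - w • 1 := by abel
      rw [e1] at hR'
      refine ⟨R', (isResolventAt_vadd_iff _ _ _ _).2 hR', ?_⟩
      calc ‖R'‖ ≤ 2 * (C₁ / D) := by linarith
        _ ≤ 2 * (C₁ / (Metric.infDist w Z / 2)) := by gcongr
        _ = 4 * C₁ / Metric.infDist w Z := by field_simp; ring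
        _ ≤ _ := by gcongr; linarith
  refine ⟨?_, hEnd, hEr.trans_le hrρ, ?_, le_rfl, by linarith, by linarith, by linarith, le_rfl,
    hresz⟩
  · rw [Set.union_sdiff_self, Set.singleton_union, Set.insert_eq_of_mem hEnd.mem_spec]
  · rintro w ⟨hw, hwE⟩
    by_contra h
    obtain ⟨R, hR, -⟩ := hresz w (by
      rintro (h' | h')
      · exact hwE h'
      · exact h h')
    exact hw ⟨R, hR⟩

end SpectralPerturbation

/-! ### Application to `L̂_z` -/

namespace ShiftMarkovProcess

variable {d : ℕ} {Ω : Type*} [TopologicalSpace Ω] [MeasurableSpace Ω] [BorelSpace Ω]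
  {μ : Measure Ω} (X : ShiftMarkovProcess d Ω μ)

theorem analyticAt_hop (𝓚 : HoppingKernel d) (v₀ : Lp ℝ ∞ μ) : AnalyticAt ℂ (X.hop 𝓚 v₀) 0 :=
  ((X.analyticAt_Khat 𝓚).const_smul (c := Complex.I)).add analyticAt_const

theorem Lhat_eq (𝓚 : HoppingKernel d) (v₀ : Lp ℝ ∞ μ) (z : EuclideanSpace ℂ (Fin d)) :
    X.Lhat 𝓚 v₀ z = (X.hop 𝓚 v₀ z).toLinearMap +ᵥ ampliation (Fin d → ℤ) X.B := rfl

variable [IsProbabilityMeasure μ]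

theorem isReducingKernelVector_deltaOne (𝓚 : HoppingKernel d) (v₀ : Lp ℝ ∞ μ) :
    IsReducingKernelVector (ampliation (Fin d → ℤ) X.B).graph (X.hop 𝓚 v₀ 0) (deltaOne d μ) where
  norm_eq := norm_deltaOne
  mem := by
    have : X.hop 𝓚 v₀ 0 (deltaOne d μ) = 0 := by
      rw [hop, add_apply, smul_apply, smul_apply, Khat_zero_deltaOne, Vhat_deltaOne]
      simp
    rw [this, neg_zero]
    exact X.deltaOne_mem_graph
  inner_eq φ ψ h := by
    rw [mem_ampliation_graph_iff] at h
    rw [inner_add_right, inner_deltaOne, X.inner_constOne_B (h 0), hop, add_apply, smul_apply,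
      smul_apply, inner_add_right, inner_smul_right, inner_smul_right, ← X.inner_Khat_zero,
      ← X.inner_Vhat, Khat_zero_deltaOne, Vhat_deltaOne]
    simp

end ShiftMarkovProcess

end MarkovAnderson

end

open MarkovAnderson in
theorem mainTheorem5 {d : ℕ} {Ω : Type*} [TopologicalSpace Ω] [MeasurableSpace Ω] [BorelSpace Ω]
    (μ : Measure Ω) [IsProbabilityMeasure μ]
    (𝓚 : HoppingKernel d) (X : ShiftMarkovProcess d Ω μ) (v₀ : Lp ℝ ∞ μ)
    (T b q χ : ℝ) (hT : 0 < T) (hχ : 0 < χ)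
    -- gap condition on the mean-zero part of the domain of `B`
    (hgap : ∀ f : X.B.domain, ∫ ω, (f : Lp ℂ 2 μ) ω ∂μ = 0 →
      1 / T * ‖(f : Lp ℂ 2 μ)‖ ^ 2 ≤ (inner ℂ (f : Lp ℂ 2 μ) (X.B f)).re)
    -- sectoriality
    (hsector : ∀ f : X.B.domain, ∫ ω, (f : Lp ℂ 2 μ) ω ∂μ = 0 →
      |(inner ℂ (f : Lp ℂ 2 μ) (X.B f)).im|
        ≤ q * |(inner ℂ (f : Lp ℂ 2 μ) (X.B f)).re + b * ‖(f : Lp ℂ 2 μ)‖ ^ 2|)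
    -- non-degeneracy of the potential: `‖B⁻¹ (v_x - v_0)‖ ≥ χ`, where `B⁻¹` is the inverse of `B`
    -- on mean-zero functions
    (hv : ∀ x : Fin d → ℤ, x ≠ 0 → ∀ f : X.B.domain, ∫ ω, (f : Lp ℂ 2 μ) ω ∂μ = 0 →
      X.B f = mulL2 (X.v v₀ x - v₀) (constOne μ) → χ ≤ ‖(f : Lp ℂ 2 μ)‖) :
    ∃ γ p c : ℝ, 0 < γ ∧ γ < 1 ∧ 0 < p ∧ 0 < c ∧
      UnperturbedSpectrum (X.Lhat 𝓚 v₀ 0) T γ p c ∧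
      ∃ ε : ℝ, 0 < ε ∧
      ∃ (E : EuclideanSpace ℂ (Fin d) → ℂ) (σplus : EuclideanSpace ℂ (Fin d) → Set ℂ)
        (γ' c' : EuclideanSpace ℂ (Fin d) → ℝ) (A C : ℝ),
        AnalyticOnNhd ℂ E (Metric.ball 0 ε) ∧
        ∀ z : EuclideanSpace ℂ (Fin d), ‖z‖ < ε →
          spec (X.Lhat 𝓚 v₀ z) = {E z} ∪ σplus z ∧
          IsNondegenerateEigenvalue (X.Lhat 𝓚 v₀ z) (E z) ∧
          ‖E z‖ < γ / (4 * T) ∧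
          σplus z ⊆ truncSector T (γ' z) p (c' z) ∧
          γ - A * ‖z‖ ≤ γ' z ∧ γ' z ≤ γ ∧ γ / 4 < γ' z ∧
          c ≤ c' z ∧ c' z ≤ c + A * ‖z‖ ∧
          ∀ w ∉ {E z} ∪ truncSector T (γ' z) p (c' z),
            ∃ R, IsResolventAt (X.Lhat 𝓚 v₀ z) w R ∧
              ‖R‖ ≤ C / Metric.infDist w ({E z} ∪ truncSector T (γ' z) p (c' z)) := by
  have mem : ∀ {f g : Lp ℂ 2 μ}, (f, g) ∈ X.B.graph → ∃ y : X.B.domain, (y : Lp ℂ 2 μ) = f ∧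
      X.B y = g := fun h => by simpa using (LinearPMap.mem_graph_iff X.B).1 h
  have hgap' : X.HasGap T := fun f g h h0 => by
    obtain ⟨y, rfl, rfl⟩ := mem h
    exact hgap y (by rwa [← inner_constOne])
  have hsector' : X.IsSectorial b q := fun f g h h0 => by
    obtain ⟨y, rfl, rfl⟩ := mem h
    exact hsector y (by rwa [← inner_constOne])
  obtain ⟨γ, p, c, C, hγ0, hγ1, hp, hc, hC, hres⟩ :=
    ShiftMarkovProcess.exists_resolvent_lifted hgap' hsector' hT hχ 𝓚 v₀
      (fun x hx f hf h0 => by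
        obtain ⟨y, rfl, hy⟩ := mem hf
        exact hv x hx y (by rwa [← inner_constOne]) hy)
  have he := X.isReducingKernelVector_deltaOne 𝓚 v₀
  refine ⟨γ, p, c, hγ0, hγ1, hp, hc, ⟨?_, fun φ => ?_, fun w hw => ?_, C + 2, fun w hw => ?_⟩,
    exists_spectral_perturbation hT hγ0 hγ1 hp hc hC (X.analyticAt_hop 𝓚 v₀) he hres⟩
  · rw [X.Lhat_eq, mem_graph_vadd_iff, zero_sub]
    exact he.mem
  · have h := (mem_graph_vadd_iff _ (X.hop 𝓚 v₀ 0) _ _).1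
      ((X.Lhat 𝓚 v₀ 0).mem_graph φ)
    simpa using he.inner_eq _ _ h
  · by_contra hw'
    obtain ⟨R, hR, -⟩ := hres w hw'
    -- The excluded value `w = 1/T` is a point of the sector, because `γ < 1`.
    refine he.notMem_spec_partIn hR (fun h => hw' ?_) hw
    rw [← sub_eq_zero.1 h]
    exact ofReal_mem_truncSector hp (by gcongr) (by positivity)
  · obtain ⟨R, hR, hRn⟩ := he.exists_resolvent_le hT hγ1 hp hc hC hres hw
    exact ⟨R, (isResolventAt_vadd_iff _ _ _ _).2 hR, hRn⟩
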